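/- For integers $p, q \ge 1$ let $T_{p,q}$ be the torus link (a knot if $\gcd(p,q)=1$) given by its standard diagram $D_{p,q}$, the closure of the positive braid $(\sigma_1\sigma_2\cdots\sigma_{p-1})^q$ on $p$ strands. Let $\mathcal{H}^{i,j}(T_{p,q})$ be its integral Khovanov homology in homological degree $i$ and quantum degree $j$, that is, the homology of the complex $\mathcal{C}(D_{p,q}) = C(D_{p,q})[-n_-]\{n_+-2n_-\}$ obtained from the cube of resolutions of $D_{p,q}$ (where $n_\pm$ are the numbers of positive and negative crossings) by means of the graded $\mathbb{Z}$-module $V=\langle 1, X\rangle$, $\deg 1 = 1$, $\deg X=-1$, with multiplication $1\otimes 1\mapsto 1$, $1\otimes X, X\otimes 1\mapsto X$, $X\otimes X\mapsto 0$ and comultiplication $1\mapsto 1\otimes X+X\otimes 1$, $X\mapsto X\otimes X$. A diagonal of the homology is a line $j-2i=a$ that contains a point $(i,j)$ with $\operatorname{rank}\mathcal{H}^{i,j} = \dim_{\mathbb{Q}}(\mathcal{H}^{i,j}\otimes\mathbb{Q})>0$. A link is called homologically thin if its homology occupies exactly two diagonals, and homologically thick otherwise. For all integers $p, q\ge 3$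 the torus link $T_{p,q}$ is homologically thick; indeed, its Khovanov homology occupies at least three diagonals. -/

import Mathlib

open scoped TensorProduct

namespace Khovanov

/-- A braid word on `p` strands: a letter `(i, true)` is the generator `σ_{i+1}` (a positive
crossing of the neighbouring strands in positions `i` and `i + 1`, counted from `0`), and
`(i, false)` is its inverse (a negative crossing). A braid word is identified with the planar
diagram of its closure, an oriented link diagram with one crossing for every letter. -/
abbrev BraidWord (p : ℕ) : Type := List (Fin (p - 1) × Bool)

/-- The standard diagram `D_{p,q}` of the torus link `T_{p,q}`: the closure of the braid
`(σ_1 σ_2 ⋯ σ_{p-1})^q` on `p` strands. -/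
def torusBraid (p q : ℕ) : BraidWord p :=
  (List.replicate q ((List.finRange (p - 1)).map fun i => (i, true))).flatten

/-- The standard basis `1`, `X` of the graded `ℤ`-module `V`. -/
inductive Gen : Type
  | one : Gen
  | X : Gen
  deriving DecidableEq

instance : Fintype Gen := ⟨{.one, .X}, by rintro (_ | _) <;> simp⟩

/-- The grading of `V`: `deg 1 = 1` and `deg X = -1`. -/
def Gen.deg : Gen → ℤ
  | .one => 1
  | .X => -1

/-- `mulCoeff a b c` is the coefficient of `c` in `m (a ⊗ b)`, where
`m (1 ⊗ 1) = 1`, `m (1 ⊗ X) = m (X ⊗ 1) = X`, `m (X ⊗ X) = 0`. -/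
def mulCoeff : Gen → Gen → Gen → ℤ
  | .one, .one, .one => 1
  | .one, .X, .X => 1
  | .X, .one, .X => 1
  | _, _, _ => 0

/-- `comulCoeff a b c` is the coefficient of `b ⊗ c` in `Δ a`, where
`Δ 1 = 1 ⊗ X + X ⊗ 1`, `Δ X = X ⊗ X`. -/
def comulCoeff : Gen → Gen → Gen → ℤ
  | .one, .one, .X => 1
  | .one, .X, .one => 1
  | .X, .X, .X => 1
  | _, _, _ => 0

variable {p : ℕ}

/-- The number of positive crossings. -/
def nPos (w : BraidWord p) : ℕ := w.countP fun l => l.2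

/-- The number of negative crossings. -/
def nNeg (w : BraidWord p) : ℕ := w.countP fun l => !l.2

/-- A point of the diagram: `(s, k)` is the point in strand position `s` at height `k`. The
`k`-th crossing lies between the heights `k` and `k + 1`. -/
abbrev Node (w : BraidWord p) : Type := Fin p × Fin (w.length + 1)

/-- A choice of a resolution for every crossing: `false` is the 0-resolution, `true` is the
1-resolution. -/
abbrev Resolution (w : BraidWord p) : Type := Fin w.length → Bool

/-- The position of the left strand at the `k`-th crossing. -/
def leftPos (w : BraidWord p) (k : Fin w.length) : Fin p :=
  ⟨(w.get k).1.val, by have := (w.get k).1.isLt; omega⟩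

/-- The position of the right strand at the `k`-th crossing. -/
def rightPos (w : BraidWord p) (k : Fin w.length) : Fin p :=
  ⟨(w.get k).1.val + 1, by have := (w.get k).1.isLt; omega⟩

/-- Whether the resolution `ε` replaces the `k`-th crossing by two vertical strands (the
0-resolution of a positive crossing, the 1-resolution of a negative crossing) rather than by a
cap and a cup (the 1-resolution of a positive crossing, the 0-resolution of a negative one). -/
def IsVertical (w : BraidWord p) (ε : Resolution w) (k : Fin w.length) : Prop :=
  ε k = !(w.get k).2

/-- The arcs of the total resolution `D_ε` of the closed braid diagram, between points of the
diagram. -/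
inductive Arc (w : BraidWord p) (ε : Resolution w) : Node w → Node w → Prop
  /-- the closing strands -/
  | closing (s : Fin p) : Arc w ε (s, Fin.last w.length) (s, 0)
  /-- the strands that pass by a crossing -/
  | away (k : Fin w.length) (s : Fin p) (hl : s ≠ leftPos w k) (hr : s ≠ rightPos w k) :
      Arc w ε (s, k.castSucc) (s, k.succ)
  | left (k : Fin w.length) (h : IsVertical w ε k) :
      Arc w ε (leftPos w k, k.castSucc) (leftPos w k, k.succ)
  | right (k : Fin w.length) (h : IsVertical w ε k) :
      Arc w ε (rightPos w k, k.castSucc) (rightPos w k, k.succ)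
  | lower (k : Fin w.length) (h : ¬ IsVertical w ε k) :
      Arc w ε (leftPos w k, k.castSucc) (rightPos w k, k.castSucc)
  | upper (k : Fin w.length) (h : ¬ IsVertical w ε k) :
      Arc w ε (leftPos w k, k.succ) (rightPos w k, k.succ)

/-- The circles of the total resolution `D_ε`: the classes of points under the equivalence
relation generated by the arcs. -/
def Circle (w : BraidWord p) (ε : Resolution w) : Type := Quot (Arc w ε)

/-- The circle of `D_ε` through a given point. -/
def circleOf (w : BraidWord p) (ε : Resolution w) (v : Node w) : Circle w ε := Quot.mk _ v

instance (w : BraidWord p) (ε : Resolution w) : Finite (Circle w ε) :=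
  inferInstanceAs (Finite (Quot (Arc w ε)))

noncomputable instance (w : BraidWord p) (ε : Resolution w) : Fintype (Circle w ε) :=
  Fintype.ofFinite _

/-- A total resolution `D_ε` with a basis vector of `V` on each of its circles. For a fixed `ε`
these are the standard basis vectors of `V_ε`, the tensor product of copies of `V` over the
circles of `D_ε`. -/
structure EnhancedState (w : BraidWord p) : Type where
  /-- the total resolution -/
  res : Resolution w
  /-- the basis vector on each circle -/
  label : Circle w res → Gen

instance (w : BraidWord p) : Finite (EnhancedState w) :=
  Finite.of_injective
    (fun S : EnhancedState w => (⟨S.res, S.label⟩ : Σ ε : Resolution w, Circle w ε → Gen))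
    (by rintro ⟨_, _⟩ ⟨_, _⟩ h; cases h; rfl)

namespace EnhancedState

variable {w : BraidWord p}

/-- The label of the circle through a given point. -/
def labelAt (S : EnhancedState w) (v : Node w) : Gen := S.label (circleOf w S.res v)

/-- The number `|ε|` of crossings with the 1-resolution. -/
def weight (S : EnhancedState w) : ℕ := (Finset.univ.filter fun k => S.res k = true).card

/-- The homological degree `i`, after the shift by `[-n_-]`. -/
def hDeg (S : EnhancedState w) : ℤ := S.weight - nNeg w

/-- The quantum degree `j`: the degree in `V_ε{|ε|}`, after the shift by `{n_+ - 2 n_-}`. -/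
noncomputable def qDeg (S : EnhancedState w) : ℤ :=
  (∑ c, (S.label c).deg) + S.weight + (nPos w - 2 * nNeg w)

end EnhancedState

/-- The lower left point next to the `k`-th crossing. In either resolution of the crossing, this
point and the upper right one lie on different ones of the two arcs that replace the crossing. -/
def cornerA (w : BraidWord p) (k : Fin w.length) : Node w := (leftPos w k, k.castSucc)

/-- The upper right point next to the `k`-th crossing. -/
def cornerB (w : BraidWord p) (k : Fin w.length) : Node w := (rightPos w k, k.succ)

open Classical in
/-- The matrix coefficient from `S` to `T` of the per-edge map that changes the resolution of the
`k`-th crossing from 0 to 1: it is the multiplication if two different circles of `S` meet at the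
crossing (they merge), the comultiplication if only one circle does (it splits), and the identity
on all circles that do not pass the crossing. -/
noncomputable def edgeCoeff {w : BraidWord p} (k : Fin w.length) (S T : EnhancedState w) : ℤ :=
  if S.res k = false ∧ T.res = Function.update S.res k true ∧
      (∀ v : Node w, circleOf w S.res v ≠ circleOf w S.res (cornerA w k) →
        circleOf w S.res v ≠ circleOf w S.res (cornerB w k) → T.labelAt v = S.labelAt v) then
    if circleOf w S.res (cornerA w k) ≠ circleOf w S.res (cornerB w k) then
      mulCoeff (S.labelAt (cornerA w k)) (S.labelAt (cornerB w k)) (T.labelAt (cornerA w k))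
    else
      comulCoeff (S.labelAt (cornerA w k)) (T.labelAt (cornerA w k)) (T.labelAt (cornerB w k))
  else 0

/-- The matrix coefficient from `S` to `T` of the differential: the sum of the per-edge maps with
the sign given by the number of 1-resolutions before the changed crossing. -/
noncomputable def diffCoeff {w : BraidWord p} (S T : EnhancedState w) : ℤ :=
  ∑ k : Fin w.length,
    (-1) ^ (Finset.univ.filter fun l => l < k ∧ S.res l = true).card * edgeCoeff k S T

/-- The basis of the chain group in homological degree `i` and quantum degree `j`. -/
abbrev ChainBasis (w : BraidWord p) (i j : ℤ) : Type :=
  {S : EnhancedState w // S.hDeg = i ∧ S.qDeg = j}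

noncomputable instance (w : BraidWord p) (i j : ℤ) : Fintype (ChainBasis w i j) :=
  Fintype.ofFinite _

/-- The chain group in homological degree `i` and quantum degree `j`, a free `ℤ`-module of finite
rank. -/
abbrev Chain (w : BraidWord p) (i j : ℤ) : Type := ChainBasis w i j → ℤ

/-- The differential from homological degree `i` to `i'` (meant for `i' = i + 1`; it preserves the
quantum degree `j`). -/
noncomputable def diff (w : BraidWord p) (i i' j : ℤ) : Chain w i j →ₗ[ℤ] Chain w i' j :=
  Matrix.mulVecLin (Matrix.of fun T S => diffCoeff S.1 T.1)

/-- The cycles in bidegree `(i, j)`. -/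
noncomputable abbrev cycles (w : BraidWord p) (i j : ℤ) : Submodule ℤ (Chain w i j) :=
  LinearMap.ker (diff w i (i + 1) j)

/-- The boundaries in bidegree `(i, j)`. -/
noncomputable abbrev boundaries (w : BraidWord p) (i j : ℤ) : Submodule ℤ (Chain w i j) :=
  LinearMap.range (diff w (i - 1) i j)

/-- The Khovanov homology group `ℋ^{i,j}` of the closure of the braid `w`: cycles modulo
boundaries. -/
abbrev Homology (w : BraidWord p) (i j : ℤ) : Type :=
  cycles w i j ⧸ (boundaries w i j).submoduleOf (cycles w i j)

/-- The rank of `ℋ^{i,j}`, the dimension of `ℋ^{i,j} ⊗ ℚ`. -/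
noncomputable def homologyRank (w : BraidWord p) (i j : ℤ) : ℕ :=
  Module.finrank ℚ (ℚ ⊗[ℤ] Homology w i j)

/-- The diagonals occupied by the homology: the integers `a` such that the line `j - 2 i = a`
contains a point `(i, j)` with `ℋ^{i,j}` of positive rank. -/
def diagonals (w : BraidWord p) : Set ℤ :=
  {a | ∃ i j : ℤ, j - 2 * i = a ∧ 0 < homologyRank w i j}

/-- Homologically thin: the homology occupies exactly two diagonals. -/
def IsHThin (w : BraidWord p) : Prop := (diagonals w).encard = 2

/-- Homologically thick: not homologically thin. -/
def IsHThick (w : BraidWord p) : Prop := ¬ IsHThin w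

end Khovanov

/-!
Write `d = q (p - 1) - p`. The diagonals `d` and `d + 2` carry homology in homological degree `0`,
and the diagonal `d - 2` carries homology in degree `4`, in a bidegree which relative to `d` is the
same for all `p, q ≥ 3`.

Quantum degrees are normalized: the `level` of a state is `qDeg - d` for the torus braid
(`qDeg_eq_level`). In degree `0`, the state with all circles labelled `X` (level `0`) and the
alternating sum of the states with exactly one strand labelled `1` (level `2`) are cycles, because
a crossing merges two different strands; nothing bounds in degree `0`
(`homologyRank_zero_pos_lower`, `homologyRank_zero_pos_upper`).

The class in degree `4` and level `6` is found by an algebraic version of discrete Morse theory on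
the complex of all states of level `6`. A set of states is `Matched` if it falls into two parts such
that the component of the differential from the first to the second is an isomorphism; matched sets
can be put together along a filtration (`Matched.union`). Two facts make the matching possible.

* Each column of crossings in which a 1-resolution occurs forces a merge of circles, so that the
  level is at least twice the sum of the number of such columns and the number of circles labelled
  `1` (`le_level`). Most families of states of level `6` with prescribed resolutions
  and labels are therefore empty.
* When two crossings cut off a small circle (a `tube`), the families can be reduced by matching
  states across a merge or a split, as in the proof of invariance under Reidemeister moves
  (`matched_of_kink`, `matched_of_merging_kink`, `matched_of_slide`).

Branching over the crossings, from the last column to the first and from the last row to the first,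
and reducing each branch until it is empty matches all states of level `6` (`matched_level_six`)
except for a single critical state in degree `4` (`exists_critical`) and a quotient complex, the
`residual` states, which is the complex of the torus link `T_{2,3}` on the first two strands. The
critical state can be completed to a cycle by matched states, since no differential leads from
either of them to the residual states. A multiple of this cycle could only bound by a chain with a
residual part in degree `3`. There, the homology of the residual complex is the 2-torsion of the
trefoil (`residual_surjective`), so that twice such a chain can be changed by a boundary to consist
of matched states alone, and the matching excludes it (`exists_cycle_of_matched`,
`homologyRank_four_pos`).

This argument needs that the square of the differential is zero. The circles of a resolution are the
cycles of a permutation of the points of the diagram: strands in even positions are oriented upwards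
and those in odd positions downwards, and this orientation is compatible with all resolutions.
Changing the resolution of one crossing composes this permutation with a transposition, hence either
merges two circles or splits one (`circleOf_corner_change`). The module of a resolution is a tensor
power of `ℤ[X]/(X²)`, which is handled by its points `ξ` in commutative rings: along an edge of the
cube, the differential is the multiplication by a `factor` (`1` for a merge and
`ξ(a) + ξ(b)` for a split) followed by an identification of variables. Commutativity of the faces of
the cube is thereby reduced to the identity `factor_comm`.
-/


namespace Equiv.Perm

/-! ### The cycles of a permutation composed with a transposition -/

variable {α : Type*} [Finite α] {σ : Perm α} {x y : α}

theorem SameCycle.mem_of_mapsTo {O : Set α} (hO : ∀ v ∈ O, σ v ∈ O) {v u : α}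
    (h : SameCycle σ v u) (hv : v ∈ O) : u ∈ O := by
  obtain ⟨n, rfl⟩ := h.exists_nat_pow_eq
  clear h
  induction n with
  | zero => simpa
  | succ n ih => rw [pow_succ', mul_apply]; exact hO _ ih

variable [DecidableEq α]

/-- Composing a permutation with a transposition of two points of one cycle splits the cycle: the
points `σ x, σ² x, …, y` become a union of cycles that avoids `x`. -/
theorem not_sameCycle_mul_swap (hxy : x ≠ y) (h : SameCycle σ x y) :
    ¬ SameCycle (σ * swap x y) x y := by
  have hex : ∃ n, 0 < n ∧ (σ ^ n) x = y := by
    obtain ⟨n, hn⟩ := h.exists_nat_pow_eq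
    refine ⟨n, Nat.pos_of_ne_zero ?_, hn⟩
    rintro rfl
    exact hxy (by simpa using hn)
  classical
  obtain ⟨hn0, hn⟩ := Nat.find_spec hex
  set n := Nat.find hex with hndef
  have hmin : ∀ m, 0 < m → m < n → (σ ^ m) x ≠ y := fun m h0 hm h' =>
    Nat.find_min hex hm ⟨h0, h'⟩
  have hx : ∀ j, 0 < j → j ≤ n → (σ ^ j) x ≠ x := by
    intro j h0 hj hjx
    rcases hj.eq_or_lt with rfl | hj
    · exact hxy (hjx.symm.trans hn)
    · refine hmin (n - j) (by omega) (by omega) ?_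
      rw [← hn]
      conv_rhs => rw [show n = (n - j) + j by omega, pow_add, mul_apply, hjx]
  intro hc
  have : x ∈ {v | ∃ j, 0 < j ∧ j ≤ n ∧ (σ ^ j) x = v} := by
    refine SameCycle.mem_of_mapsTo ?_ hc.symm ⟨n, hn0, le_rfl, hn⟩
    rintro v ⟨j, h0, hj, rfl⟩
    rcases hj.eq_or_lt with rfl | hj
    · exact ⟨1, one_pos, hn0, by simp [hn]⟩
    · refine ⟨j + 1, by omega, hj, ?_⟩
      rw [mul_apply, swap_apply_of_ne_of_ne (hx j h0 hj.le) (hmin j h0 hj), pow_succ', mul_apply]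
  obtain ⟨j, h0, hj, hjx⟩ := this
  exact hx j h0 hj hjx

/-- Composing a permutation with a transposition of points of two cycles joins the cycles. -/
theorem sameCycle_mul_swap (h : ¬ SameCycle σ x y) : SameCycle (σ * swap x y) x y := by
  have hxy : x ≠ y := fun e => h (e ▸ SameCycle.refl _ _)
  by_contra hc
  -- otherwise the cycle of `σ y` under the new permutation never reaches `x` or `y`
  have h1 : SameCycle (σ * swap x y) x (σ y) := by
    have : (σ * swap x y) x = σ y := by simp
    rw [← this, sameCycle_apply_right]
  have : ∀ n : ℕ, SameCycle (σ * swap x y) x ((σ ^ (n + 1)) y) := by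
    intro n
    induction n with
    | zero => simpa using h1
    | succ n ih =>
      have hy : (σ ^ (n + 1)) y ≠ y := fun e => by rw [e] at ih; exact hc ih
      have hx : (σ ^ (n + 1)) y ≠ x := fun e =>
        h (SameCycle.symm ⟨(n + 1 : ℕ), by rw [zpow_natCast, e]⟩)
      have : (σ * swap x y) ((σ ^ (n + 1)) y) = (σ ^ (n + 1 + 1)) y := by
        rw [mul_apply, swap_apply_of_ne_of_ne hx hy, pow_succ' σ (n + 1), mul_apply]
      rw [← this, sameCycle_apply_right]
      exact ih
  obtain ⟨n, hn⟩ := (isOfFinOrder_of_finite σ).exists_pow_eq_one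
  have := this (n - 1)
  rw [Nat.sub_add_cancel hn.1, hn.2] at this
  exact hc this

theorem sameCycle_mul_swap_iff (hxy : x ≠ y) :
    SameCycle (σ * swap x y) x y ↔ ¬ SameCycle σ x y :=
  ⟨fun h h' => not_sameCycle_mul_swap hxy h' h, sameCycle_mul_swap⟩

/-- The cycles after joining two cycles. -/
theorem sameCycle_mul_swap_iff_of_not (h : ¬ SameCycle σ x y) (v u : α) :
    SameCycle (σ * swap x y) v u ↔ SameCycle σ v u ∨ (SameCycle σ v x ∧ SameCycle σ u y) ∨
      (SameCycle σ v y ∧ SameCycle σ u x) := by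
  have hτ := sameCycle_mul_swap h
  constructor
  · intro hvu
    refine SameCycle.mem_of_mapsTo (O := {u | SameCycle σ v u ∨ (SameCycle σ v x ∧ SameCycle σ u y) ∨
      (SameCycle σ v y ∧ SameCycle σ u x)}) ?_ hvu (Or.inl (SameCycle.refl _ _))
    intro u hu
    simp only [Set.mem_ofPred_eq, mul_apply, sameCycle_apply_right, sameCycle_apply_left] at hu ⊢
    by_cases hux : u = x
    · subst hux
      rw [swap_apply_left]
      have := SameCycle.refl σ y
      have := SameCycle.refl σ u
      tauto
    by_cases huy : u = y
    · subst huy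
      rw [swap_apply_right]
      have := SameCycle.refl σ x
      have := SameCycle.refl σ u
      tauto
    rwa [swap_apply_of_ne_of_ne hux huy]
  · have hstep : ∀ v, SameCycle (σ * swap x y) v (σ v) := by
      intro v
      have h1 : SameCycle (σ * swap x y) v (swap x y v) := by
        by_cases hvx : v = x
        · subst hvx; rwa [swap_apply_left]
        by_cases hvy : v = y
        · subst hvy; rw [swap_apply_right]; exact hτ.symm
        rw [swap_apply_of_ne_of_ne hvx hvy]
      have h2 : (σ * swap x y) (swap x y v) = σ v := by simp
      rw [← h2, sameCycle_apply_right]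
      exact h1
    have hle : ∀ {v u}, SameCycle σ v u → SameCycle (σ * swap x y) v u := fun {v u} hvu =>
      SameCycle.mem_of_mapsTo (O := {u | SameCycle (σ * swap x y) v u})
        (fun u hu => SameCycle.trans hu (hstep u)) hvu (SameCycle.refl _ _)
    rintro (h1 | ⟨h1, h2⟩ | ⟨h1, h2⟩)
    · exact hle h1
    · exact (hle h1).trans (hτ.trans (hle h2).symm)
    · exact (hle h1).trans (hτ.symm.trans (hle h2).symm)

end Equiv.Perm

namespace Khovanov

variable {p : ℕ} {w : BraidWord p}

open Equiv Equiv.Perm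

/-! ### The circles of a resolution as the cycles of a permutation -/

/-- The crossing that is met on leaving a point along the orientation which runs upwards in the
even strand positions and downwards in the odd ones. Every resolution is compatible with this
orientation, since caps and cups join neighbouring positions. -/
def nextCrossing (v : Node w) : Option (Fin w.length) :=
  if v.1.val % 2 = 0 then
    if h : v.2.val < w.length then some ⟨v.2.val, h⟩ else none
  else
    if h : 0 < v.2.val then some ⟨v.2.val - 1, by have := v.2.isLt; omega⟩ else none

/-- The point on the left strand from which the orientation enters the crossing `k`. -/
def inLeft (k : Fin w.length) : Node w :=
  (leftPos w k, if (leftPos w k).val % 2 = 0 then k.castSucc else k.succ)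

/-- The point on the right strand from which the orientation enters the crossing `k`. -/
def inRight (k : Fin w.length) : Node w :=
  (rightPos w k, if (leftPos w k).val % 2 = 0 then k.succ else k.castSucc)

theorem rightPos_val (k : Fin w.length) : (rightPos w k).val = (leftPos w k).val + 1 := rfl

theorem leftPos_ne_rightPos (k : Fin w.length) : leftPos w k ≠ rightPos w k := by
  intro h; have := congrArg Fin.val h; rw [rightPos_val] at this; omega

theorem inLeft_ne_inRight (k : Fin w.length) : inLeft k ≠ inRight k := fun h =>
  leftPos_ne_rightPos k (congrArg Prod.fst h)

theorem nextCrossing_inLeft (k : Fin w.length) : nextCrossing (inLeft k) = some k := by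
  unfold nextCrossing inLeft
  by_cases h : (leftPos w k).val % 2 = 0
  · simp [h]
  · simp [h]

theorem nextCrossing_inRight (k : Fin w.length) : nextCrossing (inRight k) = some k := by
  unfold nextCrossing inRight
  by_cases h : (leftPos w k).val % 2 = 0
  · have : ((rightPos w k).val) % 2 = 1 := by rw [rightPos_val]; omega
    simp [h, this]
  · have : ((rightPos w k).val) % 2 = 0 := by rw [rightPos_val]; omega
    simp [h, this]

theorem nextCrossing_swap (k : Fin w.length) (v : Node w) :
    nextCrossing (swap (inLeft k) (inRight k) v) = some k ↔ nextCrossing v = some k := by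
  by_cases h1 : v = inLeft k
  · subst h1; simp [nextCrossing_inLeft, nextCrossing_inRight]
  by_cases h2 : v = inRight k
  · subst h2; simp [nextCrossing_inLeft, nextCrossing_inRight]
  rw [swap_apply_of_ne_of_ne h1 h2]

open Classical in
/-- Exchange of the two points that enter a crossing, at all crossings that are resolved by a cap
and a cup. -/
noncomputable def turnFun (ε : Resolution w) (v : Node w) : Node w :=
  match nextCrossing v with
  | none => v
  | some k => if IsVertical w ε k then v else swap (inLeft k) (inRight k) v

theorem turnFun_none {ε : Resolution w} {v : Node w} (h : nextCrossing v = none) :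
    turnFun ε v = v := by unfold turnFun; rw [h]

theorem turnFun_vertical {ε : Resolution w} {v : Node w} {k} (h : nextCrossing v = some k)
    (hk : IsVertical w ε k) : turnFun ε v = v := by
  unfold turnFun; rw [h]; simp [hk]

theorem turnFun_horizontal {ε : Resolution w} {v : Node w} {k} (h : nextCrossing v = some k)
    (hk : ¬ IsVertical w ε k) : turnFun ε v = swap (inLeft k) (inRight k) v := by
  unfold turnFun; rw [h]; simp [hk]

theorem turnFun_involutive (ε : Resolution w) : Function.Involutive (turnFun ε) := by
  intro v
  rcases h : nextCrossing v with _ | k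
  · rw [turnFun_none h, turnFun_none h]
  · by_cases hk : IsVertical w ε k
    · rw [turnFun_vertical h hk, turnFun_vertical h hk]
    · rw [turnFun_horizontal h hk, turnFun_horizontal ((nextCrossing_swap k v).2 h) hk]
      simp

/-- One step along the closed vertical strands, upwards in the even positions and downwards in the
odd ones. The points of a strand are numbered from `0` to the length of the word, and its two ends
are joined by an arc of the closure. -/
def strandStep (w : BraidWord p) : Perm (Node w) :=
  Equiv.prodShear (Equiv.refl _) fun s =>
    if s.val % 2 = 0 then finRotate (w.length + 1) else (finRotate (w.length + 1)).symm

/-- The permutation of the points of the diagram whose cycles are the circles of `D_ε`. -/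
noncomputable def succPerm (ε : Resolution w) : Perm (Node w) :=
  strandStep w * (turnFun_involutive ε).toPerm

theorem succPerm_apply (ε : Resolution w) (v : Node w) :
    succPerm ε v = strandStep w (turnFun ε v) := rfl

theorem strandStep_even_castSucc {s : Fin p} (hs : s.val % 2 = 0) (k : Fin w.length) :
    strandStep w (s, k.castSucc) = (s, k.succ) := by
  simp [strandStep, hs]

theorem strandStep_even_last {s : Fin p} (hs : s.val % 2 = 0) :
    strandStep w (s, Fin.last _) = (s, 0) := by
  simp [strandStep, hs]

theorem strandStep_odd_succ {s : Fin p} (hs : ¬ s.val % 2 = 0) (k : Fin w.length) :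
    strandStep w (s, k.succ) = (s, k.castSucc) := by
  have : (finRotate (w.length + 1)).symm k.succ = k.castSucc := by
    rw [Equiv.symm_apply_eq]; simp
  simp only [strandStep, hs, Equiv.prodShear_apply, Equiv.refl_apply, if_false, this]

theorem strandStep_odd_zero {s : Fin p} (hs : ¬ s.val % 2 = 0) :
    strandStep w (s, 0) = (s, Fin.last _) := by
  have : (finRotate (w.length + 1)).symm 0 = Fin.last _ := by
    rw [Equiv.symm_apply_eq]; simp
  simp only [strandStep, hs, Equiv.prodShear_apply, Equiv.refl_apply, if_false, this]

theorem strandStep_inLeft (k : Fin w.length) : strandStep w (inLeft k) =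
    (leftPos w k, if (leftPos w k).val % 2 = 0 then k.succ else k.castSucc) := by
  unfold inLeft
  by_cases h : (leftPos w k).val % 2 = 0
  · simp only [h, if_true, strandStep_even_castSucc]
  · simp only [h, if_false]; rw [strandStep_odd_succ h]

theorem strandStep_inRight (k : Fin w.length) : strandStep w (inRight k) =
    (rightPos w k, if (leftPos w k).val % 2 = 0 then k.castSucc else k.succ) := by
  unfold inRight
  by_cases h : (leftPos w k).val % 2 = 0
  · have : ¬ ((rightPos w k).val) % 2 = 0 := by rw [rightPos_val]; omega
    simp only [h, if_true]; rw [strandStep_odd_succ this]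
  · have : ((rightPos w k).val) % 2 = 0 := by rw [rightPos_val]; omega
    simp only [h, if_false]; rw [strandStep_even_castSucc this]

theorem succPerm_vertical {ε : Resolution w} {v : Node w} {k} (h : nextCrossing v = some k)
    (hk : IsVertical w ε k) : succPerm ε v = strandStep w v := by
  rw [succPerm_apply, turnFun_vertical h hk]

theorem succPerm_inLeft {ε : Resolution w} {k} (hk : ¬ IsVertical w ε k) :
    succPerm ε (inLeft k) = strandStep w (inRight k) := by
  rw [succPerm_apply, turnFun_horizontal (nextCrossing_inLeft k) hk, swap_apply_left]

theorem succPerm_inRight {ε : Resolution w} {k} (hk : ¬ IsVertical w ε k) :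
    succPerm ε (inRight k) = strandStep w (inLeft k) := by
  rw [succPerm_apply, turnFun_horizontal (nextCrossing_inRight k) hk, swap_apply_right]

theorem circleOf_of_arc {ε : Resolution w} {u v : Node w} (h : Arc w ε u v) :
    circleOf w ε u = circleOf w ε v := Quot.sound h

theorem nextCrossing_even_castSucc {s : Fin p} (hs : s.val % 2 = 0) (k : Fin w.length) :
    nextCrossing (w := w) (s, k.castSucc) = some k := by simp [nextCrossing, hs]

theorem nextCrossing_odd_succ {s : Fin p} (hs : ¬ s.val % 2 = 0) (k : Fin w.length) :
    nextCrossing (w := w) (s, k.succ) = some k := by simp [nextCrossing, hs]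

theorem eq_or_eq_of_nextCrossing {v : Node w} {k : Fin w.length} (h : nextCrossing v = some k) :
    (v.1.val % 2 = 0 ∧ v.2 = k.castSucc) ∨ (¬ v.1.val % 2 = 0 ∧ v.2 = k.succ) := by
  unfold nextCrossing at h
  split_ifs at h with h1 h2 h2
  · left
    simp only [Option.some.injEq] at h
    subst h
    exact ⟨h1, rfl⟩
  · right
    simp only [Option.some.injEq] at h
    subst h
    refine ⟨h1, Fin.ext ?_⟩
    simp only [Fin.val_succ]; omega

theorem eq_or_eq_of_nextCrossing_none {v : Node w} (h : nextCrossing v = none) :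
    (v.1.val % 2 = 0 ∧ v.2 = Fin.last _) ∨ (¬ v.1.val % 2 = 0 ∧ v.2 = 0) := by
  unfold nextCrossing at h
  split_ifs at h with h1 h2 h2
  · left
    refine ⟨h1, Fin.ext ?_⟩
    have := v.2.isLt
    simp only [Fin.val_last]; omega
  · right
    refine ⟨h1, Fin.ext ?_⟩
    simp only [Fin.val_zero]; omega

theorem circleOf_succPerm (ε : Resolution w) (v : Node w) :
    circleOf w ε (succPerm ε v) = circleOf w ε v := by
  obtain ⟨s, h⟩ := v
  rcases hn : nextCrossing (s, h) with _ | k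
  · rw [succPerm_apply, turnFun_none hn]
    rcases eq_or_eq_of_nextCrossing_none hn with ⟨hs, rfl⟩ | ⟨hs, rfl⟩
    · rw [strandStep_even_last hs]
      exact (circleOf_of_arc (Arc.closing s)).symm
    · rw [strandStep_odd_zero hs]
      exact circleOf_of_arc (Arc.closing s)
  · have hcase := eq_or_eq_of_nextCrossing hn
    dsimp only at hcase
    by_cases hl : s = leftPos w k
    · have hv : (s, h) = inLeft k := by
        subst hl
        rcases hcase with ⟨hs, rfl⟩ | ⟨hs, rfl⟩ <;> simp [inLeft, hs]
      rw [hv]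
      by_cases hk : IsVertical w ε k
      · rw [succPerm_vertical (nextCrossing_inLeft k) hk, strandStep_inLeft]
        unfold inLeft
        by_cases hs : (leftPos w k).val % 2 = 0
        · simp only [hs, if_true]; exact (circleOf_of_arc (Arc.left k hk)).symm
        · simp only [hs, if_false]; exact circleOf_of_arc (Arc.left k hk)
      · rw [succPerm_inLeft hk, strandStep_inRight]
        unfold inLeft
        by_cases hs : (leftPos w k).val % 2 = 0
        · simp only [hs, if_true]; exact (circleOf_of_arc (Arc.lower k hk)).symm
        · simp only [hs, if_false]; exact (circleOf_of_arc (Arc.upper k hk)).symm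
    by_cases hr : s = rightPos w k
    · have hv : (s, h) = inRight k := by
        subst hr
        rw [rightPos_val] at hcase
        rcases hcase with ⟨hs, rfl⟩ | ⟨hs, rfl⟩
        · have : ¬ (leftPos w k).val % 2 = 0 := by omega
          simp [inRight, this]
        · have : (leftPos w k).val % 2 = 0 := by omega
          simp [inRight, this]
      rw [hv]
      by_cases hk : IsVertical w ε k
      · rw [succPerm_vertical (nextCrossing_inRight k) hk, strandStep_inRight]
        unfold inRight
        by_cases hs : (leftPos w k).val % 2 = 0
        · simp only [hs, if_true]; exact circleOf_of_arc (Arc.right k hk)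
        · simp only [hs, if_false]; exact (circleOf_of_arc (Arc.right k hk)).symm
      · rw [succPerm_inRight hk, strandStep_inLeft]
        unfold inRight
        by_cases hs : (leftPos w k).val % 2 = 0
        · simp only [hs, if_true]; exact circleOf_of_arc (Arc.upper k hk)
        · simp only [hs, if_false]; exact circleOf_of_arc (Arc.lower k hk)
    have hturn : turnFun ε (s, h) = (s, h) := by
      by_cases hk : IsVertical w ε k
      · exact turnFun_vertical hn hk
      · rw [turnFun_horizontal hn hk, swap_apply_of_ne_of_ne]
        · intro e; exact hl (congrArg Prod.fst e)
        · intro e; exact hr (congrArg Prod.fst e)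
    rw [succPerm_apply, hturn]
    rcases hcase with ⟨hs, rfl⟩ | ⟨hs, rfl⟩
    · rw [strandStep_even_castSucc hs]; exact (circleOf_of_arc (Arc.away k s hl hr)).symm
    · rw [strandStep_odd_succ hs]; exact circleOf_of_arc (Arc.away k s hl hr)

theorem sameCycle_of_arc {ε : Resolution w} {u v : Node w} (h : Arc w ε u v) :
    SameCycle (succPerm ε) u v := by
  have key : ∀ u v, succPerm ε u = v → SameCycle (succPerm ε) u v := by
    rintro u v rfl; rw [sameCycle_apply_right]
  rcases h with s | ⟨k, s, hl, hr⟩ | ⟨k, hk⟩ | ⟨k, hk⟩ | ⟨k, hk⟩ | ⟨k, hk⟩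
  · by_cases hs : s.val % 2 = 0
    · apply key
      rw [succPerm_apply, turnFun_none (by simp [nextCrossing, hs]), strandStep_even_last hs]
    · refine (key _ _ ?_).symm
      rw [succPerm_apply, turnFun_none (by simp [nextCrossing, hs]), strandStep_odd_zero hs]
  · have hturn : ∀ h, nextCrossing (w := w) (s, h) = some k → turnFun ε (s, h) = (s, h) := by
      intro h hn
      by_cases hk : IsVertical w ε k
      · exact turnFun_vertical hn hk
      · rw [turnFun_horizontal hn hk, swap_apply_of_ne_of_ne]
        · intro e; exact hl (congrArg Prod.fst e)
        · intro e; exact hr (congrArg Prod.fst e)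
    by_cases hs : s.val % 2 = 0
    · apply key
      rw [succPerm_apply, hturn _ (nextCrossing_even_castSucc hs k), strandStep_even_castSucc hs]
    · refine (key _ _ ?_).symm
      rw [succPerm_apply, hturn _ (nextCrossing_odd_succ hs k), strandStep_odd_succ hs]
  · have := key _ _ (succPerm_vertical (nextCrossing_inLeft k) hk)
    rw [strandStep_inLeft, inLeft] at this
    by_cases hs : (leftPos w k).val % 2 = 0
    · simpa only [hs, if_true] using this
    · simpa only [hs, if_false] using this.symm
  · have := key _ _ (succPerm_vertical (nextCrossing_inRight k) hk)
    rw [strandStep_inRight, inRight] at this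
    by_cases hs : (leftPos w k).val % 2 = 0
    · simpa only [hs, if_true] using this.symm
    · simpa only [hs, if_false] using this
  · by_cases hs : (leftPos w k).val % 2 = 0
    · have := key _ _ (succPerm_inLeft hk)
      rw [strandStep_inRight, inLeft] at this
      simpa only [hs, if_true] using this
    · have := key _ _ (succPerm_inRight hk)
      rw [strandStep_inLeft, inRight] at this
      simpa only [hs, if_false] using this.symm
  · by_cases hs : (leftPos w k).val % 2 = 0
    · have := key _ _ (succPerm_inRight hk)
      rw [strandStep_inLeft, inRight] at this
      simpa only [hs, if_true] using this.symm
    · have := key _ _ (succPerm_inLeft hk)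
      rw [strandStep_inRight, inLeft] at this
      simpa only [hs, if_false] using this

/-- The circles are the cycles of `succPerm`. -/
theorem circleOf_eq_iff {ε : Resolution w} {u v : Node w} :
    circleOf w ε u = circleOf w ε v ↔ SameCycle (succPerm ε) u v := by
  constructor
  · intro h
    have := Quot.eqvGen_exact h
    clear h
    induction this with
    | rel _ _ h => exact sameCycle_of_arc h
    | refl => exact SameCycle.refl _ _
    | symm _ _ _ ih => exact ih.symm
    | trans _ _ _ _ _ ih1 ih2 => exact ih1.trans ih2
  · intro h
    exact (SameCycle.mem_of_mapsTo (O := {v | circleOf w ε u = circleOf w ε v})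
      (fun v hv => Eq.trans hv (circleOf_succPerm ε v).symm) h rfl)

/-- Changing the resolution of one crossing composes `succPerm` with a transposition. -/
theorem succPerm_change {ε ε' : Resolution w} {k : Fin w.length}
    (h : ∀ l, l ≠ k → ε' l = ε l) (hk : ε' k ≠ ε k) :
    succPerm ε' = succPerm ε * swap (inLeft k) (inRight k) := by
  ext1 v
  rw [succPerm_apply, mul_apply, succPerm_apply]
  congr 1
  rcases hn : nextCrossing v with _ | l
  · rw [turnFun_none hn, swap_apply_of_ne_of_ne, turnFun_none hn]
    · rintro rfl; simp [nextCrossing_inLeft] at hn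
    · rintro rfl; simp [nextCrossing_inRight] at hn
  by_cases hl : l = k
  · subst hl
    have hn' := (nextCrossing_swap l v).2 hn
    by_cases hv : IsVertical w ε l
    · have hv' : ¬ IsVertical w ε' l := fun h' => hk (h'.trans hv.symm)
      rw [turnFun_horizontal hn hv', turnFun_vertical hn' hv]
    · have hv' : IsVertical w ε' l := by
        unfold IsVertical at hv ⊢
        revert hk hv
        cases ε' l <;> cases ε l <;> cases (w.get l).2 <;> simp
      rw [turnFun_vertical hn hv', turnFun_horizontal hn' hv, swap_apply_self]
  · rw [swap_apply_of_ne_of_ne]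
    · have hiff : IsVertical w ε' l ↔ IsVertical w ε l := by
        unfold IsVertical; rw [h l hl]
      by_cases hv : IsVertical w ε l
      · rw [turnFun_vertical hn hv, turnFun_vertical hn (hiff.2 hv)]
      · rw [turnFun_horizontal hn hv, turnFun_horizontal hn (fun h => hv (hiff.1 h))]
    · rintro rfl; simp [nextCrossing_inLeft] at hn; exact hl hn.symm
    · rintro rfl; simp [nextCrossing_inRight] at hn; exact hl hn.symm

/-- The points that enter a crossing lie on the circles of its two corners. -/
theorem circleOf_inLeft_inRight (ε : Resolution w) (k : Fin w.length) :
    (circleOf w ε (inLeft k) = circleOf w ε (cornerA w k) ∧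
      circleOf w ε (inRight k) = circleOf w ε (cornerB w k)) ∨
    (circleOf w ε (inLeft k) = circleOf w ε (cornerB w k) ∧
      circleOf w ε (inRight k) = circleOf w ε (cornerA w k)) := by
  unfold inLeft inRight cornerA cornerB
  by_cases hs : (leftPos w k).val % 2 = 0
  · simp [hs]
  · simp only [hs, if_false]
    by_cases hk : IsVertical w ε k
    · exact Or.inl ⟨(circleOf_of_arc (Arc.left k hk)).symm, circleOf_of_arc (Arc.right k hk)⟩
    · exact Or.inr ⟨circleOf_of_arc (Arc.upper k hk), (circleOf_of_arc (Arc.lower k hk)).symm⟩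

/-- Changing the resolution of a crossing either merges or splits circles: the two corners lie on
one circle for exactly one of the two resolutions. -/
theorem circleOf_corner_change {ε ε' : Resolution w} {k : Fin w.length}
    (h : ∀ l, l ≠ k → ε' l = ε l) (hk : ε' k ≠ ε k) :
    circleOf w ε' (cornerA w k) = circleOf w ε' (cornerB w k) ↔
      circleOf w ε (cornerA w k) ≠ circleOf w ε (cornerB w k) := by
  have key : ∀ ε : Resolution w, circleOf w ε (cornerA w k) = circleOf w ε (cornerB w k) ↔
      SameCycle (succPerm ε) (inLeft k) (inRight k) := by
    intro ε
    rw [← circleOf_eq_iff]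
    rcases circleOf_inLeft_inRight ε k with ⟨h1, h2⟩ | ⟨h1, h2⟩ <;> rw [h1, h2]
    exact eq_comm
  rw [Ne, key, key, succPerm_change h hk]
  exact sameCycle_mul_swap_iff (inLeft_ne_inRight k)

/-- The circles after a merge. -/
theorem circleOf_merge {ε ε' : Resolution w} {k : Fin w.length}
    (h : ∀ l, l ≠ k → ε' l = ε l) (hk : ε' k ≠ ε k)
    (hne : circleOf w ε (cornerA w k) ≠ circleOf w ε (cornerB w k)) (v u : Node w) :
    circleOf w ε' v = circleOf w ε' u ↔ circleOf w ε v = circleOf w ε u ∨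
      (circleOf w ε v = circleOf w ε (cornerA w k) ∧ circleOf w ε u = circleOf w ε (cornerB w k)) ∨
      (circleOf w ε v = circleOf w ε (cornerB w k) ∧
        circleOf w ε u = circleOf w ε (cornerA w k)) := by
  have hnot : ¬ SameCycle (succPerm ε) (inLeft k) (inRight k) := by
    rw [← circleOf_eq_iff]
    rcases circleOf_inLeft_inRight ε k with ⟨h1, h2⟩ | ⟨h1, h2⟩ <;> rw [h1, h2]
    · exact hne
    · exact hne.symm
  rw [circleOf_eq_iff, succPerm_change h hk, sameCycle_mul_swap_iff_of_not hnot]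
  simp only [← circleOf_eq_iff]
  rcases circleOf_inLeft_inRight ε k with ⟨h1, h2⟩ | ⟨h1, h2⟩ <;> rw [h1, h2]
  tauto

end Khovanov

namespace Khovanov

variable {p : ℕ} {w : BraidWord p}

/-! ### Merges of circles -/

theorem exists_circleOf {ε : Resolution w} (c : Circle w ε) : ∃ v, circleOf w ε v = c :=
  Quot.exists_rep c

/-- `ε'` arises from `ε` by changing the resolution of the crossing `k`, and this merges two
circles. -/
structure IsMerge (ε ε' : Resolution w) (k : Fin w.length) : Prop where
  agree : ∀ l, l ≠ k → ε' l = ε l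
  differ : ε' k ≠ ε k
  ne : circleOf w ε (cornerA w k) ≠ circleOf w ε (cornerB w k)

namespace IsMerge

variable {ε ε' : Resolution w} {k : Fin w.length}

theorem corners_eq (h : IsMerge ε ε' k) :
    circleOf w ε' (cornerA w k) = circleOf w ε' (cornerB w k) :=
  (circleOf_corner_change h.agree h.differ).2 h.ne

theorem iff (h : IsMerge ε ε' k) (v u : Node w) :
    circleOf w ε' v = circleOf w ε' u ↔ circleOf w ε v = circleOf w ε u ∨
      (circleOf w ε v = circleOf w ε (cornerA w k) ∧ circleOf w ε u = circleOf w ε (cornerB w k)) ∨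
      (circleOf w ε v = circleOf w ε (cornerB w k) ∧
        circleOf w ε u = circleOf w ε (cornerA w k)) :=
  circleOf_merge h.agree h.differ h.ne v u

theorem le (h : IsMerge ε ε' k) {v u : Node w} (hvu : circleOf w ε v = circleOf w ε u) :
    circleOf w ε' v = circleOf w ε' u := (h.iff v u).2 (Or.inl hvu)

theorem eq_cornerA_iff (h : IsMerge ε ε' k) (v : Node w) :
    circleOf w ε' v = circleOf w ε' (cornerA w k) ↔
      circleOf w ε v = circleOf w ε (cornerA w k) ∨ circleOf w ε v = circleOf w ε (cornerB w k) := by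
  rw [h.iff]; tauto

end IsMerge

theorem isMerge_or (ε ε' : Resolution w) (k : Fin w.length)
    (h : ∀ l, l ≠ k → ε' l = ε l) (hk : ε' k ≠ ε k) : IsMerge ε ε' k ∨ IsMerge ε' ε k := by
  by_cases hne : circleOf w ε (cornerA w k) = circleOf w ε (cornerB w k)
  · right
    refine ⟨fun l hl => (h l hl).symm, hk.symm, fun he => ?_⟩
    exact (circleOf_corner_change h hk).1 he hne
  · exact Or.inl ⟨h, hk, hne⟩

open Classical in
/-- A product over the circles before a merge, in terms of the circles after the merge. -/
theorem IsMerge.prod_eq {ε ε' : Resolution w} {k : Fin w.length} (h : IsMerge ε ε' k)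
    {M : Type*} [CommMonoid M] (F : Circle w ε → M) (F' : Circle w ε' → M)
    (hF : ∀ v, circleOf w ε v ≠ circleOf w ε (cornerA w k) →
      circleOf w ε v ≠ circleOf w ε (cornerB w k) → F (circleOf w ε v) = F' (circleOf w ε' v)) :
    ∏ c, F c = F (circleOf w ε (cornerA w k)) * F (circleOf w ε (cornerB w k)) *
      ∏ c ∈ Finset.univ.erase (circleOf w ε' (cornerA w k)), F' c := by
  rw [← Finset.mul_prod_erase _ F (Finset.mem_univ (circleOf w ε (cornerA w k))),
    ← Finset.mul_prod_erase _ F (a := circleOf w ε (cornerB w k)) (by simp [h.ne.symm]), mul_assoc]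
  congr 2
  have hA := h.eq_cornerA_iff
  refine Finset.prod_bij
    (fun c _ => Quot.lift (circleOf w ε') (fun u v huv => h.le (circleOf_of_arc huv)) c) ?_ ?_ ?_ ?_
  · intro c
    obtain ⟨v, rfl⟩ := exists_circleOf c
    intro hv
    simp only [Finset.mem_erase, Finset.mem_univ, and_true] at hv ⊢
    intro e
    rcases (hA v).1 e with e | e
    · exact hv.2 e
    · exact hv.1 e
  · intro c
    obtain ⟨v, rfl⟩ := exists_circleOf c
    intro hv d
    obtain ⟨u, rfl⟩ := exists_circleOf d
    intro hu e
    simp only [Finset.mem_erase, Finset.mem_univ, and_true] at hv hu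
    rcases (h.iff v u).1 e with e | ⟨e, -⟩ | ⟨e, -⟩
    · exact e
    · exact absurd e hv.2
    · exact absurd e hv.1
  · intro c
    obtain ⟨v, rfl⟩ := exists_circleOf c
    intro hv
    simp only [Finset.mem_erase, Finset.mem_univ, and_true] at hv
    rw [Ne, hA] at hv
    exact ⟨circleOf w ε v, by simp only [Finset.mem_erase, Finset.mem_univ, and_true]; tauto, rfl⟩
  · intro c
    obtain ⟨v, rfl⟩ := exists_circleOf c
    intro hv
    simp only [Finset.mem_erase, Finset.mem_univ, and_true] at hv
    exact hF v hv.2 hv.1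

/-- A sum over the circles before and after a merge. -/
theorem IsMerge.sum_eq {ε ε' : Resolution w} {k : Fin w.length} (h : IsMerge ε ε' k)
    (F : Circle w ε → ℤ) (F' : Circle w ε' → ℤ)
    (hF : ∀ v, circleOf w ε v ≠ circleOf w ε (cornerA w k) →
      circleOf w ε v ≠ circleOf w ε (cornerB w k) → F (circleOf w ε v) = F' (circleOf w ε' v)) :
    ∑ c, F c = F (circleOf w ε (cornerA w k)) + F (circleOf w ε (cornerB w k)) +
      (∑ c, F' c - F' (circleOf w ε' (cornerA w k))) := by
  classical
  have h1 := h.prod_eq (M := Multiplicative ℤ) (fun c => Multiplicative.ofAdd (F c))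
    (fun c => Multiplicative.ofAdd (F' c)) (fun v h1 h2 => by rw [hF v h1 h2])
  rw [← ofAdd_sum, ← ofAdd_sum, ← ofAdd_add, ← ofAdd_add, Multiplicative.ofAdd.injective.eq_iff]
    at h1
  rw [h1, ← Finset.add_sum_erase _ F' (Finset.mem_univ (circleOf w ε' (cornerA w k)))]
  ring

/-- A merge lowers the number of circles by one. -/
theorem IsMerge.card_eq {ε ε' : Resolution w} {k : Fin w.length} (h : IsMerge ε ε' k) :
    Fintype.card (Circle w ε) = Fintype.card (Circle w ε') + 1 := by
  have := h.sum_eq (fun _ => 1) (fun _ => 1) (fun _ _ _ => rfl)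
  simp at this
  omega

namespace EnhancedState

/-- The state with a given resolution and a labelling of the points that is constant on circles. -/
def ofLabel (ε : Resolution w) (ℓ : Node w → Gen)
    (h : ∀ u v, circleOf w ε u = circleOf w ε v → ℓ u = ℓ v) : EnhancedState w :=
  ⟨ε, Quot.lift ℓ fun u v huv => h u v (circleOf_of_arc huv)⟩

theorem ext_labelAt {S T : EnhancedState w} (h : S.res = T.res)
    (hl : ∀ v, S.labelAt v = T.labelAt v) : S = T := by
  obtain ⟨ε, ℓ⟩ := S
  obtain ⟨ε', ℓ'⟩ := T
  cases h
  congr 1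
  funext c
  obtain ⟨v, rfl⟩ := exists_circleOf c
  exact hl v

theorem labelAt_eq (S : EnhancedState w) {u v : Node w}
    (h : circleOf w S.res u = circleOf w S.res v) : S.labelAt u = S.labelAt v := congrArg S.label h

end EnhancedState

open EnhancedState

/-! ### The edges of the cube of resolutions -/

section Edge

variable {k : Fin w.length} {S T : EnhancedState w}

theorem res_of_edgeCoeff_ne_zero (h : edgeCoeff k S T ≠ 0) :
    S.res k = false ∧ T.res = Function.update S.res k true := by
  unfold edgeCoeff at h
  split_ifs at h with h1 h2
  · exact ⟨h1.1, h1.2.1⟩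
  · exact ⟨h1.1, h1.2.1⟩
  · exact absurd rfl h

theorem labelAt_of_edgeCoeff_ne_zero (h : edgeCoeff k S T ≠ 0) (v : Node w)
    (hA : circleOf w S.res v ≠ circleOf w S.res (cornerA w k))
    (hB : circleOf w S.res v ≠ circleOf w S.res (cornerB w k)) : T.labelAt v = S.labelAt v := by
  unfold edgeCoeff at h
  split_ifs at h with h1 h2
  · exact h1.2.2 v hA hB
  · exact h1.2.2 v hA hB
  · exact absurd rfl h

theorem edgeCoeff_merge (hS : S.res k = false) (hT : T.res = Function.update S.res k true)
    (hne : circleOf w S.res (cornerA w k) ≠ circleOf w S.res (cornerB w k))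
    (hl : ∀ v, circleOf w S.res v ≠ circleOf w S.res (cornerA w k) →
      circleOf w S.res v ≠ circleOf w S.res (cornerB w k) → T.labelAt v = S.labelAt v) :
    edgeCoeff k S T = mulCoeff (S.labelAt (cornerA w k)) (S.labelAt (cornerB w k))
      (T.labelAt (cornerA w k)) := by
  unfold edgeCoeff
  rw [if_pos ⟨hS, hT, hl⟩, if_pos hne]

theorem edgeCoeff_split (hS : S.res k = false) (hT : T.res = Function.update S.res k true)
    (hne : circleOf w S.res (cornerA w k) = circleOf w S.res (cornerB w k))
    (hl : ∀ v, circleOf w S.res v ≠ circleOf w S.res (cornerA w k) → T.labelAt v = S.labelAt v) :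
    edgeCoeff k S T = comulCoeff (S.labelAt (cornerA w k)) (T.labelAt (cornerA w k))
      (T.labelAt (cornerB w k)) := by
  unfold edgeCoeff
  rw [if_pos ⟨hS, hT, fun v h _ => hl v h⟩, if_neg (not_not.2 hne)]

theorem isMerge_update {ε : Resolution w} (hS : ε k = false)
    (hne : circleOf w ε (cornerA w k) ≠ circleOf w ε (cornerB w k)) :
    IsMerge ε (Function.update ε k true) k :=
  ⟨fun l hl => by simp [hl], by simp [hS], hne⟩

theorem isMerge_update' {ε : Resolution w} (hS : ε k = false)
    (hne : circleOf w ε (cornerA w k) = circleOf w ε (cornerB w k)) :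
    IsMerge (Function.update ε k true) ε k := by
  rcases isMerge_or ε (Function.update ε k true) k (fun l hl => by simp [hl]) (by simp [hS])
    with h | h
  · exact absurd hne h.ne
  · exact h

theorem weight_update {ε : Resolution w} (hS : ε k = false) :
    (Finset.univ.filter fun l => Function.update ε k true l = true).card =
      (Finset.univ.filter fun l => ε l = true).card + 1 := by
  have : (Finset.univ.filter fun l => Function.update ε k true l = true) =
      insert k (Finset.univ.filter fun l => ε l = true) := by
    ext l
    by_cases hl : l = k
    · subst hl; simp
    · simp [hl]
  rw [this, Finset.card_insert_of_notMem (by simp [hS])]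

theorem weight_of_edgeCoeff_ne_zero (h : edgeCoeff k S T ≠ 0) : T.weight = S.weight + 1 := by
  obtain ⟨h1, h2⟩ := res_of_edgeCoeff_ne_zero h
  unfold EnhancedState.weight
  rw [h2]
  exact weight_update h1

/-- The sum of the degrees of the labels. -/
noncomputable def EnhancedState.degSum (S : EnhancedState w) : ℤ := ∑ c, (S.label c).deg

theorem qDeg_eq (S : EnhancedState w) :
    S.qDeg = S.degSum + S.weight + (nPos w - 2 * nNeg w) := rfl

/-- The change of the degree along a merge, for labels which agree away from the corners. -/
theorem IsMerge.degSum_eq {k : Fin w.length} {S T : EnhancedState w}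
    (h : IsMerge S.res T.res k)
    (hl : ∀ v, circleOf w S.res v ≠ circleOf w S.res (cornerA w k) →
      circleOf w S.res v ≠ circleOf w S.res (cornerB w k) → S.labelAt v = T.labelAt v) :
    S.degSum = (S.labelAt (cornerA w k)).deg + (S.labelAt (cornerB w k)).deg +
      (T.degSum - (T.labelAt (cornerA w k)).deg) :=
  h.sum_eq (fun c => (S.label c).deg) (fun c => (T.label c).deg)
    (fun v h1 h2 => congrArg Gen.deg (hl v h1 h2))

theorem degSum_of_edgeCoeff_ne_zero (h : edgeCoeff k S T ≠ 0) : T.degSum = S.degSum - 1 := by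
  obtain ⟨h1, h2⟩ := res_of_edgeCoeff_ne_zero h
  have h3 := labelAt_of_edgeCoeff_ne_zero h
  by_cases hne : circleOf w S.res (cornerA w k) = circleOf w S.res (cornerB w k)
  · rw [edgeCoeff_split h1 h2 hne (fun v hv => h3 v hv (hne ▸ hv))] at h
    have hm := isMerge_update' h1 hne
    rw [← h2] at hm
    have := hm.degSum_eq (S := T) (T := S) (fun v hA hB => by
      have := (hm.eq_cornerA_iff v).not.2 (by tauto)
      exact h3 v this (hne ▸ this))
    rw [this]
    cases hx : S.labelAt (cornerA w k) <;> cases hy : T.labelAt (cornerA w k) <;>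
      cases hz : T.labelAt (cornerB w k) <;> simp_all [comulCoeff, Gen.deg]; ring
  · rw [edgeCoeff_merge h1 h2 hne h3] at h
    have hm := isMerge_update h1 hne
    rw [← h2] at hm
    have := hm.degSum_eq (S := S) (T := T) (fun v hA hB => (h3 v hA hB).symm)
    rw [this]
    cases hx : S.labelAt (cornerA w k) <;> cases hy : S.labelAt (cornerB w k) <;>
      cases hz : T.labelAt (cornerA w k) <;> simp_all [mulCoeff, Gen.deg]; ring

theorem exists_edgeCoeff_ne_zero (h : diffCoeff S T ≠ 0) : ∃ k, edgeCoeff k S T ≠ 0 := by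
  by_contra hc
  push Not at hc
  exact h (by simp [diffCoeff, hc])

theorem hDeg_of_diffCoeff_ne_zero (h : diffCoeff S T ≠ 0) : T.hDeg = S.hDeg + 1 := by
  obtain ⟨k, hk⟩ := exists_edgeCoeff_ne_zero h
  unfold EnhancedState.hDeg
  rw [weight_of_edgeCoeff_ne_zero hk]
  push_cast; ring

theorem qDeg_of_diffCoeff_ne_zero (h : diffCoeff S T ≠ 0) : T.qDeg = S.qDeg := by
  obtain ⟨k, hk⟩ := exists_edgeCoeff_ne_zero h
  rw [qDeg_eq, qDeg_eq, weight_of_edgeCoeff_ne_zero hk, degSum_of_edgeCoeff_ne_zero hk]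
  push_cast; ring

end Edge

end Khovanov

namespace Khovanov

variable {p : ℕ} {w : BraidWord p}

open EnhancedState

/-! ### The square of the differential -/

noncomputable instance (w : BraidWord p) : Fintype (EnhancedState w) := Fintype.ofFinite _

/-- A point of a circle. -/
noncomputable def pointOf {ε : Resolution w} (c : Circle w ε) : Node w := Quot.out c

theorem circleOf_pointOf {ε : Resolution w} (c : Circle w ε) : circleOf w ε (pointOf c) = c :=
  Quot.out_eq c

section Eval

variable {A : Type*} [CommRing A]

/-- The monomial of a state: the product, over the circles labelled `X`, of the value of `ξ` at a
point of the circle. If `ξ` has square zero and is constant on circles, this is the image of the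
basis vector under the ring homomorphism from `V_ε`, a tensor power of `ℤ[X]/(X²)`, given by `ξ`. -/
noncomputable def eval (ξ : Node w → A) (S : EnhancedState w) : A :=
  ∏ c, if S.label c = .X then ξ (pointOf c) else 1

open Classical in
/-- In terms of the rings `V_ε`, the map of an edge of the cube is the multiplication by this
factor, followed by an identification of the variables. -/
noncomputable def factor (k : Fin w.length) (ε : Resolution w) (ξ : Node w → A) : A :=
  if circleOf w ε (cornerA w k) = circleOf w ε (cornerB w k) then
    ξ (cornerA w k) + ξ (cornerB w k) else 1

theorem Gen.sum_eq {M : Type*} [AddCommMonoid M] (f : Gen → M) : ∑ g, f g = f .one + f .X := by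
  have : (Finset.univ : Finset Gen) = {.one, .X} := by ext g; cases g <;> simp
  rw [this, Finset.sum_pair (by simp)]

variable {ξ : Node w → A} {k : Fin w.length} {S : EnhancedState w}

theorem sum_edgeCoeff_mul_eval_merge (hS : S.res k = false)
    (hξ : ∀ u v, circleOf w (Function.update S.res k true) u =
      circleOf w (Function.update S.res k true) v → ξ u = ξ v)
    (hsq : ∀ v, ξ v * ξ v = 0)
    (hne : circleOf w S.res (cornerA w k) ≠ circleOf w S.res (cornerB w k)) :
    ∑ M, (edgeCoeff k S M : A) * eval ξ M = eval ξ S := by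
  classical
  have hm := isMerge_update hS hne
  set ε' := Function.update S.res k true with hε'
  let E : Gen → EnhancedState w := fun g => ofLabel ε'
    (fun v => if circleOf w ε' v = circleOf w ε' (cornerA w k) then g else S.labelAt v) (by
      intro u v huv
      simp only [huv]
      split_ifs with hv
      · rfl
      · rcases (hm.iff u v).1 huv with h | ⟨-, h⟩ | ⟨-, h⟩
        · exact S.labelAt_eq h
        · exact absurd ((hm.eq_cornerA_iff v).2 (Or.inr h)) hv
        · exact absurd ((hm.eq_cornerA_iff v).2 (Or.inl h)) hv)
  have hEA : ∀ g, (E g).labelAt (cornerA w k) = g := fun g => if_pos rfl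
  have hEo : ∀ g v, circleOf w ε' v ≠ circleOf w ε' (cornerA w k) →
      (E g).labelAt v = S.labelAt v := fun g v hv => if_neg hv
  have hEedge : ∀ g, edgeCoeff k S (E g) =
      mulCoeff (S.labelAt (cornerA w k)) (S.labelAt (cornerB w k)) g := by
    intro g
    rw [edgeCoeff_merge hS rfl hne, hEA]
    intro v h1 h2
    exact hEo g v ((hm.eq_cornerA_iff v).not.2 (by tauto))
  have hinj : Function.Injective E := fun g g' h => by rw [← hEA g, h, hEA]
  have hrange : ∀ M ∉ Set.range E, (edgeCoeff k S M : A) * eval ξ M = 0 := by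
    intro M hM
    by_cases h0 : edgeCoeff k S M = 0
    · simp [h0]
    refine absurd ⟨M.labelAt (cornerA w k), ?_⟩ hM
    have hres := (res_of_edgeCoeff_ne_zero h0).2
    refine ext_labelAt hres.symm fun v => ?_
    by_cases hv : circleOf w ε' v = circleOf w ε' (cornerA w k)
    · refine (if_pos hv).trans (M.labelAt_eq ?_)
      rw [hres]; exact hv.symm
    · rw [hEo _ _ hv]
      rw [hm.eq_cornerA_iff] at hv
      exact (labelAt_of_edgeCoeff_ne_zero h0 v (by tauto) (by tauto)).symm
  rw [← Fintype.sum_of_injective E hinj (fun g => (edgeCoeff k S (E g) : A) * eval ξ (E g)) _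
    hrange (fun _ => rfl), Gen.sum_eq]
  set R : A := ∏ c ∈ Finset.univ.erase (circleOf w ε' (cornerA w k)),
    (if (E .one).label c = .X then ξ (pointOf c) else 1) with hR
  have hE : ∀ g, eval ξ (E g) = (if g = .X then ξ (cornerA w k) else 1) * R := by
    intro g
    refine (Finset.mul_prod_erase Finset.univ (fun c : Circle w ε' =>
      if (E g).label c = .X then ξ (pointOf c) else 1)
        (Finset.mem_univ (circleOf w ε' (cornerA w k)))).symm.trans ?_
    congr 1
    · have h1 : (E g).label (circleOf w ε' (cornerA w k)) = g := hEA g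
      rw [h1, hξ _ (cornerA w k) (circleOf_pointOf _)]
    · refine Finset.prod_congr rfl fun c hc => ?_
      obtain ⟨v, rfl⟩ := exists_circleOf c
      have hv := Finset.ne_of_mem_erase hc
      have h1 : (E g).label (circleOf w ε' v) = S.labelAt v := hEo g v hv
      have h2 : (E .one).label (circleOf w ε' v) = S.labelAt v := hEo .one v hv
      rw [h1, h2]
  have hSR : eval ξ S = (if S.labelAt (cornerA w k) = .X then ξ (cornerA w k) else 1) *
      (if S.labelAt (cornerB w k) = .X then ξ (cornerA w k) else 1) * R := by
    unfold eval
    rw [hm.prod_eq (fun c => if S.label c = .X then ξ (pointOf c) else 1)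
      (fun c => if (E .one).label c = .X then ξ (pointOf c) else 1)]
    · congr 2
      · rw [hξ _ (cornerA w k) (hm.le (circleOf_pointOf _))]; rfl
      · rw [hξ _ (cornerB w k) (hm.le (circleOf_pointOf _)), hξ _ _ hm.corners_eq]; rfl
    · intro v h1 h2
      have h3 : (E .one).label (circleOf w ε' v) = S.labelAt v :=
        hEo .one v ((hm.eq_cornerA_iff v).not.2 (by tauto))
      rw [h3, hξ _ v (hm.le (circleOf_pointOf _)), hξ _ v (circleOf_pointOf _)]
      rfl
  rw [hE, hE, hSR, hEedge, hEedge]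
  cases S.labelAt (cornerA w k) <;> cases S.labelAt (cornerB w k) <;>
    simp [mulCoeff, hsq]

theorem sum_edgeCoeff_mul_eval_split (hS : S.res k = false)
    (hξ : ∀ u v, circleOf w (Function.update S.res k true) u =
      circleOf w (Function.update S.res k true) v → ξ u = ξ v)
    (hsq : ∀ v, ξ v * ξ v = 0)
    (heq : circleOf w S.res (cornerA w k) = circleOf w S.res (cornerB w k)) :
    ∑ M, (edgeCoeff k S M : A) * eval ξ M = (ξ (cornerA w k) + ξ (cornerB w k)) * eval ξ S := by
  classical
  have hm := isMerge_update' hS heq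
  set ε' := Function.update S.res k true with hε'
  let E : Gen × Gen → EnhancedState w := fun g => ofLabel ε'
    (fun v => if circleOf w ε' v = circleOf w ε' (cornerA w k) then g.1 else
      if circleOf w ε' v = circleOf w ε' (cornerB w k) then g.2 else S.labelAt v) (by
      intro u v huv
      simp only [huv]
      split_ifs with hv
      · rfl
      · rfl
      · exact S.labelAt_eq (hm.le huv))
  have hEA : ∀ g, (E g).labelAt (cornerA w k) = g.1 := fun g => if_pos rfl
  have hEB : ∀ g, (E g).labelAt (cornerB w k) = g.2 := fun g =>
    (if_neg hm.ne.symm).trans (if_pos rfl)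
  have hEo : ∀ g v, circleOf w S.res v ≠ circleOf w S.res (cornerA w k) →
      (E g).labelAt v = S.labelAt v := by
    intro g v hv
    have hv := (hm.eq_cornerA_iff v).not.1 hv
    exact (if_neg (by tauto)).trans (if_neg (by tauto))
  have hEedge : ∀ g, edgeCoeff k S (E g) = comulCoeff (S.labelAt (cornerA w k)) g.1 g.2 := by
    intro g
    rw [edgeCoeff_split hS rfl heq (fun v hv => hEo g v hv), hEA, hEB]
  have hinj : Function.Injective E := fun g g' h => by
    refine Prod.ext ?_ ?_
    · rw [← hEA g, h, hEA]
    · rw [← hEB g, h, hEB]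
  have hrange : ∀ M ∉ Set.range E, (edgeCoeff k S M : A) * eval ξ M = 0 := by
    intro M hM
    by_cases h0 : edgeCoeff k S M = 0
    · simp [h0]
    refine absurd ⟨(M.labelAt (cornerA w k), M.labelAt (cornerB w k)), ?_⟩ hM
    have hres := (res_of_edgeCoeff_ne_zero h0).2
    refine ext_labelAt hres.symm fun v => ?_
    by_cases hA : circleOf w ε' v = circleOf w ε' (cornerA w k)
    · refine (if_pos hA).trans (M.labelAt_eq ?_)
      rw [hres]; exact hA.symm
    by_cases hB : circleOf w ε' v = circleOf w ε' (cornerB w k)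
    · refine (if_neg hA).trans ((if_pos hB).trans (M.labelAt_eq ?_))
      rw [hres]; exact hB.symm
    · have hv := (hm.eq_cornerA_iff v).not.2 (by tauto)
      rw [hEo _ _ hv]
      exact (labelAt_of_edgeCoeff_ne_zero h0 v hv (heq ▸ hv)).symm
  rw [← Fintype.sum_of_injective E hinj (fun g => (edgeCoeff k S (E g) : A) * eval ξ (E g)) _
    hrange (fun _ => rfl), Fintype.sum_prod_type, Gen.sum_eq, Gen.sum_eq, Gen.sum_eq]
  set R : A := ∏ c ∈ Finset.univ.erase (circleOf w S.res (cornerA w k)),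
    (if S.label c = .X then ξ (pointOf c) else 1) with hR
  have hE : ∀ g, eval ξ (E g) = (if g.1 = .X then ξ (cornerA w k) else 1) *
      (if g.2 = .X then ξ (cornerB w k) else 1) * R := by
    intro g
    unfold eval
    have := hm.prod_eq (fun c => if (E g).label c = .X then ξ (pointOf c) else 1)
      (fun c => if S.label c = .X then ξ (pointOf c) else 1) (by
        intro v h1 h2
        have hv := (hm.eq_cornerA_iff v).not.2 (by tauto)
        have h3 : (E g).label (circleOf w ε' v) = S.labelAt v := hEo g v hv
        have h4 : ξ (pointOf (circleOf w S.res v)) = ξ v := by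
          refine hξ _ _ ?_
          rcases (hm.iff _ _).1 (circleOf_pointOf (circleOf w S.res v)) with h | ⟨-, h⟩ | ⟨-, h⟩
          · exact h
          · exact absurd h h2
          · exact absurd h h1
        rw [h3, h4, hξ _ v (circleOf_pointOf _)]
        rfl)
    refine this.trans ?_
    congr 2
    · have h1 : (E g).label (circleOf w ε' (cornerA w k)) = g.1 := hEA g
      rw [h1, hξ _ (cornerA w k) (circleOf_pointOf _)]
    · have h1 : (E g).label (circleOf w ε' (cornerB w k)) = g.2 := hEB g
      rw [h1, hξ _ (cornerB w k) (circleOf_pointOf _)]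
  have hSR : eval ξ S = (if S.labelAt (cornerA w k) = .X then
      ξ (pointOf (circleOf w S.res (cornerA w k))) else 1) * R := by
    unfold eval
    rw [← Finset.mul_prod_erase _ _ (Finset.mem_univ (circleOf w S.res (cornerA w k)))]
    rfl
  have hout : (ξ (cornerA w k) + ξ (cornerB w k)) *
      ξ (pointOf (circleOf w S.res (cornerA w k))) = ξ (cornerA w k) * ξ (cornerB w k) := by
    rcases (hm.eq_cornerA_iff _).1 (circleOf_pointOf (circleOf w S.res (cornerA w k))) with h | h
    · rw [hξ _ _ h]; linear_combination hsq (cornerA w k)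
    · rw [hξ _ _ h]; linear_combination hsq (cornerB w k)
  simp only [hE, hSR, hEedge]
  cases S.labelAt (cornerA w k)
  · simp [comulCoeff]; ring
  · simp only [comulCoeff, if_true, ← mul_assoc, hout]
    simp

/-- The map of an edge of the cube, in terms of the rings `V_ε`. It is enough to evaluate at `ξ` that
are constant on the circles of the target. -/
theorem sum_edgeCoeff_mul_eval (hS : S.res k = false)
    (hξ : ∀ u v, circleOf w (Function.update S.res k true) u =
      circleOf w (Function.update S.res k true) v → ξ u = ξ v)
    (hsq : ∀ v, ξ v * ξ v = 0) :
    ∑ M, (edgeCoeff k S M : A) * eval ξ M = factor k S.res ξ * eval ξ S := by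
  unfold factor
  split_ifs with h
  · exact sum_edgeCoeff_mul_eval_split hS hξ hsq h
  · rw [one_mul]; exact sum_edgeCoeff_mul_eval_merge hS hξ hsq h

/-- Variables whose difference is annihilated by `c` may be identified after multiplication by `c`. -/
theorem mul_eval_congr {c : A} {ξ ξ' : Node w → A} (h : ∀ v, c * ξ v = c * ξ' v)
    (S : EnhancedState w) : c * eval ξ S = c * eval ξ' S := by
  classical
  unfold eval
  refine Finset.induction_on (Finset.univ : Finset (Circle w S.res)) (by simp) ?_
  intro a s ha ih
  rw [Finset.prod_insert ha, Finset.prod_insert ha, mul_left_comm, ih, mul_left_comm, ← mul_assoc,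
    ← mul_assoc]
  congr 1
  split_ifs
  · exact h _
  · rfl

theorem mul_factor_congr {c : A} {ξ ξ' : Node w → A} (h : ∀ v, c * ξ v = c * ξ' v)
    (k : Fin w.length) (ε : Resolution w) : c * factor k ε ξ = c * factor k ε ξ' := by
  unfold factor
  split_ifs
  · rw [mul_add, mul_add, h, h]
  · rfl

theorem update_comm {k l : Fin w.length} (hkl : k ≠ l) (ε : Resolution w) :
    Function.update (Function.update ε k true) l true =
      Function.update (Function.update ε l true) k true := Function.update_comm hkl _ _ _

/-- The composition of the maps of two successive edges, in terms of the rings `V_ε`. -/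
theorem sum_sum_edgeCoeff_mul_eval {k l : Fin w.length} (hkl : k ≠ l) (hk : S.res k = false)
    (hl : S.res l = false)
    (hξ : ∀ u v, circleOf w (Function.update (Function.update S.res k true) l true) u =
      circleOf w (Function.update (Function.update S.res k true) l true) v → ξ u = ξ v)
    (hsq : ∀ v, ξ v * ξ v = 0) :
    ∑ M, (edgeCoeff k S M : A) * ∑ T, (edgeCoeff l M T : A) * eval ξ T =
      factor l (Function.update S.res k true) ξ * factor k S.res ξ * eval ξ S := by
  classical
  set ε := Function.update S.res k true with hε
  have hεl : ε l = false := by simp [hε, hkl.symm, hl]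
  -- replace `ξ` by a function that is constant on the circles of `ε`
  obtain ⟨ξ', hξ', hsq', hc⟩ : ∃ ξ' : Node w → A,
      (∀ u v, circleOf w ε u = circleOf w ε v → ξ' u = ξ' v) ∧ (∀ v, ξ' v * ξ' v = 0) ∧
      ∀ v, factor l ε ξ * ξ v = factor l ε ξ * ξ' v := by
    by_cases h : circleOf w ε (cornerA w l) = circleOf w ε (cornerB w l)
    · have hm := isMerge_update' hεl h
      refine ⟨fun v => if circleOf w ε v = circleOf w ε (cornerA w l) then ξ (cornerA w l) else ξ v,
        ?_, ?_, ?_⟩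
      · intro u v huv
        simp only [huv]
        split_ifs with hv
        · rfl
        · refine hξ _ _ ?_
          rcases (hm.iff u v).1 huv with h' | ⟨-, h'⟩ | ⟨-, h'⟩
          · exact h'
          · exact absurd ((hm.eq_cornerA_iff v).2 (Or.inr h')) hv
          · exact absurd ((hm.eq_cornerA_iff v).2 (Or.inl h')) hv
      · intro v
        dsimp only
        split_ifs <;> exact hsq _
      · intro v
        dsimp only
        split_ifs with hv
        · unfold factor
          rw [if_pos h]
          rcases (hm.eq_cornerA_iff v).1 hv with h' | h'
          · rw [hξ _ _ h']
          · rw [hξ _ _ h']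
            linear_combination hsq (cornerB w l) - hsq (cornerA w l)
        · rfl
    · have hm := isMerge_update hεl h
      exact ⟨ξ, fun u v huv => hξ u v (hm.le huv), hsq, fun _ => rfl⟩
  have h1 : ∀ M, (edgeCoeff k S M : A) * ∑ T, (edgeCoeff l M T : A) * eval ξ T =
      factor l ε ξ * ((edgeCoeff k S M : A) * eval ξ' M) := by
    intro M
    by_cases h0 : edgeCoeff k S M = 0
    · simp [h0]
    have hres := (res_of_edgeCoeff_ne_zero h0).2
    rw [sum_edgeCoeff_mul_eval (by rw [hres]; exact hεl) (by rw [hres]; exact hξ) hsq, hres,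
      mul_eval_congr hc]
    ring
  rw [Finset.sum_congr rfl fun M _ => h1 M, ← Finset.mul_sum,
    sum_edgeCoeff_mul_eval hk hξ' hsq', ← mul_assoc, ← mul_factor_congr hc, mul_right_comm,
    ← mul_eval_congr hc]
  ring

open Classical in
theorem card_circle_update {ε : Resolution w} {k : Fin w.length} (hk : ε k = false) :
    if circleOf w ε (cornerA w k) = circleOf w ε (cornerB w k) then
      Fintype.card (Circle w (Function.update ε k true)) = Fintype.card (Circle w ε) + 1
    else Fintype.card (Circle w ε) = Fintype.card (Circle w (Function.update ε k true)) + 1 := by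
  split_ifs with h
  · exact (isMerge_update' hk h).card_eq
  · exact (isMerge_update hk h).card_eq

/-- The factors along the two paths around a face of the cube agree. By counting circles, the paths
have equally many splits; where these are splits at different crossings, the factors agree because
of the identifications of the variables. -/
theorem factor_comm {k l : Fin w.length} (hkl : k ≠ l) {ε : Resolution w} (hk : ε k = false)
    (hl : ε l = false)
    (hξ : ∀ u v, circleOf w (Function.update (Function.update ε k true) l true) u =
      circleOf w (Function.update (Function.update ε k true) l true) v → ξ u = ξ v) :
    factor l (Function.update ε k true) ξ * factor k ε ξ =
      factor k (Function.update ε l true) ξ * factor l ε ξ := by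
  have hεl : Function.update ε k true l = false := by simp [hkl.symm, hl]
  have hεk : Function.update ε l true k = false := by simp [hkl, hk]
  have a := card_circle_update hk
  have b := card_circle_update hl
  have c := card_circle_update hεl
  have d := card_circle_update hεk
  rw [← update_comm hkl] at d
  unfold factor
  by_cases hK : circleOf w ε (cornerA w k) = circleOf w ε (cornerB w k) <;>
  by_cases hL : circleOf w ε (cornerA w l) = circleOf w ε (cornerB w l) <;>
  by_cases hL' : circleOf w (Function.update ε k true) (cornerA w l) =
    circleOf w (Function.update ε k true) (cornerB w l) <;>
  by_cases hK' : circleOf w (Function.update ε l true) (cornerA w k) =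
    circleOf w (Function.update ε l true) (cornerB w k) <;>
  simp only [hK, hL, hL', hK', if_true, if_false, one_mul, mul_one] at a b c d ⊢
  all_goals first | omega | ring1 | skip
  · -- two splits of one circle, each of which makes the other crossing a merge
    have c2 := isMerge_update hεl hL'
    have d2 := isMerge_update hεk hK'
    rw [← update_comm hkl] at d2
    have h1 := hξ _ _ c2.corners_eq
    have h2 := hξ _ _ d2.corners_eq
    rw [← h1, ← h2]
    rcases ((isMerge_update' hk hK).iff _ _).1 hL with h | ⟨h, -⟩ | ⟨h, -⟩
    · exact absurd h hL'
    · rw [hξ _ _ (c2.le h)]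
    · rw [hξ _ _ (c2.le h), h2]
  · -- two merges of the same two circles, each of which makes the other crossing a split
    have c1 := isMerge_update' hεl hL'
    have d1 := isMerge_update' hεk hK'
    rw [← update_comm hkl] at d1
    have a2 := isMerge_update hk hK
    have key : ∀ v, circleOf w (Function.update ε k true) v =
        circleOf w (Function.update ε k true) (cornerA w l) →
        ξ v = ξ (cornerA w l) ∨ ξ v = ξ (cornerB w l) := fun v hv =>
      ((c1.eq_cornerA_iff v).1 hv).imp (hξ _ _) (hξ _ _)
    have hA : circleOf w (Function.update ε k true) (cornerA w k) =
        circleOf w (Function.update ε k true) (cornerA w l) := by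
      rcases (a2.iff _ _).1 hL' with h | ⟨h, -⟩ | ⟨h, -⟩
      · exact absurd h hL
      · exact (a2.le h).symm
      · exact a2.corners_eq.trans (a2.le h).symm
    have hB := a2.corners_eq.symm.trans hA
    rcases (c1.eq_cornerA_iff _).1 hA with h1 | h1 <;>
      rcases (c1.eq_cornerA_iff _).1 hB with h2 | h2
    · exact absurd (h1.trans h2.symm) d1.ne
    · rw [hξ _ _ h1, hξ _ _ h2]
    · rw [hξ _ _ h1, hξ _ _ h2, add_comm]
    · exact absurd (h1.trans h2.symm) d1.ne

end Eval

/-- The exponents of the monomial of a labelling of the circles. -/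
noncomputable def exponents {ι : Type*} [Finite ι] (ℓ : ι → Gen) : ι →₀ ℕ :=
  Finsupp.equivFunOnFinite.symm fun c => if ℓ c = .X then 1 else 0

theorem exponents_apply {ι : Type*} [Finite ι] (ℓ : ι → Gen) (c : ι) :
    exponents ℓ c = if ℓ c = .X then 1 else 0 := rfl

theorem exponents_injective {ι : Type*} [Finite ι] :
    Function.Injective (exponents : (ι → Gen) → ι →₀ ℕ) := by
  intro ℓ ℓ' h
  funext c
  have := DFunLike.congr_fun h c
  rw [exponents_apply, exponents_apply] at this
  cases h1 : ℓ c <;> cases h2 : ℓ' c <;> simp_all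

/-- The square-free monomials are linearly independent modulo the squares of the variables. -/
theorem eq_zero_of_sum_monomial_mem {ι : Type*} [Fintype ι] [DecidableEq ι]
    (a : (ι → Gen) → ℤ)
    (h : ∑ ℓ, MvPolynomial.monomial (exponents ℓ) (a ℓ) ∈ Ideal.span
      ((fun s => MvPolynomial.monomial s (1 : ℤ)) ''
        Set.range fun c : ι => Finsupp.single c 2)) (ℓ : ι → Gen) : a ℓ = 0 := by
  classical
  rw [MvPolynomial.mem_ideal_span_monomial_image] at h
  by_contra hne
  have hcoeff : MvPolynomial.coeff (exponents ℓ)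
      (∑ ℓ, MvPolynomial.monomial (exponents ℓ) (a ℓ)) = a ℓ := by
    rw [MvPolynomial.coeff_sum, Finset.sum_eq_single ℓ]
    · simp
    · intro ℓ' _ h'
      rw [MvPolynomial.coeff_monomial, if_neg (fun e => h' (exponents_injective e))]
    · simp
  obtain ⟨s, ⟨c, rfl⟩, hs⟩ := h (exponents ℓ) (by
    rw [MvPolynomial.mem_support_iff, hcoeff]; exact hne)
  have := hs c
  dsimp only at this
  rw [Finsupp.single_eq_same, exponents_apply] at this
  split_ifs at this <;> omega

/-- A combination of states with one resolution vanishes if its value is zero at all `ξ`. -/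
theorem eq_zero_of_sum_eval {ε : Resolution w} (a : EnhancedState w → ℤ)
    (ha : ∀ S, S.res ≠ ε → a S = 0)
    (h : ∀ (A : Type) [CommRing A] (ξ : Node w → A),
      (∀ u v, circleOf w ε u = circleOf w ε v → ξ u = ξ v) → (∀ v, ξ v * ξ v = 0) →
      ∑ S, (a S : A) * eval ξ S = 0) (S : EnhancedState w) : a S = 0 := by
  classical
  set I : Ideal (MvPolynomial (Circle w ε) ℤ) := Ideal.span
      ((fun s => MvPolynomial.monomial s (1 : ℤ)) ''
        Set.range fun c : Circle w ε => Finsupp.single c 2) with hI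
  have h1 := h (MvPolynomial (Circle w ε) ℤ ⧸ I)
    (fun v => Ideal.Quotient.mk I (MvPolynomial.X (circleOf w ε v)))
    (fun u v huv => by rw [huv]) (fun v => by
      rw [← map_mul, Ideal.Quotient.eq_zero_iff_mem]
      refine Ideal.subset_span ⟨_, ⟨circleOf w ε v, rfl⟩, ?_⟩
      rw [← pow_two, MvPolynomial.X_pow_eq_monomial])
  have hinj : Function.Injective (fun ℓ : Circle w ε → Gen => (⟨ε, ℓ⟩ : EnhancedState w)) := by
    intro ℓ ℓ' h; cases h; rfl
  have hev : ∀ ℓ : Circle w ε → Gen, eval (fun v => Ideal.Quotient.mk I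
      (MvPolynomial.X (circleOf w ε v))) ⟨ε, ℓ⟩ =
      Ideal.Quotient.mk I (MvPolynomial.monomial (exponents ℓ) 1) := by
    intro ℓ
    unfold eval
    rw [MvPolynomial.monomial_eq, Finsupp.prod_fintype _ _ (fun _ => pow_zero _), map_one, one_mul,
      map_prod]
    refine Finset.prod_congr rfl fun c _ => ?_
    change (if ℓ c = .X then Ideal.Quotient.mk I
      (MvPolynomial.X (circleOf w ε (pointOf (ε := ε) c))) else 1) = _
    rw [circleOf_pointOf, exponents_apply]
    split_ifs <;> simp
  rw [← Fintype.sum_of_injective _ hinj (fun ℓ => Ideal.Quotient.mk I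
    (MvPolynomial.monomial (exponents ℓ) (a ⟨ε, ℓ⟩)))] at h1
  · rw [← map_sum, Ideal.Quotient.eq_zero_iff_mem] at h1
    have h2 := eq_zero_of_sum_monomial_mem _ h1
    by_cases hS : S.res = ε
    · subst hS; exact h2 S.label
    · exact ha S hS
  · rintro S hS
    rw [ha S, Int.cast_zero, zero_mul]
    rintro rfl
    exact hS ⟨S.label, rfl⟩
  · intro ℓ
    rw [hev, ← zsmul_eq_mul, ← map_zsmul, ← map_zsmul (MvPolynomial.monomial _)]
    simp

/-- The faces of the cube of resolutions commute. -/
theorem sum_edgeCoeff_comm {k l : Fin w.length} (hkl : k ≠ l) (S T : EnhancedState w) :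
    ∑ M, edgeCoeff k S M * edgeCoeff l M T = ∑ M, edgeCoeff l S M * edgeCoeff k M T := by
  classical
  have hres : ∀ {k l : Fin w.length} {S T M : EnhancedState w}, k ≠ l →
      edgeCoeff k S M * edgeCoeff l M T ≠ 0 → S.res k = false ∧ S.res l = false ∧
        T.res = Function.update (Function.update S.res k true) l true := by
    intro k l S T M hkl h
    obtain ⟨h1, h2⟩ := res_of_edgeCoeff_ne_zero (left_ne_zero_of_mul h)
    obtain ⟨h3, h4⟩ := res_of_edgeCoeff_ne_zero (right_ne_zero_of_mul h)
    rw [h2] at h3 h4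
    exact ⟨h1, by simpa [hkl.symm] using h3, h4⟩
  by_cases hk : S.res k = false
  · by_cases hl : S.res l = false
    · rw [← sub_eq_zero]
      refine eq_zero_of_sum_eval (ε := Function.update (Function.update S.res k true) l true)
        (fun T => ∑ M, edgeCoeff k S M * edgeCoeff l M T -
          ∑ M, edgeCoeff l S M * edgeCoeff k M T) ?_ ?_ T
      · intro T hT
        rw [Finset.sum_eq_zero, Finset.sum_eq_zero, sub_zero]
        · intro M _
          by_contra h
          exact hT ((hres hkl.symm h).2.2.trans (update_comm hkl.symm _))
        · intro M _
          by_contra h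
          exact hT (hres hkl h).2.2
      · intro A _ ξ hξ hsq
        have key : ∀ k l : Fin w.length, ∑ T, ((∑ M, edgeCoeff k S M * edgeCoeff l M T : ℤ) : A) *
            eval ξ T = ∑ M, (edgeCoeff k S M : A) * ∑ T, (edgeCoeff l M T : A) * eval ξ T := by
          intro k l
          simp only [Int.cast_sum, Int.cast_mul, Finset.sum_mul, Finset.mul_sum]
          rw [Finset.sum_comm]
          simp only [mul_assoc]
        simp only [Int.cast_sub, sub_mul, Finset.sum_sub_distrib]
        rw [key, key, sum_sum_edgeCoeff_mul_eval hkl hk hl hξ hsq,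
          sum_sum_edgeCoeff_mul_eval hkl.symm hl hk (by rwa [update_comm hkl.symm]) hsq,
          factor_comm hkl hk hl hξ, sub_self]
    · rw [Finset.sum_eq_zero, Finset.sum_eq_zero]
      · intro M _
        by_contra h
        exact hl (hres hkl.symm h).1
      · intro M _
        by_contra h
        exact hl (hres hkl h).2.1
  · rw [Finset.sum_eq_zero, Finset.sum_eq_zero]
    · intro M _
      by_contra h
      exact hk (hres hkl.symm h).2.1
    · intro M _
      by_contra h
      exact hk (hres hkl h).1

/-- The sign of the edge that changes the `k`-th crossing of a resolution. -/
def edgeSign (ε : Resolution w) (k : Fin w.length) : ℤ :=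
  (-1) ^ (Finset.univ.filter fun l => l < k ∧ ε l = true).card

theorem diffCoeff_eq (S T : EnhancedState w) :
    diffCoeff S T = ∑ k, edgeSign S.res k * edgeCoeff k S T := rfl

theorem edgeSign_update_of_lt {ε : Resolution w} {k l : Fin w.length} (hkl : k < l)
    (hk : ε k = false) : edgeSign (Function.update ε k true) l = -edgeSign ε l := by
  unfold edgeSign
  have : (Finset.univ.filter fun m => m < l ∧ Function.update ε k true m = true) =
      insert k (Finset.univ.filter fun m => m < l ∧ ε m = true) := by
    ext m
    by_cases hm : m = k
    · subst hm; simp [hkl]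
    · simp [hm]
  rw [this, Finset.card_insert_of_notMem (by simp [hk]), pow_succ]
  ring

theorem edgeSign_update_of_gt {ε : Resolution w} {k l : Fin w.length} (hkl : l < k) :
    edgeSign (Function.update ε k true) l = edgeSign ε l := by
  unfold edgeSign
  congr 2
  ext m
  by_cases hm : m = k
  · subst hm; simp [not_lt.2 hkl.le]
  · simp [hm]

/-- The square of the differential is zero. -/
theorem sum_diffCoeff_mul_diffCoeff (S T : EnhancedState w) :
    ∑ M, diffCoeff S M * diffCoeff M T = 0 := by
  have h1 : ∀ M, diffCoeff S M * diffCoeff M T = ∑ k, ∑ l,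
      edgeSign S.res k * edgeSign (Function.update S.res k true) l *
        (edgeCoeff k S M * edgeCoeff l M T) := by
    intro M
    rw [diffCoeff_eq, diffCoeff_eq, Finset.sum_mul_sum]
    refine Finset.sum_congr rfl fun k _ => Finset.sum_congr rfl fun l _ => ?_
    by_cases h0 : edgeCoeff k S M = 0
    · simp [h0]
    rw [(res_of_edgeCoeff_ne_zero h0).2]
    ring
  rw [Finset.sum_congr rfl fun M _ => h1 M, Finset.sum_comm]
  have h2 : ∀ k, ∑ M, ∑ l, edgeSign S.res k * edgeSign (Function.update S.res k true) l *
        (edgeCoeff k S M * edgeCoeff l M T) = ∑ l, edgeSign S.res k *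
        edgeSign (Function.update S.res k true) l * ∑ M, edgeCoeff k S M * edgeCoeff l M T := by
    intro k
    rw [Finset.sum_comm]
    simp only [Finset.mul_sum]
  rw [Finset.sum_congr rfl fun k _ => h2 k]
  -- the summands for `(k, l)` and `(l, k)` cancel
  have h3 : ∀ k l, edgeSign S.res k * edgeSign (Function.update S.res k true) l *
        ∑ M, edgeCoeff k S M * edgeCoeff l M T = -(edgeSign S.res l *
        edgeSign (Function.update S.res l true) k * ∑ M, edgeCoeff l S M * edgeCoeff k M T) := by
    intro k l
    by_cases hkl : k = l
    · subst hkl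
      rw [Finset.sum_eq_zero]
      · simp
      · intro M _
        by_contra h
        have h1 := (res_of_edgeCoeff_ne_zero (left_ne_zero_of_mul h)).2
        have h2 := (res_of_edgeCoeff_ne_zero (right_ne_zero_of_mul h)).1
        rw [h1] at h2
        simp at h2
    rw [sum_edgeCoeff_comm hkl]
    by_cases h0 : ∑ M, edgeCoeff l S M * edgeCoeff k M T = 0
    · simp [h0]
    obtain ⟨M, -, hM⟩ := Finset.exists_ne_zero_of_sum_ne_zero h0
    have hl := (res_of_edgeCoeff_ne_zero (left_ne_zero_of_mul hM)).1
    rw [← sum_edgeCoeff_comm hkl] at h0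
    obtain ⟨M, -, hM⟩ := Finset.exists_ne_zero_of_sum_ne_zero h0
    have hk := (res_of_edgeCoeff_ne_zero (left_ne_zero_of_mul hM)).1
    rcases lt_or_gt_of_ne hkl with h | h
    · rw [edgeSign_update_of_lt h hk, edgeSign_update_of_gt h]
      ring
    · rw [edgeSign_update_of_lt h hl, edgeSign_update_of_gt h]
      ring
  have h4 := Finset.sum_comm (s := Finset.univ) (t := Finset.univ) (f := fun k l : Fin w.length =>
    edgeSign S.res k * edgeSign (Function.update S.res k true) l *
        ∑ M, edgeCoeff k S M * edgeCoeff l M T)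
  have h5 : ∑ k, ∑ l, edgeSign S.res k * edgeSign (Function.update S.res k true) l *
        ∑ M, edgeCoeff k S M * edgeCoeff l M T = -∑ k, ∑ l, edgeSign S.res k *
          edgeSign (Function.update S.res k true) l *
            ∑ M, edgeCoeff k S M * edgeCoeff l M T := by
    conv_lhs => rw [h4]
    rw [← Finset.sum_neg_distrib]
    refine Finset.sum_congr rfl fun k _ => ?_
    rw [← Finset.sum_neg_distrib]
    refine Finset.sum_congr rfl fun l _ => ?_
    rw [h3 l k]
  omega

end Khovanov

namespace Khovanov

/-! ### Matchings in based complexes -/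

section Acyclic

variable {ι : Type*} [Fintype ι]

/-- The endomorphism of the free module on `ι` with matrix coefficients `D s t` from `s` to `t`. -/
def applyMatrix (D : ι → ι → ℤ) (x : ι → ℤ) (t : ι) : ℤ := ∑ s, D s t * x s

theorem applyMatrix_add (D : ι → ι → ℤ) (x y : ι → ℤ) (t : ι) :
    applyMatrix D (x + y) t = applyMatrix D x t + applyMatrix D y t := by
  simp [applyMatrix, mul_add, Finset.sum_add_distrib]

theorem applyMatrix_sub (D : ι → ι → ℤ) (x y : ι → ℤ) (t : ι) :
    applyMatrix D (x - y) t = applyMatrix D x t - applyMatrix D y t := by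
  simp [applyMatrix, mul_sub, Finset.sum_sub_distrib]

theorem applyMatrix_applyMatrix {D : ι → ι → ℤ} (hD : ∀ s t, ∑ m, D s m * D m t = 0)
    (x : ι → ℤ) (t : ι) : applyMatrix D (applyMatrix D x) t = 0 := by
  simp only [applyMatrix, Finset.mul_sum]
  rw [Finset.sum_comm]
  refine Finset.sum_eq_zero fun s _ => ?_
  have : ∑ m, D m t * (D s m * x s) = (∑ m, D s m * D m t) * x s := by
    rw [Finset.sum_mul]; exact Finset.sum_congr rfl fun m _ => by ring
  rw [this, hD, zero_mul]

/-- If `x` is supported in `A` and there are no matrix coefficients from `A` to `t`, then the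
coefficient of the image at `t` vanishes. -/
theorem applyMatrix_eq_zero {D : ι → ι → ℤ} {x : ι → ℤ} {t : ι}
    (h : ∀ s, x s ≠ 0 → D s t = 0) : applyMatrix D x t = 0 := by
  refine Finset.sum_eq_zero fun s _ => ?_
  by_cases hx : x s = 0
  · rw [hx, mul_zero]
  · rw [h s hx, zero_mul]

/-- A set `A` of basis elements is matched if it is the union of two disjoint sets `U` and `A \ U`
for which the part of the matrix `D` from `U` to `A \ U` is invertible. This is what a perfect
acyclic matching of discrete Morse theory provides. -/
def Matched (D : ι → ι → ℤ) (A : Set ι) : Prop :=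
  ∃ U ⊆ A,
    (∀ x : ι → ℤ, (∀ i ∉ U, x i = 0) → (∀ t ∈ A \ U, applyMatrix D x t = 0) → x = 0) ∧
    ∀ y : ι → ℤ, ∃ x : ι → ℤ, (∀ i ∉ U, x i = 0) ∧ ∀ t ∈ A \ U, applyMatrix D x t = y t

variable {D : ι → ι → ℤ}

theorem matched_empty : Matched D ∅ :=
  ⟨∅, le_rfl, fun _ hx _ => funext fun i => hx i (Set.notMem_empty i),
    fun _ => ⟨0, fun _ _ => rfl, fun t ht => absurd ht.1 (Set.notMem_empty t)⟩⟩

/-- Matched sets can be put together if one of them is closed under the differential within the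
union. -/
theorem Matched.union {B C : Set ι} (hB : Matched D B) (hC : Matched D C) (hdisj : Disjoint B C)
    (hBC : ∀ s ∈ B, ∀ t ∈ C, D s t = 0) : Matched D (B ∪ C) := by
  classical
  obtain ⟨U, hU, injU, surjU⟩ := hB
  obtain ⟨V, hV, injV, surjV⟩ := hC
  have hBV : ∀ i ∈ B, i ∉ V := fun i hi hiV => Set.disjoint_left.1 hdisj hi (hV hiV)
  have hCU : ∀ i ∈ C, i ∉ U := fun i hi hiU => Set.disjoint_left.1 hdisj (hU hiU) hi
  have hmemB : ∀ t ∈ B \ U, t ∈ (B ∪ C) \ (U ∪ V) := fun t ht =>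
    ⟨Or.inl ht.1, fun h => h.elim ht.2 (hBV t ht.1)⟩
  have hmemC : ∀ t ∈ C \ V, t ∈ (B ∪ C) \ (U ∪ V) := fun t ht =>
    ⟨Or.inr ht.1, fun h => h.elim (hCU t ht.1) ht.2⟩
  refine ⟨U ∪ V, Set.union_subset_union hU hV, ?_, ?_⟩
  · intro x hx h0
    -- the part of `x` on `V` vanishes first
    have hxV : (fun i => if i ∈ V then x i else 0) = 0 := by
      refine injV _ (fun i hi => if_neg hi) fun t ht => ?_
      refine Eq.trans ?_ (h0 t (hmemC t ht))
      refine Finset.sum_congr rfl fun s _ => ?_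
      by_cases hs : s ∈ V
      · simp [hs]
      · simp only [if_neg hs]
        by_cases hsU : s ∈ U
        · rw [hBC s (hU hsU) t ht.1]; simp
        · rw [hx s (fun h => h.elim hsU hs)]
    have hxU : ∀ i ∉ U, x i = 0 := by
      intro i hi
      by_cases hiV : i ∈ V
      · have := congrFun hxV i
        simpa [hiV] using this
      · exact hx i (fun h => h.elim hi hiV)
    exact injU x hxU fun t ht => h0 t (hmemB t ht)
  · intro y
    obtain ⟨v, hv, hv'⟩ := surjV y
    obtain ⟨u, hu, hu'⟩ := surjU (fun t => y t - applyMatrix D v t)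
    refine ⟨u + v, fun i hi => ?_, fun t ht => ?_⟩
    · rw [Pi.add_apply, hu i (fun h => hi (Or.inl h)), hv i (fun h => hi (Or.inr h)), add_zero]
    · rw [applyMatrix_add]
      rcases ht with ⟨ht | ht, hn⟩
      · rw [hu' t ⟨ht, fun h => hn (Or.inl h)⟩]; ring
      · rw [hv' t ⟨ht, fun h => hn (Or.inr h)⟩, applyMatrix_eq_zero, zero_add]
        intro s hs
        by_contra hD
        exact hs (hu s fun hsU => hD (hBC s (hU hsU) t ht))

/-- Two sets of basis elements are matched if the matrix between them is a signed permutation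
matrix. -/
theorem matched_of_bijection {U F : Set ι} (hdisj : Disjoint U F) (e : ι → ι → ℤ)
    (he : ∀ s ∈ U, ∀ t ∈ F, ∃ σ : ℤ, σ * σ = 1 ∧ D s t = σ * e s t)
    (hU : ∀ s ∈ U, ∃ t ∈ F, e s t = 1) (hF : ∀ t ∈ F, ∃ s ∈ U, e s t = 1)
    (uniqU : ∀ s ∈ U, ∀ s' ∈ U, ∀ t ∈ F, e s t ≠ 0 → e s' t ≠ 0 → s = s')
    (uniqF : ∀ s ∈ U, ∀ t ∈ F, ∀ t' ∈ F, e s t ≠ 0 → e s t' ≠ 0 → t = t') :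
    Matched D (U ∪ F) := by
  classical
  have hFeq : (U ∪ F) \ U = F := by
    rw [Set.union_sdiff_left, hdisj.symm.sdiff_eq_left]
  have key : ∀ x : ι → ℤ, (∀ i ∉ U, x i = 0) → ∀ s ∈ U, ∀ t ∈ F, e s t = 1 →
      applyMatrix D x t = D s t * x s := by
    intro x hx s hs t ht hst
    unfold applyMatrix
    rw [Finset.sum_eq_single s]
    · intro s' _ hne
      by_cases hs' : s' ∈ U
      · obtain ⟨σ, -, hσ⟩ := he s' hs' t ht
        rw [hσ]
        by_cases h0 : e s' t = 0
        · simp [h0]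
        · exact absurd (uniqU s' hs' s hs t ht h0 (by rw [hst]; exact one_ne_zero)) hne
      · rw [hx s' hs', mul_zero]
    · intro h; exact absurd (Finset.mem_univ s) h
  refine ⟨U, Set.subset_union_left, ?_, ?_⟩
  · intro x hx h0
    funext s
    by_cases hs : s ∈ U
    · obtain ⟨t, ht, hst⟩ := hU s hs
      have h1 := h0 t (hFeq.symm ▸ ht : t ∈ (U ∪ F) \ U)
      rw [key x hx s hs t ht hst] at h1
      obtain ⟨σ, hσ, hD⟩ := he s hs t ht
      rw [hD, hst, mul_one] at h1
      have : σ * (σ * x s) = 0 := by rw [h1, mul_zero]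
      rwa [← mul_assoc, hσ, one_mul] at this
    · exact hx s hs
  · intro y
    choose! f hf hf1 using hU
    refine ⟨fun s => if s ∈ U then D s (f s) * y (f s) else 0, fun i hi => if_neg hi, ?_⟩
    intro t ht
    rw [hFeq] at ht
    obtain ⟨s, hs, hst⟩ := hF t ht
    have hfs : f s = t := uniqF s hs (f s) (hf s hs) t ht
      (by rw [hf1 s hs]; exact one_ne_zero) (by rw [hst]; exact one_ne_zero)
    rw [key _ (fun i hi => if_neg hi) s hs t ht hst, if_pos hs, hfs]
    obtain ⟨σ, hσ, hD⟩ := he s hs t ht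
    rw [hD, hst, mul_one, ← mul_assoc, hσ, one_mul]

/-- A complex in which all basis elements are matched, apart from one element `a` of degree `n` and
a quotient complex `P` without rational homology in degree `n - 1`, has homology of positive rank in
degree `n`. -/
theorem exists_cycle_of_matched (hD : ∀ s t, ∑ m, D s m * D m t = 0) (deg : ι → ℤ)
    (hdeg : ∀ s t, D s t ≠ 0 → deg t = deg s + 1) {M P A : Set ι} {a : ι} {n : ℤ}
    (hM : ∀ s t, D s t ≠ 0 → (s ∈ M ↔ t ∈ M))
    (hMPA : ∀ s ∈ M, s ∈ P ∨ s = a ∨ s ∈ A) (hPM : P ⊆ M) (haM : a ∈ M) (hAM : A ⊆ M)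
    (haA : a ∉ A) (ha : deg a = n) (hA : Matched D A)
    (haP : ∀ t ∈ P, D a t = 0) (hAP : ∀ s ∈ A, ∀ t ∈ P, D s t = 0)
    (hP : ∀ y : ι → ℤ, ∃ x : ι → ℤ, (∀ i, x i ≠ 0 → i ∈ P ∧ deg i = n - 2) ∧
      ∀ t ∈ P, deg t = n - 1 → applyMatrix D x t = 2 * y t) :
    ∃ z : ι → ℤ, (∀ i, z i ≠ 0 → i ∈ M ∧ deg i = n) ∧ (∀ t, applyMatrix D z t = 0) ∧
      ∀ m : ℤ, m ≠ 0 → ∀ y : ι → ℤ, (∀ i, y i ≠ 0 → i ∈ M ∧ deg i = n - 1) →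
        ¬ ∀ t, applyMatrix D y t = m * z t := by
  classical
  obtain ⟨U, hUA, inj, surj⟩ := hA
  -- a preimage under the matched part of the matrix can be chosen homogeneous
  have surj' : ∀ (d : ℤ) (y : ι → ℤ), ∃ x : ι → ℤ, (∀ i, x i ≠ 0 → i ∈ U ∧ deg i = d) ∧
      ∀ t ∈ A \ U, deg t = d + 1 → applyMatrix D x t = y t := by
    intro d y
    obtain ⟨x, hx, hxy⟩ := surj y
    refine ⟨fun i => if deg i = d then x i else 0, fun i hi => ?_, fun t ht htd => ?_⟩
    · dsimp only at hi
      split_ifs at hi with h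
      · exact ⟨by by_contra h'; exact hi (hx i h'), h⟩
      · exact absurd rfl hi
    · rw [← hxy t ht]
      refine Finset.sum_congr rfl fun s _ => ?_
      by_cases hst : D s t = 0
      · simp [hst]
      · have := hdeg s t hst
        simp only [if_pos (show deg s = d by omega)]
  have hdeg0 : ∀ (x : ι → ℤ) (d : ℤ), (∀ i, x i ≠ 0 → deg i = d) → ∀ t, deg t ≠ d + 1 →
      applyMatrix D x t = 0 := by
    intro x d hx t ht
    refine applyMatrix_eq_zero fun s hs => ?_
    by_contra hst
    exact ht (by rw [hdeg s t hst, hx s hs])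
  have hM0 : ∀ x : ι → ℤ, (∀ i, x i ≠ 0 → i ∈ M) → ∀ t ∉ M, applyMatrix D x t = 0 := by
    intro x hx t ht
    refine applyMatrix_eq_zero fun s hs => ?_
    by_contra hst
    exact ht ((hM s t hst).1 (hx s hs))
  obtain ⟨k, hk, hk'⟩ := surj' n (fun t => - D a t)
  have hka : k a = 0 := by by_contra h; exact haA (hUA (hk a h).1)
  set δ : ι → ℤ := fun i => if i = a then 1 else 0 with hδ
  have hDδ : ∀ t, applyMatrix D δ t = D a t := by intro t; simp [applyMatrix, hδ]
  have hz : ∀ i, (δ + k) i ≠ 0 → i ∈ M ∧ deg i = n := by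
    intro i hi
    by_cases hia : i = a
    · subst hia; exact ⟨haM, ha⟩
    · have : k i ≠ 0 := by simpa [hδ, hia] using hi
      exact ⟨hAM (hUA (hk i this).1), (hk i this).2⟩
  have hzd := hdeg0 _ n fun i hi => (hz i hi).2
  have hv : applyMatrix D (δ + k) = 0 := by
    refine inj _ (fun t ht => ?_) (fun t _ => applyMatrix_applyMatrix hD _ t)
    by_cases htM : t ∈ M
    · rcases hMPA t htM with htP | rfl | htA
      · rw [applyMatrix_add, hDδ, haP t htP, applyMatrix_eq_zero, zero_add]
        exact fun s hs => hAP s (hUA (hk s hs).1) t htP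
      · exact hzd t (by omega)
      · by_cases htd : deg t = n + 1
        · rw [applyMatrix_add, hDδ, hk' t ⟨htA, ht⟩ htd]; ring
        · exact hzd t htd
    · exact hM0 _ (fun i hi => (hz i hi).1) t htM
  refine ⟨δ + k, hz, fun t => congrFun hv t, ?_⟩
  intro m hm y hy hyz
  obtain ⟨x₂, hx₂, hx₂'⟩ := hP y
  have hy₁ : ∀ t, applyMatrix D (2 • y - applyMatrix D x₂) t = 2 * (m * (δ + k) t) := by
    intro t
    rw [applyMatrix_sub, applyMatrix_applyMatrix hD, two_nsmul, applyMatrix_add, hyz]; ring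
  set y₁ := 2 • y - applyMatrix D x₂ with hy₁def
  have hx₂d := hdeg0 _ (n - 2) fun i hi => (hx₂ i hi).2
  have hx₂M := hM0 _ fun i hi => hPM (hx₂ i hi).1
  have hy₁0 : ∀ i, y₁ i ≠ 0 → (i ∈ M ∧ i ∉ P) ∧ deg i = n - 1 := by
    intro i hi
    have hi' : 2 * y i - applyMatrix D x₂ i ≠ 0 := by simpa [hy₁def] using hi
    have hd : deg i = n - 1 := by
      by_contra h
      have h1 : y i = 0 := by by_contra h'; exact h (hy i h').2
      rw [h1, hx₂d i (by omega)] at hi'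
      exact hi' (by ring)
    refine ⟨⟨?_, ?_⟩, hd⟩
    · by_contra h
      have h1 : y i = 0 := by by_contra h'; exact h (hy i h').1
      rw [h1, hx₂M i h] at hi'
      exact hi' (by ring)
    · intro hP'
      rw [hx₂' i hP' hd] at hi'
      exact hi' (by ring)
  obtain ⟨x₃, hx₃, hx₃'⟩ := surj' (n - 2) y₁
  have hx₃d := hdeg0 _ (n - 2) fun i hi => (hx₃ i hi).2
  have hx₃M := hM0 _ fun i hi => hAM (hUA (hx₃ i hi).1)
  have hy₂ : y₁ - applyMatrix D x₃ = 0 := by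
    refine inj _ (fun t ht => ?_) (fun t ht => ?_)
    · rw [Pi.sub_apply]
      by_cases htd : deg t = n - 1
      · by_cases htM : t ∈ M
        · rcases hMPA t htM with htP | rfl | htA
          · have h1 : y₁ t = 0 := by by_contra h; exact (hy₁0 t h).1.2 htP
            rw [h1, applyMatrix_eq_zero, sub_zero]
            exact fun s hs => hAP s (hUA (hx₃ s hs).1) t htP
          · omega
          · rw [hx₃' t ⟨htA, ht⟩ (by omega), sub_self]
        · have h1 : y₁ t = 0 := by by_contra h; exact htM (hy₁0 t h).1.1
          rw [h1, hx₃M t htM, sub_zero]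
      · have h1 : y₁ t = 0 := by by_contra h; exact htd (hy₁0 t h).2
        rw [h1, hx₃d t (by omega), sub_zero]
    · have hta : t ≠ a := fun h => haA (h ▸ ht.1)
      have htk : k t = 0 := by by_contra h; exact ht.2 (hk t h).1
      rw [applyMatrix_sub, hy₁, applyMatrix_applyMatrix hD]
      simp [hδ, hta, htk]
  have h1 := hy₁ a
  rw [sub_eq_zero.1 hy₂, applyMatrix_applyMatrix hD] at h1
  have h2 : (δ + k) a = 1 := by simp [hδ, hka]
  rw [h2] at h1
  exact hm (by omega)

end Acyclic

/-! ### Cycles of infinite order -/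

section Homology

variable {p : ℕ} {w : BraidWord p}

/-- The homology has positive rank where there is a cycle without multiples that bound. -/
theorem homologyRank_pos {i j : ℤ} (z : Chain w i j) (hz : z ∈ cycles w i j)
    (hb : ∀ m : ℤ, m ≠ 0 → m • z ∉ boundaries w i j) : 0 < homologyRank w i j := by
  set H := Homology w i j
  let c : H := Submodule.Quotient.mk ⟨z, hz⟩
  have hc : ∀ m : ℤ, m • c = 0 → m = 0 := by
    intro m hm
    by_contra h0
    have h1 : (Submodule.Quotient.mk (m • (⟨z, hz⟩ : cycles w i j)) : H) = 0 := hm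
    rw [Submodule.Quotient.mk_eq_zero] at h1
    exact hb m h0 h1
  have hinj : Function.Injective (LinearMap.toSpanSingleton ℤ H c) := by
    rw [injective_iff_map_eq_zero]
    intro m hm
    exact hc m (by simpa using hm)
  have hinj' := Module.Flat.lTensor_preserves_injective_linearMap (M := ℚ) _ hinj
  have hfin : Module.Finite ℤ H := inferInstance
  have hne : (1 : ℚ) ⊗ₜ[ℤ] c ≠ 0 := by
    intro h0
    have h1 : LinearMap.lTensor ℚ (LinearMap.toSpanSingleton ℤ H c) ((1 : ℚ) ⊗ₜ (1 : ℤ)) = 0 := by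
      simpa using h0
    have h2 := (injective_iff_map_eq_zero _).1 hinj' _ h1
    have h3 := congrArg (TensorProduct.rid ℤ ℚ) h2
    simp at h3
  have : Nontrivial (ℚ ⊗[ℤ] H) := ⟨⟨_, _, hne⟩⟩
  exact Module.finrank_pos

/-- A function on all states, supported in one bidegree, that is a cycle and has no multiples that
bound. -/
theorem homologyRank_pos_of_total {i j : ℤ} (z : EnhancedState w → ℤ)
    (hz : ∀ S, z S ≠ 0 → S.hDeg = i ∧ S.qDeg = j) (hcyc : ∀ T, applyMatrix diffCoeff z T = 0)
    (hb : ∀ m : ℤ, m ≠ 0 → ∀ y : EnhancedState w → ℤ,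
      (∀ S, y S ≠ 0 → S.hDeg = i - 1 ∧ S.qDeg = j) → ¬ ∀ T, applyMatrix diffCoeff y T = m * z T) :
    0 < homologyRank w i j := by
  classical
  have hsum : ∀ (i : ℤ) (x : EnhancedState w → ℤ), (∀ S, x S ≠ 0 → S.hDeg = i ∧ S.qDeg = j) →
      ∀ i' (T : ChainBasis w i' j),
        diff w i i' j (fun S => x S.1) T = applyMatrix diffCoeff x T.1 := by
    intro i x hx i' T
    have h1 : diff w i i' j (fun S => x S.1) T =
        ∑ S : ChainBasis w i j, diffCoeff S.1 T.1 * x S.1 := rfl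
    rw [h1]
    refine Fintype.sum_of_injective Subtype.val Subtype.val_injective _ _ ?_ (fun _ => rfl)
    intro S hS
    by_cases h0 : x S = 0
    · rw [h0, mul_zero]
    · exact absurd ⟨⟨S, hx S h0⟩, rfl⟩ hS
  refine homologyRank_pos (fun S => z S.1) ?_ ?_
  · rw [LinearMap.mem_ker]
    funext T
    rw [hsum i z hz]
    exact hcyc T.1
  · rintro m hm ⟨y, hy⟩
    let y' : EnhancedState w → ℤ := fun S =>
      if h : S.hDeg = i - 1 ∧ S.qDeg = j then y ⟨S, h⟩ else 0
    have hy' : ∀ S, y' S ≠ 0 → S.hDeg = i - 1 ∧ S.qDeg = j := by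
      intro S hS
      by_contra h
      exact hS (dif_neg h)
    have hyy : (fun S : ChainBasis w (i - 1) j => y' S.1) = y := by
      funext S
      exact dif_pos S.2
    refine hb m hm y' hy' fun T => ?_
    by_cases hT : T.hDeg = i ∧ T.qDeg = j
    · rw [← hsum (i - 1) y' hy' i ⟨T, hT⟩, hyy, hy]
      rfl
    · have hzT : z T = 0 := by by_contra h; exact hT (hz T h)
      rw [hzT, mul_zero]
      refine applyMatrix_eq_zero fun S hS => ?_
      by_contra h
      have h1 := hDeg_of_diffCoeff_ne_zero h
      have h2 := qDeg_of_diffCoeff_ne_zero h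
      have h3 := hy' S hS
      exact hT ⟨by omega, by omega⟩

end Homology

end Khovanov

namespace Khovanov

variable {p : ℕ} {w : BraidWord p}

open EnhancedState

/-! ### Circles of positive braids -/

/-- A braid word without inverse generators. -/
def IsPositive (w : BraidWord p) : Prop := ∀ k, (w.get k).2 = true

theorem IsPositive.isVertical_iff (hw : IsPositive w) {ε : Resolution w} {k : Fin w.length} :
    IsVertical w ε k ↔ ε k = false := by
  unfold IsVertical; rw [hw k]; rfl

/-- The column of a crossing: the position of its left strand. -/
def col (k : Fin w.length) : ℕ := (leftPos w k).val

/-- A set of points is closed in a resolution if it is a union of circles. -/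
def IsClosedIn (ε : Resolution w) (O : Set (Node w)) : Prop :=
  ∀ u v, Arc w ε u v → (u ∈ O ↔ v ∈ O)

theorem IsClosedIn.mem_iff {ε : Resolution w} {O : Set (Node w)} (hO : IsClosedIn ε O)
    {u v : Node w} (h : circleOf w ε u = circleOf w ε v) : u ∈ O ↔ v ∈ O := by
  have := Quot.eqvGen_exact h
  clear h
  induction this with
  | rel _ _ h => exact hO _ _ h
  | refl => exact Iff.rfl
  | symm _ _ _ ih => exact ih.symm
  | trans _ _ _ _ _ ih1 ih2 => exact ih1.trans ih2

theorem IsClosedIn.ne {ε : Resolution w} {O : Set (Node w)} (hO : IsClosedIn ε O)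
    {u v : Node w} (hu : u ∈ O) (hv : v ∉ O) : circleOf w ε u ≠ circleOf w ε v :=
  fun h => hv ((hO.mem_iff h).1 hu)

section ClosedSets

variable {ε : Resolution w}

/-- The points on the strands `c` and `c + 1` above the crossing `lo` and below the crossing `hi`.
They form a circle if these crossings lie in column `c`, are resolved by a cap and a cup, and
are not separated by a crossing of this kind in a neighbouring column. -/
def tube (c : ℕ) (lo hi : Fin w.length) : Set (Node w) :=
  {v | (v.1.val = c ∨ v.1.val = c + 1) ∧ lo.val < v.2.val ∧ v.2.val ≤ hi.val}

/-- The points on the strands `c` and `c + 1` that lie above the crossing `hi` or below the crossing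
`lo`. -/
def outerTube (c : ℕ) (lo hi : Fin w.length) : Set (Node w) :=
  {v | (v.1.val = c ∨ v.1.val = c + 1) ∧ (hi.val < v.2.val ∨ v.2.val ≤ lo.val)}

theorem isClosedIn_tube (hw : IsPositive w) {c : ℕ} {lo hi : Fin w.length}
    (hlo : col lo = c) (hhi : col hi = c) (h1 : ε lo = true) (h2 : ε hi = true)
    (h : ∀ l : Fin w.length, lo < l → l < hi → col l ≤ c + 1 → c ≤ col l + 1 → ε l = false) :
    IsClosedIn ε (tube c lo hi) := by
  intro u v huv
  rcases huv with s | ⟨k, s, hl, hr⟩ | ⟨k, hk⟩ | ⟨k, hk⟩ | ⟨k, hk⟩ | ⟨k, hk⟩ <;>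
    simp only [tube, Set.mem_ofPred_eq, Fin.val_last, Fin.val_zero, Fin.val_castSucc, Fin.val_succ,
      rightPos_val] <;> have hlo' := lo.isLt <;> have hhi' := hi.isLt <;> unfold col at *
  · omega
  · have hl' : s.val ≠ (leftPos w k).val := fun e => hl (Fin.ext e)
    have hr' : s.val ≠ (leftPos w k).val + 1 := fun e => hr (Fin.ext e)
    by_cases e1 : k = lo
    · subst e1; omega
    by_cases e2 : k = hi
    · subst e2; omega
    have := Fin.val_ne_of_ne e1
    have := Fin.val_ne_of_ne e2
    omega
  all_goals rw [hw.isVertical_iff] at hk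
  · have e1 : k ≠ lo := by rintro rfl; simp [h1] at hk
    have e2 : k ≠ hi := by rintro rfl; simp [h2] at hk
    have := Fin.val_ne_of_ne e1
    have := Fin.val_ne_of_ne e2
    omega
  · have e1 : k ≠ lo := by rintro rfl; simp [h1] at hk
    have e2 : k ≠ hi := by rintro rfl; simp [h2] at hk
    have := Fin.val_ne_of_ne e1
    have := Fin.val_ne_of_ne e2
    omega
  all_goals
    by_cases e1 : k = lo
    · subst e1; omega
    by_cases e2 : k = hi
    · subst e2; omega
    have := Fin.val_ne_of_ne e1
    have := Fin.val_ne_of_ne e2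
    have h3 := h k
    rw [Fin.lt_def, Fin.lt_def] at h3
    have h4 : ¬ (lo.val < k.val ∧ k.val < hi.val ∧ (leftPos w k).val ≤ c + 1 ∧
      c ≤ (leftPos w k).val + 1) := fun ⟨a, b, d, e⟩ => hk (h3 a b d e)
    omega

theorem isClosedIn_outerTube (hw : IsPositive w) {c : ℕ} {lo hi : Fin w.length} (hlh : lo ≤ hi)
    (hlo : col lo = c) (hhi : col hi = c) (h1 : ε lo = true) (h2 : ε hi = true)
    (h : ∀ l : Fin w.length, l < lo ∨ hi < l → col l ≤ c + 1 → c ≤ col l + 1 → ε l = false) :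
    IsClosedIn ε (outerTube c lo hi) := by
  intro u v huv
  rw [Fin.le_def] at hlh
  rcases huv with s | ⟨k, s, hl, hr⟩ | ⟨k, hk⟩ | ⟨k, hk⟩ | ⟨k, hk⟩ | ⟨k, hk⟩ <;>
    simp only [outerTube, Set.mem_ofPred_eq, Fin.val_last, Fin.val_zero, Fin.val_castSucc,
      Fin.val_succ, rightPos_val] <;> have hlo' := lo.isLt <;> have hhi' := hi.isLt <;>
    unfold col at *
  · omega
  · have hl' : s.val ≠ (leftPos w k).val := fun e => hl (Fin.ext e)
    have hr' : s.val ≠ (leftPos w k).val + 1 := fun e => hr (Fin.ext e)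
    by_cases e1 : k = lo
    · subst e1; omega
    by_cases e2 : k = hi
    · subst e2; omega
    have := Fin.val_ne_of_ne e1
    have := Fin.val_ne_of_ne e2
    omega
  all_goals rw [hw.isVertical_iff] at hk
  · have e1 : k ≠ lo := by rintro rfl; simp [h1] at hk
    have e2 : k ≠ hi := by rintro rfl; simp [h2] at hk
    have := Fin.val_ne_of_ne e1
    have := Fin.val_ne_of_ne e2
    omega
  · have e1 : k ≠ lo := by rintro rfl; simp [h1] at hk
    have e2 : k ≠ hi := by rintro rfl; simp [h2] at hk
    have := Fin.val_ne_of_ne e1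
    have := Fin.val_ne_of_ne e2
    omega
  all_goals
    by_cases e1 : k = lo
    · subst e1; omega
    by_cases e2 : k = hi
    · subst e2; omega
    have := Fin.val_ne_of_ne e1
    have := Fin.val_ne_of_ne e2
    have h3 := h k
    rw [Fin.lt_def, Fin.lt_def] at h3
    have h4 : ¬ ((k.val < lo.val ∨ hi.val < k.val) ∧ (leftPos w k).val ≤ c + 1 ∧
      c ≤ (leftPos w k).val + 1) := fun ⟨a, d, e⟩ => hk (h3 a d e)
    omega

theorem isClosedIn_strand (hw : IsPositive w) {s : ℕ}
    (h : ∀ l : Fin w.length, col l ≤ s → s ≤ col l + 1 → ε l = false) :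
    IsClosedIn ε {v : Node w | v.1.val = s} := by
  intro u v huv
  rcases huv with s | ⟨k, s, hl, hr⟩ | ⟨k, hk⟩ | ⟨k, hk⟩ | ⟨k, hk⟩ | ⟨k, hk⟩ <;>
    simp only [Set.mem_ofPred_eq, rightPos_val]
  all_goals
    rw [hw.isVertical_iff] at hk
    have h3 := h k
    unfold col at h3
    have h4 : ¬ ((leftPos w k).val ≤ s ∧ s ≤ (leftPos w k).val + 1) := fun ⟨a, d⟩ => hk (h3 a d)
    omega

theorem isClosedIn_left (hw : IsPositive w) {c : ℕ}
    (h : ∀ l : Fin w.length, col l = c → ε l = false) :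
    IsClosedIn ε {v : Node w | v.1.val ≤ c} := by
  intro u v huv
  rcases huv with s | ⟨k, s, hl, hr⟩ | ⟨k, hk⟩ | ⟨k, hk⟩ | ⟨k, hk⟩ | ⟨k, hk⟩ <;>
    simp only [Set.mem_ofPred_eq, rightPos_val]
  all_goals
    rw [hw.isVertical_iff] at hk
    have h3 := h k
    unfold col at h3
    have h4 : (leftPos w k).val ≠ c := fun e => hk (h3 e)
    omega

theorem circleOf_vertical (hw : IsPositive w) {k : Fin w.length} {s : Fin p}
    (h : col k = s.val ∨ col k + 1 = s.val → ε k = false) :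
    circleOf w ε (s, k.castSucc) = circleOf w ε (s, k.succ) := by
  by_cases hl : s = leftPos w k
  · subst hl
    exact circleOf_of_arc (Arc.left k (hw.isVertical_iff.2 (h (Or.inl rfl))))
  by_cases hr : s = rightPos w k
  · subst hr
    exact circleOf_of_arc (Arc.right k (hw.isVertical_iff.2 (h (Or.inr rfl))))
  exact circleOf_of_arc (Arc.away k s hl hr)

theorem circleOf_strand_le (hw : IsPositive w) {s : Fin p} {a b : ℕ} (hab : a ≤ b)
    (hb : b < w.length + 1) (h : ∀ l : Fin w.length, a ≤ l.val → l.val < b →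
      (col l = s.val ∨ col l + 1 = s.val) → ε l = false) :
    circleOf w ε (s, ⟨a, by omega⟩) = circleOf w ε (s, ⟨b, hb⟩) := by
  induction b, hab using Nat.le_induction with
  | base => rfl
  | succ b hab ih =>
    rw [ih (by omega) fun l h1 h2 => h l h1 (by omega)]
    exact circleOf_vertical hw (k := ⟨b, by omega⟩)
      (fun h' => h ⟨b, by omega⟩ hab (Nat.lt_succ_self b) h')

theorem circleOf_strand (hw : IsPositive w) {s : Fin p}
    (h : ∀ l : Fin w.length, (col l = s.val ∨ col l + 1 = s.val) → ε l = false)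
    (x : Fin (w.length + 1)) : circleOf w ε (s, x) = circleOf w ε (s, 0) :=
  (circleOf_strand_le hw (Nat.zero_le x.val) x.isLt fun l _ _ hl => h l hl).symm

theorem circleOf_lower (hw : IsPositive w) {k : Fin w.length} (hk : ε k = true) :
    circleOf w ε (leftPos w k, k.castSucc) = circleOf w ε (rightPos w k, k.castSucc) :=
  circleOf_of_arc (Arc.lower k (by rw [hw.isVertical_iff, hk]; simp))

theorem circleOf_upper (hw : IsPositive w) {k : Fin w.length} (hk : ε k = true) :
    circleOf w ε (leftPos w k, k.succ) = circleOf w ε (rightPos w k, k.succ) :=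
  circleOf_of_arc (Arc.upper k (by rw [hw.isVertical_iff, hk]; simp))

/-- A tube is a single circle. -/
theorem circleOf_tube (hw : IsPositive w) {c : ℕ} {lo hi : Fin w.length}
    (hlo : col lo = c) (h1 : ε lo = true)
    (h : ∀ l : Fin w.length, lo < l → l < hi → col l ≤ c + 1 → c ≤ col l + 1 → ε l = false)
    {v : Node w} (hv : v ∈ tube c lo hi) : circleOf w ε v = circleOf w ε (cornerB w lo) := by
  obtain ⟨s, x⟩ := v
  obtain ⟨hs, hx1, hx2⟩ := hv
  dsimp only at hs hx1 hx2
  have key : circleOf w ε (s, lo.succ) = circleOf w ε (s, x) := by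
    refine circleOf_strand_le hw (s := s) (a := lo.val + 1) (by omega) x.isLt ?_
    intro l hl1 hl2 hl3
    refine h l (by rw [Fin.lt_def]; omega) (by rw [Fin.lt_def]; omega) ?_ ?_ <;> omega
  rw [← key]
  rcases hs with hs | hs
  · have : s = leftPos w lo := Fin.ext (hs.trans hlo.symm)
    subst this
    exact circleOf_upper hw h1
  · have : s = rightPos w lo := Fin.ext (by rw [rightPos_val]; unfold col at hlo; omega)
    subst this
    rfl

end ClosedSets

/-! ### Counting circles -/

theorem card_circle_le_of_zero (hw : IsPositive w) {ε : Resolution w} (h : ∀ k, ε k = false) :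
    Fintype.card (Circle w ε) ≤ p := by
  have hs : Function.Surjective (fun s : Fin p => circleOf w ε (s, 0)) := by
    intro c
    obtain ⟨⟨s, x⟩, rfl⟩ := exists_circleOf c
    exact ⟨s, (circleOf_strand hw (fun l _ => h l) x).symm⟩
  simpa using Fintype.card_le_of_surjective _ hs

theorem card_circle_update_le {ε : Resolution w} {k : Fin w.length} (hk : ε k = false) :
    Fintype.card (Circle w (Function.update ε k true)) ≤ Fintype.card (Circle w ε) + 1 := by
  classical
  have := card_circle_update hk
  split_ifs at this <;> omega

/-- A crossing in a column without 1-resolutions merges two circles. -/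
theorem circleOf_corners_ne (hw : IsPositive w) {ε : Resolution w} {k : Fin w.length}
    (h : ∀ l, col l = col k → ε l = false) :
    circleOf w ε (cornerA w k) ≠ circleOf w ε (cornerB w k) := by
  refine (isClosedIn_left hw h).ne ?_ ?_
  · exact le_refl (col k)
  · change ¬ (rightPos w k).val ≤ col k
    rw [rightPos_val]; unfold col; omega

/-- The number of 1-resolutions. -/
def ones (ε : Resolution w) : ℕ := (Finset.univ.filter fun k => ε k = true).card

theorem ones_update {ε : Resolution w} {k : Fin w.length} (hk : ε k = false) :
    ones (Function.update ε k true) = ones ε + 1 := weight_update hk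

/-- Of the changes from the 0-resolution that lead to `ε`, at least one for each column that occurs
is a merge; the others are merges or splits. -/
theorem card_circle_add_le (hw : IsPositive w) (ε : Resolution w) (C : Finset ℕ)
    (hC : ∀ c ∈ C, ∃ k, col k = c ∧ ε k = true) :
    Fintype.card (Circle w ε) + 2 * C.card ≤ p + ones ε := by
  induction hn : ones ε generalizing ε C with
  | zero =>
    have h0 : ∀ k, ε k = false := by
      intro k
      rw [ones, Finset.card_eq_zero, Finset.filter_eq_empty_iff] at hn
      simpa using hn (Finset.mem_univ k)
    have : C = ∅ := by
      refine Finset.eq_empty_of_forall_notMem fun c hc => ?_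
      obtain ⟨k, -, hk⟩ := hC c hc
      simp [h0 k] at hk
    subst this
    simpa using card_circle_le_of_zero hw h0
  | succ n ih =>
    obtain ⟨k, hk⟩ : ∃ k, ε k = true := by
      have : 0 < ones ε := by omega
      obtain ⟨k, hk⟩ := Finset.card_pos.1 this
      exact ⟨k, (Finset.mem_filter.1 hk).2⟩
    set ε₀ := Function.update ε k false with hε₀
    have hk₀ : ε₀ k = false := by simp [hε₀]
    have hup : Function.update ε₀ k true = ε := by
      rw [hε₀, Function.update_idem, ← hk, Function.update_eq_self]
    have hn₀ : ones ε₀ = n := by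
      have := ones_update hk₀
      rw [hup, hn] at this
      omega
    by_cases hcol : ∃ l, col l = col k ∧ ε₀ l = true
    · have h1 := ih ε₀ C (fun c hc => by
        obtain ⟨l, hl, hl'⟩ := hC c hc
        by_cases hlk : l = k
        · subst hlk; rw [← hl]; exact hcol
        · exact ⟨l, hl, by simp [hε₀, hlk, hl']⟩) hn₀
      have h2 := card_circle_update_le hk₀
      rw [hup] at h2
      omega
    · push Not at hcol
      have h1 := ih ε₀ (C.erase (col k)) (fun c hc => by
        obtain ⟨l, hl, hl'⟩ := hC c (Finset.mem_of_mem_erase hc)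
        have hlk : l ≠ k := by rintro rfl; exact Finset.ne_of_mem_erase hc hl.symm
        exact ⟨l, hl, by simp [hε₀, hlk, hl']⟩) hn₀
      have h2 := (isMerge_update hk₀ (circleOf_corners_ne hw fun l hl => by
        simpa using hcol l hl)).card_eq
      rw [hup] at h2
      have h3 := Finset.pred_card_le_card_erase (s := C) (a := col k)
      omega

/-- The quantum degree up to a shift. For a positive braid, the level is `0` for the state with the
0-resolution at all crossings and all circles labelled `X`. -/
noncomputable def level (S : EnhancedState w) : ℤ := S.degSum + S.weight + p

theorem level_of_edgeCoeff_ne_zero {k : Fin w.length} {S T : EnhancedState w}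
    (h : edgeCoeff k S T ≠ 0) : level T = level S := by
  unfold level
  rw [weight_of_edgeCoeff_ne_zero h, degSum_of_edgeCoeff_ne_zero h]
  push_cast; ring

/-- The sum of the degrees of the labels, by the number of circles labelled `1`. -/
theorem degSum_eq_card (S : EnhancedState w) :
    S.degSum = 2 * (Finset.univ.filter fun c => S.label c = .one).card -
      Fintype.card (Circle w S.res) := by
  unfold EnhancedState.degSum
  rw [Finset.card_filter, Fintype.card, Finset.card_eq_sum_ones]
  push_cast
  rw [Finset.mul_sum, ← Finset.sum_sub_distrib]
  refine Finset.sum_congr rfl fun c _ => ?_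
  cases S.label c <;> simp [Gen.deg]

/-- A lower bound for the level by the number of columns with a 1-resolution and the number of
circles labelled `1`. -/
theorem le_level (hw : IsPositive w) (S : EnhancedState w) (C : Finset ℕ)
    (hC : ∀ c ∈ C, ∃ k, col k = c ∧ S.res k = true) (L : Finset (Node w))
    (hL : ∀ u ∈ L, ∀ v ∈ L, circleOf w S.res u = circleOf w S.res v → u = v)
    (hone : ∀ v ∈ L, S.labelAt v = .one) : 2 * ((C.card : ℤ) + L.card) ≤ level S := by
  classical
  have h1 := card_circle_add_le hw S.res C hC
  have h2 := degSum_eq_card S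
  have h3 : L.card ≤ (Finset.univ.filter fun c => S.label c = .one).card := by
    refine Finset.card_le_card_of_injOn (circleOf w S.res) (fun v hv => ?_)
      (fun u hu v hv => hL u hu v hv)
    exact Finset.mem_coe.2 (Finset.mem_filter.2 ⟨Finset.mem_univ _, hone v hv⟩)
  have h4 : S.weight = ones S.res := rfl
  unfold level
  omega

end Khovanov

namespace Khovanov

variable {p : ℕ} {w : BraidWord p}

open EnhancedState

/-! ### Matching states across a merge -/

/-- The points `x` and `y` are the two corners of the crossing `k`. -/
def AreCorners (k : Fin w.length) (x y : Node w) : Prop :=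
  (x = cornerA w k ∧ y = cornerB w k) ∨ (x = cornerB w k ∧ y = cornerA w k)

/-- The state `c` is obtained from the state `f` by merging the circle through `x`, which is labelled
`g`, into the circle through `y`, whose label is kept. -/
structure Absorbs (g : Gen) (x y : Node w) (f c : EnhancedState w) : Prop where
  label_x : f.labelAt x = g
  label_y : f.labelAt y = c.labelAt y
  label_away : ∀ v, circleOf w c.res v ≠ circleOf w c.res y → f.labelAt v = c.labelAt v

section Absorbs

variable {k : Fin w.length} {x y : Node w} {g : Gen}

theorem AreCorners.ne {ε ε' : Resolution w} (hxy : AreCorners k x y) (h : IsMerge ε ε' k) :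
    circleOf w ε x ≠ circleOf w ε y := by
  rcases hxy with ⟨rfl, rfl⟩ | ⟨rfl, rfl⟩
  · exact h.ne
  · exact h.ne.symm

theorem AreCorners.eq {ε ε' : Resolution w} (hxy : AreCorners k x y) (h : IsMerge ε ε' k) :
    circleOf w ε' x = circleOf w ε' y := by
  rcases hxy with ⟨rfl, rfl⟩ | ⟨rfl, rfl⟩
  · exact h.corners_eq
  · exact h.corners_eq.symm

theorem AreCorners.eq_iff {ε ε' : Resolution w} (hxy : AreCorners k x y) (h : IsMerge ε ε' k)
    (v : Node w) : circleOf w ε' v = circleOf w ε' y ↔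
      circleOf w ε v = circleOf w ε x ∨ circleOf w ε v = circleOf w ε y := by
  rcases hxy with ⟨rfl, rfl⟩ | ⟨rfl, rfl⟩
  · rw [← h.corners_eq, h.eq_cornerA_iff]
  · rw [h.eq_cornerA_iff]; tauto

theorem AreCorners.iff_of_ne {ε ε' : Resolution w} (hxy : AreCorners k x y)
    (h : IsMerge ε ε' k) {u v : Node w} (hv : circleOf w ε' v ≠ circleOf w ε' y)
    (huv : circleOf w ε' u = circleOf w ε' v) : circleOf w ε u = circleOf w ε v := by
  rw [Ne, hxy.eq_iff h] at hv
  rcases (h.iff u v).1 huv with h1 | ⟨-, h1⟩ | ⟨-, h1⟩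
  · exact h1
  all_goals rcases hxy with ⟨rfl, rfl⟩ | ⟨rfl, rfl⟩ <;> tauto

/-- Labels away from the absorbed circle do not change. -/
theorem Absorbs.labelAt_eq {f c : EnhancedState w} (h : Absorbs g x y f c)
    (hxy : AreCorners k x y) (hm : IsMerge f.res c.res k) {v : Node w}
    (hv : circleOf w f.res v ≠ circleOf w f.res x) : f.labelAt v = c.labelAt v := by
  by_cases hvy : circleOf w c.res v = circleOf w c.res y
  · rw [c.labelAt_eq hvy, ← h.label_y]
    exact f.labelAt_eq (((hxy.eq_iff hm v).1 hvy).resolve_left hv)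
  · exact h.label_away v hvy

theorem exists_absorbs_of_coarse (hxy : AreCorners k x y) {ε : Resolution w} (c : EnhancedState w)
    (hm : IsMerge ε c.res k) (g : Gen) : ∃ f : EnhancedState w, f.res = ε ∧ Absorbs g x y f c := by
  classical
  refine ⟨ofLabel ε (fun v => if circleOf w ε v = circleOf w ε x then g else c.labelAt v) ?_, rfl,
    if_pos rfl, if_neg (hxy.ne hm).symm, ?_⟩
  · intro u v huv
    simp only [huv]
    rw [c.labelAt_eq (hm.le huv)]
  · intro v hv
    have := (hxy.eq_iff hm v).not.1 hv
    exact if_neg (by tauto)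

theorem exists_absorbs_of_fine (hxy : AreCorners k x y) {ε : Resolution w} (f : EnhancedState w)
    (hm : IsMerge f.res ε k) (hx : f.labelAt x = g) :
    ∃ c : EnhancedState w, c.res = ε ∧ Absorbs g x y f c := by
  classical
  refine ⟨ofLabel ε (fun v => if circleOf w ε v = circleOf w ε y then f.labelAt y
    else f.labelAt v) ?_, rfl, hx, (if_pos rfl).symm, ?_⟩
  · intro u v huv
    simp only [huv]
    split_ifs with hv
    · rfl
    · exact f.labelAt_eq (hxy.iff_of_ne hm hv huv)
  · intro v hv
    exact (if_neg hv).symm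

theorem Absorbs.unique_fine (hxy : AreCorners k x y) {f f' c : EnhancedState w}
    (hm : IsMerge f.res c.res k) (hres : f.res = f'.res) (h : Absorbs g x y f c)
    (h' : Absorbs g x y f' c) : f = f' := by
  refine ext_labelAt hres fun v => ?_
  by_cases hv : circleOf w f.res v = circleOf w f.res x
  · rw [f.labelAt_eq hv, f'.labelAt_eq (hres ▸ hv), h.label_x, h'.label_x]
  · rw [h.labelAt_eq hxy hm hv, h'.labelAt_eq hxy (hres ▸ hm) (hres ▸ hv)]

theorem Absorbs.unique_coarse {f c c' : EnhancedState w}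
    (hres : c.res = c'.res) (h : Absorbs g x y f c)
    (h' : Absorbs g x y f c') : c = c' := by
  refine ext_labelAt hres fun v => ?_
  by_cases hv : circleOf w c.res v = circleOf w c.res y
  · rw [c.labelAt_eq hv, c'.labelAt_eq (hres ▸ hv), ← h.label_y, ← h'.label_y]
  · rw [← h.label_away v hv, ← h'.label_away v (hres ▸ hv)]

/-- The coefficient of a split at a state whose new circle is labelled `X`. -/
theorem edgeCoeff_of_absorbs_X (hxy : AreCorners k x y) {f c : EnhancedState w}
    (hk : c.res k = false) (hres : f.res = Function.update c.res k true)
    (hm : IsMerge f.res c.res k) (h : Absorbs .X x y f c) : edgeCoeff k c f = 1 := by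
  have heq := hm.corners_eq
  rw [edgeCoeff_split hk hres heq]
  · have h1 := h.label_x
    have h2 := h.label_y
    rcases hxy with ⟨rfl, rfl⟩ | ⟨rfl, rfl⟩
    · rw [c.labelAt_eq heq, ← h2, h1]
      cases f.labelAt (cornerB w k) <;> rfl
    · rw [← h2, h1]
      cases f.labelAt (cornerA w k) <;> rfl
  · intro v hv
    refine h.label_away v ?_
    rcases hxy with ⟨rfl, rfl⟩ | ⟨rfl, rfl⟩
    · exact heq ▸ hv
    · exact hv

theorem absorbs_X_of_edgeCoeff (hxy : AreCorners k x y) {f c : EnhancedState w}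
    (hm : IsMerge f.res c.res k) (hx : f.labelAt x = .X) (h : edgeCoeff k c f ≠ 0) :
    Absorbs .X x y f c := by
  have heq := hm.corners_eq
  obtain ⟨hk, hres⟩ := res_of_edgeCoeff_ne_zero h
  have haway := labelAt_of_edgeCoeff_ne_zero h
  rw [edgeCoeff_split hk hres heq (fun v hv => haway v hv (heq ▸ hv))] at h
  refine ⟨hx, ?_, fun v hv => ?_⟩
  · rcases hxy with ⟨rfl, rfl⟩ | ⟨rfl, rfl⟩
    · rw [hx, c.labelAt_eq heq] at h
      revert h
      cases c.labelAt (cornerB w k) <;> cases f.labelAt (cornerB w k) <;> simp [comulCoeff]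
    · rw [hx] at h
      revert h
      cases c.labelAt (cornerA w k) <;> cases f.labelAt (cornerA w k) <;> simp [comulCoeff]
  · refine haway v ?_ ?_ <;> rcases hxy with ⟨rfl, rfl⟩ | ⟨rfl, rfl⟩
    · exact heq ▸ hv
    · exact hv
    · exact hv
    · exact heq ▸ hv

/-- The coefficient of a merge at a state one of whose circles at the crossing is labelled `1`. -/
theorem edgeCoeff_of_absorbs_one (hxy : AreCorners k x y) {f c : EnhancedState w}
    (hk : f.res k = false) (hres : c.res = Function.update f.res k true)
    (hm : IsMerge f.res c.res k) (h : Absorbs .one x y f c) : edgeCoeff k f c = 1 := by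
  have heq := hm.corners_eq
  rw [edgeCoeff_merge hk hres hm.ne]
  · have h1 := h.label_x
    have h2 := h.label_y
    rcases hxy with ⟨rfl, rfl⟩ | ⟨rfl, rfl⟩
    · rw [c.labelAt_eq heq, ← h2, h1]
      cases f.labelAt (cornerB w k) <;> rfl
    · rw [← h2, h1]
      cases f.labelAt (cornerA w k) <;> rfl
  · intro v hA hB
    refine (h.labelAt_eq hxy hm ?_).symm
    rcases hxy with ⟨rfl, rfl⟩ | ⟨rfl, rfl⟩
    · exact hA
    · exact hB

theorem absorbs_one_of_edgeCoeff (hxy : AreCorners k x y) {f c : EnhancedState w}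
    (hm : IsMerge f.res c.res k) (hx : f.labelAt x = .one) (h : edgeCoeff k f c ≠ 0) :
    Absorbs .one x y f c := by
  have heq := hm.corners_eq
  obtain ⟨hk, hres⟩ := res_of_edgeCoeff_ne_zero h
  have haway := labelAt_of_edgeCoeff_ne_zero h
  rw [edgeCoeff_merge hk hres hm.ne haway] at h
  refine ⟨hx, ?_, fun v hv => (haway v ?_ ?_).symm⟩
  · rcases hxy with ⟨rfl, rfl⟩ | ⟨rfl, rfl⟩
    · rw [hx, c.labelAt_eq heq] at h
      revert h
      cases c.labelAt (cornerB w k) <;> cases f.labelAt (cornerB w k) <;> simp [mulCoeff]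
    · rw [hx] at h
      revert h
      cases c.labelAt (cornerA w k) <;> cases f.labelAt (cornerA w k) <;> simp [mulCoeff]
  all_goals
    have := (hxy.eq_iff hm v).not.1 hv
    rcases hxy with ⟨rfl, rfl⟩ | ⟨rfl, rfl⟩ <;> tauto

end Absorbs

/-! ### Families of states -/

/-- The states of level 6 (in homological degree `4`, these lie on the diagonal below the two
diagonals of the homology in degree `0`) with prescribed resolutions at some crossings and
prescribed labels at some points: the crossings in `Z` have the 0-resolution, those in `I` the
1-resolution, the points in `L₁` the label `1`, and those in `LX` the label `X`. -/
def Family (Z I : Set (Fin w.length)) (L₁ LX : Set (Node w)) : Set (EnhancedState w) :=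
  {S | level S = 6 ∧ (∀ k ∈ Z, S.res k = false) ∧ (∀ k ∈ I, S.res k = true) ∧
    (∀ v ∈ L₁, S.labelAt v = .one) ∧ ∀ v ∈ LX, S.labelAt v = .X}

theorem mem_family_insert_left {Z I : Set (Fin w.length)} {L₁ LX : Set (Node w)} {k} {S} :
    S ∈ Family (insert k Z) I L₁ LX ↔ S ∈ Family Z I L₁ LX ∧ S.res k = false := by
  simp only [Family, Set.mem_ofPred_eq, Set.forall_mem_insert]; tauto

theorem mem_family_insert_right {Z I : Set (Fin w.length)} {L₁ LX : Set (Node w)} {k} {S} :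
    S ∈ Family Z (insert k I) L₁ LX ↔ S ∈ Family Z I L₁ LX ∧ S.res k = true := by
  simp only [Family, Set.mem_ofPred_eq, Set.forall_mem_insert]; tauto

theorem mem_family_insert_one {Z I : Set (Fin w.length)} {L₁ LX : Set (Node w)} {v} {S} :
    S ∈ Family Z I (insert v L₁) LX ↔ S ∈ Family Z I L₁ LX ∧ S.labelAt v = .one := by
  simp only [Family, Set.mem_ofPred_eq, Set.forall_mem_insert]; tauto

theorem mem_family_insert_X {Z I : Set (Fin w.length)} {L₁ LX : Set (Node w)} {v} {S} :
    S ∈ Family Z I L₁ (insert v LX) ↔ S ∈ Family Z I L₁ LX ∧ S.labelAt v = .X := by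
  simp only [Family, Set.mem_ofPred_eq, Set.forall_mem_insert]; tauto

/-! ### Reductions of families -/

section Moves

variable {Z I : Set (Fin w.length)} {L₁ LX : Set (Node w)}

/-- The edge map at `k` is the only one that changes the resolution of `k`. -/
theorem diffCoeff_eq_edgeCoeff {k : Fin w.length} {S T : EnhancedState w} (hS : S.res k = false)
    (hT : T.res k = true) : diffCoeff S T = edgeSign S.res k * edgeCoeff k S T := by
  rw [diffCoeff_eq, Finset.sum_eq_single k]
  · intro l _ hl
    by_contra h
    have := (res_of_edgeCoeff_ne_zero (right_ne_zero_of_mul h)).2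
    rw [this, Function.update_of_ne hl.symm, hS] at hT
    exact Bool.false_ne_true hT
  · intro h; exact absurd (Finset.mem_univ k) h

theorem exists_sign_mul_edgeCoeff {k : Fin w.length} {S T : EnhancedState w} (hS : S.res k = false)
    (hT : T.res k = true) : ∃ σ : ℤ, σ * σ = 1 ∧ diffCoeff S T = σ * edgeCoeff k S T := by
  refine ⟨edgeSign S.res k, ?_, diffCoeff_eq_edgeCoeff hS hT⟩
  unfold edgeSign
  rw [← pow_add, ← two_mul, pow_mul]; simp

theorem diffCoeff_eq_zero_of_res {k : Fin w.length} {S T : EnhancedState w} (hS : S.res k = true)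
    (hT : T.res k = false) : diffCoeff S T = 0 := by
  by_contra h
  obtain ⟨l, hl⟩ := exists_edgeCoeff_ne_zero h
  have := (res_of_edgeCoeff_ne_zero hl).2
  rw [this] at hT
  by_cases hlk : k = l
  · subst hlk; simp at hT
  · rw [Function.update_of_ne hlk, hS] at hT
    simp at hT

/-- There is no differential between states of a family with different labels on a closed set that
no free crossing meets. -/
theorem diffCoeff_eq_zero_of_label {S T : EnhancedState w}
    (hS : S ∈ Family Z I L₁ LX) (hT : T ∈ Family Z I L₁ LX) {O : Set (Node w)}
    (hO : IsClosedIn S.res O)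
    (hfree : ∀ l, l ∉ Z → l ∉ I → S.res l = T.res l ∨ (cornerA w l ∉ O ∧ cornerB w l ∉ O))
    {x : Node w} (hx : x ∈ O) (hl : S.labelAt x ≠ T.labelAt x) : diffCoeff S T = 0 := by
  by_contra h
  obtain ⟨l, h0⟩ := exists_edgeCoeff_ne_zero h
  obtain ⟨h1, h2⟩ := res_of_edgeCoeff_ne_zero h0
  have h3 : T.res l = true := by rw [h2, Function.update_self]
  have hlZ : l ∉ Z := fun h' => by simp [hT.2.1 l h'] at h3
  have hlI : l ∉ I := fun h' => by simp [hS.2.2.1 l h'] at h1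
  rcases hfree l hlZ hlI with h' | ⟨hA, hB⟩
  · rw [h1, h3] at h'; simp at h'
  · exact hl (labelAt_of_edgeCoeff_ne_zero h0 x (hO.ne hx hA) (hO.ne hx hB)).symm

theorem isMerge_of_closed_true {k : Fin w.length} {x y : Node w} (hxy : AreCorners k x y)
    {ε ε' : Resolution w} (h : ∀ l, l ≠ k → ε' l = ε l) (hk : ε' k ≠ ε k) {O : Set (Node w)}
    (hO : IsClosedIn ε O) (hx : x ∈ O) (hy : y ∉ O) : IsMerge ε ε' k := by
  rcases isMerge_or ε ε' k h hk with hm | hm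
  · exact hm
  · exact absurd (hxy.eq hm) (hO.ne hx hy)

/-- A crossing whose 1-resolution splits off a circle: the states with the 0-resolution are matched
with those in which the new circle is labelled `X`. -/
theorem matched_split {b : Fin w.length} {x y : Node w} (hxy : AreCorners b x y) (hbZ : b ∉ Z)
    (hbI : b ∉ I) {O : Set (Node w)}
    (hO : ∀ ε : Resolution w, (∀ k ∈ Z, ε k = false) → (∀ k ∈ I, ε k = true) → ε b = true →
      IsClosedIn ε O)
    (hx : x ∈ O) (hy : y ∉ O) (h₁ : ∀ v ∈ L₁, v ∉ O) (hX : ∀ v ∈ LX, v ∉ O) :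
    Matched diffCoeff {S ∈ Family Z I L₁ LX | S.res b = false ∨
      (S.res b = true ∧ S.labelAt x = .X)} := by
  have hbZ' : ∀ k ∈ Z, k ≠ b := fun k hk e => hbZ (e ▸ hk)
  have hbI' : ∀ k ∈ I, k ≠ b := fun k hk e => hbI (e ▸ hk)
  have hm : ∀ S ∈ Family Z I L₁ LX, ∀ ε, S.res b = false → ε = Function.update S.res b true →
      IsMerge ε S.res b ∧ IsClosedIn ε O := by
    rintro S hS ε hb rfl
    have hcl : IsClosedIn (Function.update S.res b true) O := by
      refine hO _ (fun k hk => ?_) (fun k hk => ?_) (by simp)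
      · rw [Function.update_of_ne (hbZ' k hk)]; exact hS.2.1 k hk
      · rw [Function.update_of_ne (hbI' k hk)]; exact hS.2.2.1 k hk
    exact ⟨isMerge_of_closed_true hxy (fun l hl => by simp [hl]) (by simp [hb]) hcl hx hy, hcl⟩
  have hunion : {S ∈ Family Z I L₁ LX | S.res b = false ∨ (S.res b = true ∧ S.labelAt x = .X)} =
      {S ∈ Family Z I L₁ LX | S.res b = false} ∪
      {S ∈ Family Z I L₁ LX | S.res b = true ∧ S.labelAt x = .X} := by
    ext S; simp only [Set.mem_ofPred_eq, Set.mem_union]; tauto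
  rw [hunion]
  refine matched_of_bijection ?_ (edgeCoeff b) ?_ ?_ ?_ ?_ ?_
  · rw [Set.disjoint_left]
    rintro S ⟨-, h1⟩ ⟨-, h2, -⟩
    rw [h1] at h2; exact Bool.false_ne_true h2
  · rintro S ⟨-, hS⟩ T ⟨-, hT, -⟩
    exact exists_sign_mul_edgeCoeff hS hT
  · rintro S ⟨hS, hb⟩
    obtain ⟨hmS, hcl⟩ := hm S hS _ hb rfl
    obtain ⟨T, hres, hT⟩ := exists_absorbs_of_coarse hxy S hmS .X
    have hmT : IsMerge T.res S.res b := by rw [hres]; exact hmS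
    have hedge := edgeCoeff_of_absorbs_X hxy hb hres hmT hT
    have hlab : ∀ v, v ∉ O → T.labelAt v = S.labelAt v := fun v hv =>
      hT.labelAt_eq hxy hmT (by rw [hres]; exact (hcl.ne hx hv).symm)
    refine ⟨T, ⟨⟨?_, ?_, ?_, ?_, ?_⟩, by simp [hres], hT.label_x⟩, hedge⟩
    · rw [level_of_edgeCoeff_ne_zero (by rw [hedge]; exact one_ne_zero)]; exact hS.1
    · intro k hk; rw [hres, Function.update_of_ne (hbZ' k hk)]; exact hS.2.1 k hk
    · intro k hk; rw [hres, Function.update_of_ne (hbI' k hk)]; exact hS.2.2.1 k hk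
    · intro v hv; rw [hlab v (h₁ v hv)]; exact hS.2.2.2.1 v hv
    · intro v hv; rw [hlab v (hX v hv)]; exact hS.2.2.2.2 v hv
  · rintro T ⟨hT, hb, hTx⟩
    have hcl := hO T.res hT.2.1 hT.2.2.1 hb
    have hmT : IsMerge T.res (Function.update T.res b false) b :=
      isMerge_of_closed_true hxy (fun l hl => by simp [hl]) (by simp [hb]) hcl hx hy
    obtain ⟨S, hres, hS⟩ := exists_absorbs_of_fine hxy T hmT hTx
    have hbS : S.res b = false := by simp [hres]
    have hres' : T.res = Function.update S.res b true := by
      rw [hres, Function.update_idem, ← hb, Function.update_eq_self]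
    have hmT' : IsMerge T.res S.res b := by rw [hres]; exact hmT
    have hedge := edgeCoeff_of_absorbs_X hxy hbS hres' hmT' hS
    have hlab : ∀ v, v ∉ O → T.labelAt v = S.labelAt v := fun v hv =>
      hS.labelAt_eq hxy hmT' (hcl.ne hx hv).symm
    refine ⟨S, ⟨⟨?_, ?_, ?_, ?_, ?_⟩, hbS⟩, hedge⟩
    · rw [← level_of_edgeCoeff_ne_zero (by rw [hedge]; exact one_ne_zero)]; exact hT.1
    · intro k hk; rw [hres, Function.update_of_ne (hbZ' k hk)]; exact hT.2.1 k hk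
    · intro k hk; rw [hres, Function.update_of_ne (hbI' k hk)]; exact hT.2.2.1 k hk
    · intro v hv; rw [← hlab v (h₁ v hv)]; exact hT.2.2.2.1 v hv
    · intro v hv; rw [← hlab v (hX v hv)]; exact hT.2.2.2.2 v hv
  · rintro S ⟨hS, hb⟩ S' ⟨hS', hb'⟩ T ⟨-, -, hTx⟩ h h'
    have hr := (res_of_edgeCoeff_ne_zero h).2
    have hr' := (res_of_edgeCoeff_ne_zero h').2
    have hresS : S.res = S'.res := by
      funext l
      by_cases hl : l = b
      · subst hl; rw [hb, hb']
      · have := congrFun (hr.symm.trans hr') l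
        rwa [Function.update_of_ne hl, Function.update_of_ne hl] at this
    exact (absorbs_X_of_edgeCoeff hxy (hm S hS _ hb hr).1 hTx h).unique_coarse hresS
      (absorbs_X_of_edgeCoeff hxy (hm S' hS' _ hb' hr').1 hTx h')
  · rintro S ⟨hS, hb⟩ T ⟨-, -, hTx⟩ T' ⟨-, -, hTx'⟩ h h'
    have hr := (res_of_edgeCoeff_ne_zero h).2
    have hr' := (res_of_edgeCoeff_ne_zero h').2
    have hmT := (hm S hS _ hb hr).1
    exact (absorbs_X_of_edgeCoeff hxy hmT hTx h).unique_fine hxy hmT (hr.trans hr'.symm)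
      (absorbs_X_of_edgeCoeff hxy (hm S hS _ hb hr').1 hTx' h')

/-- A crossing whose 1-resolution merges a circle of the 0-resolution into another one: the states
with the 1-resolution are matched with those in which this circle is labelled `1`. -/
theorem matched_merge {a : Fin w.length} {x y : Node w} (hxy : AreCorners a x y) (haZ : a ∉ Z)
    (haI : a ∉ I) {O : Set (Node w)}
    (hO : ∀ ε : Resolution w, (∀ k ∈ Z, ε k = false) → (∀ k ∈ I, ε k = true) → ε a = false →
      IsClosedIn ε O)
    (hx : x ∈ O) (hy : y ∉ O) (h₁ : ∀ v ∈ L₁, v ∉ O) (hX : ∀ v ∈ LX, v ∉ O) :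
    Matched diffCoeff {S ∈ Family Z I L₁ LX | S.res a = true ∨
      (S.res a = false ∧ S.labelAt x = .one)} := by
  have haZ' : ∀ k ∈ Z, k ≠ a := fun k hk e => haZ (e ▸ hk)
  have haI' : ∀ k ∈ I, k ≠ a := fun k hk e => haI (e ▸ hk)
  have hm : ∀ S ∈ Family Z I L₁ LX, ∀ ε, S.res a = false → ε = Function.update S.res a true →
      IsMerge S.res ε a := by
    rintro S hS ε hb rfl
    exact isMerge_of_closed_true hxy (fun l hl => by simp [hl]) (by simp [hb])
      (hO _ hS.2.1 hS.2.2.1 hb) hx hy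
  have hunion : {S ∈ Family Z I L₁ LX | S.res a = true ∨ (S.res a = false ∧ S.labelAt x = .one)} =
      {S ∈ Family Z I L₁ LX | S.res a = false ∧ S.labelAt x = .one} ∪
      {S ∈ Family Z I L₁ LX | S.res a = true} := by
    ext S; simp only [Set.mem_ofPred_eq, Set.mem_union]; tauto
  rw [hunion]
  refine matched_of_bijection ?_ (edgeCoeff a) ?_ ?_ ?_ ?_ ?_
  · rw [Set.disjoint_left]
    rintro S ⟨-, h1, -⟩ ⟨-, h2⟩
    rw [h1] at h2; exact Bool.false_ne_true h2
  · rintro S ⟨-, hS, -⟩ T ⟨-, hT⟩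
    exact exists_sign_mul_edgeCoeff hS hT
  · rintro S ⟨hS, hb, hSx⟩
    have hcl := hO _ hS.2.1 hS.2.2.1 hb
    obtain ⟨T, hres, hT⟩ := exists_absorbs_of_fine hxy S (hm S hS _ hb rfl) hSx
    have hmT := hm S hS _ hb hres
    have hedge := edgeCoeff_of_absorbs_one hxy hb hres hmT hT
    have hlab : ∀ v, v ∉ O → S.labelAt v = T.labelAt v := fun v hv =>
      hT.labelAt_eq hxy hmT (hcl.ne hx hv).symm
    refine ⟨T, ⟨⟨?_, ?_, ?_, ?_, ?_⟩, by simp [hres]⟩, hedge⟩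
    · rw [level_of_edgeCoeff_ne_zero (by rw [hedge]; exact one_ne_zero)]; exact hS.1
    · intro k hk; rw [hres, Function.update_of_ne (haZ' k hk)]; exact hS.2.1 k hk
    · intro k hk; rw [hres, Function.update_of_ne (haI' k hk)]; exact hS.2.2.1 k hk
    · intro v hv; rw [← hlab v (h₁ v hv)]; exact hS.2.2.2.1 v hv
    · intro v hv; rw [← hlab v (hX v hv)]; exact hS.2.2.2.2 v hv
  · rintro T ⟨hT, hb⟩
    have hcl : IsClosedIn (Function.update T.res a false) O := by
      refine hO _ (fun k hk => ?_) (fun k hk => ?_) (by simp)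
      · rw [Function.update_of_ne (haZ' k hk)]; exact hT.2.1 k hk
      · rw [Function.update_of_ne (haI' k hk)]; exact hT.2.2.1 k hk
    have hmT : IsMerge (Function.update T.res a false) T.res a :=
      isMerge_of_closed_true hxy (fun l hl => by simp [hl]) (by simp [hb]) hcl hx hy
    obtain ⟨S, hres, hS⟩ := exists_absorbs_of_coarse hxy T hmT .one
    have hbS : S.res a = false := by simp [hres]
    have hres' : T.res = Function.update S.res a true := by
      rw [hres, Function.update_idem, ← hb, Function.update_eq_self]
    have hmT' : IsMerge S.res T.res a := by rw [hres]; exact hmT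
    have hedge := edgeCoeff_of_absorbs_one hxy hbS hres' hmT' hS
    have hlab : ∀ v, v ∉ O → S.labelAt v = T.labelAt v := fun v hv =>
      hS.labelAt_eq hxy hmT' (by rw [hres]; exact (hcl.ne hx hv).symm)
    refine ⟨S, ⟨⟨?_, ?_, ?_, ?_, ?_⟩, hbS, hS.label_x⟩, hedge⟩
    · rw [← level_of_edgeCoeff_ne_zero (by rw [hedge]; exact one_ne_zero)]; exact hT.1
    · intro k hk; rw [hres, Function.update_of_ne (haZ' k hk)]; exact hT.2.1 k hk
    · intro k hk; rw [hres, Function.update_of_ne (haI' k hk)]; exact hT.2.2.1 k hk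
    · intro v hv; rw [hlab v (h₁ v hv)]; exact hT.2.2.2.1 v hv
    · intro v hv; rw [hlab v (hX v hv)]; exact hT.2.2.2.2 v hv
  · rintro S ⟨hS, hb, hSx⟩ S' ⟨hS', hb', hSx'⟩ T - h h'
    have hr := (res_of_edgeCoeff_ne_zero h).2
    have hr' := (res_of_edgeCoeff_ne_zero h').2
    have hresS : S.res = S'.res := by
      funext l
      by_cases hl : l = a
      · subst hl; rw [hb, hb']
      · have := congrFun (hr.symm.trans hr') l
        rwa [Function.update_of_ne hl, Function.update_of_ne hl] at this
    have hmT := hm S hS _ hb hr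
    exact (absorbs_one_of_edgeCoeff hxy hmT hSx h).unique_fine hxy hmT hresS
      (absorbs_one_of_edgeCoeff hxy (hm S' hS' _ hb' hr') hSx' h')
  · rintro S ⟨hS, hb, hSx⟩ T - T' - h h'
    have hr := (res_of_edgeCoeff_ne_zero h).2
    have hr' := (res_of_edgeCoeff_ne_zero h').2
    exact (absorbs_one_of_edgeCoeff hxy (hm S hS _ hb hr) hSx h).unique_coarse (hr.trans hr'.symm)
      (absorbs_one_of_edgeCoeff hxy (hm S hS _ hb hr') hSx h')

variable {E : Set (EnhancedState w)}

/-- Distinguishing the two resolutions of the crossing `k`, where `E` are the states that remain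
unmatched. The differential never leads from the 1-resolution back to the 0-resolution. -/
theorem matched_branch (k : Fin w.length)
    (h1 : Matched diffCoeff (Family Z (insert k I) L₁ LX \ E))
    (h0 : Matched diffCoeff (Family (insert k Z) I L₁ LX \ E)) :
    Matched diffCoeff (Family Z I L₁ LX \ E) := by
  have : Family Z I L₁ LX \ E = (Family Z (insert k I) L₁ LX \ E) ∪
      (Family (insert k Z) I L₁ LX \ E) := by
    ext S
    simp only [Set.mem_sdiff, Set.mem_union, mem_family_insert_left, mem_family_insert_right]
    cases S.res k <;> simp
  rw [this]
  refine h1.union h0 ?_ ?_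
  · rw [Set.disjoint_left]
    rintro S ⟨hS, -⟩ ⟨hS', -⟩
    rw [mem_family_insert_right] at hS
    rw [mem_family_insert_left] at hS'
    exact Bool.false_ne_true (hS'.2.symm.trans hS.2)
  · rintro S ⟨hS, -⟩ T ⟨hT, -⟩
    rw [mem_family_insert_right] at hS
    rw [mem_family_insert_left] at hT
    exact diffCoeff_eq_zero_of_res hS.2 hT.2

/-- Reduction at a crossing whose 1-resolution splits off a circle (a Reidemeister move of the
first kind). -/
theorem matched_of_kink {b : Fin w.length} {O : Set (Node w)}
    (hM : Matched diffCoeff (Family Z (insert b I) (insert (cornerB w b) L₁) LX \ E))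
    (hbZ : b ∉ Z) (hbI : b ∉ I)
    (hO : ∀ ε : Resolution w, (∀ k ∈ Z, ε k = false) → (∀ k ∈ I, ε k = true) → ε b = true →
      IsClosedIn ε O)
    (hB : cornerB w b ∈ O) (hA : cornerA w b ∉ O) (h₁ : ∀ v ∈ L₁, v ∉ O) (hX : ∀ v ∈ LX, v ∉ O)
    (hfree : ∀ l, l ∉ Z → l ∉ I → l ≠ b → cornerA w l ∉ O ∧ cornerB w l ∉ O)
    (hE : ∀ S ∈ E, S ∈ Family Z I L₁ LX → S.res b = true ∧ S.labelAt (cornerB w b) = .one) :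
    Matched diffCoeff (Family Z I L₁ LX \ E) := by
  have hS := matched_split (Or.inr ⟨rfl, rfl⟩) hbZ hbI hO hB hA h₁ hX
  have : Family Z I L₁ LX \ E = (Family Z (insert b I) (insert (cornerB w b) L₁) LX \ E) ∪
      {S ∈ Family Z I L₁ LX | S.res b = false ∨
        (S.res b = true ∧ S.labelAt (cornerB w b) = .X)} := by
    ext S
    simp only [Set.mem_sdiff, Set.mem_union, mem_family_insert_right, mem_family_insert_one,
      Set.mem_ofPred_eq]
    have h3 := hE S
    cases h1 : S.res b <;> cases h2 : S.labelAt (cornerB w b) <;> simp [h1, h2] at h3 ⊢ <;> tauto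
  rw [this]
  refine hM.union hS ?_ ?_
  · rw [Set.disjoint_left]
    rintro S ⟨hS, -⟩ ⟨-, hS'⟩
    rw [mem_family_insert_right, mem_family_insert_one] at hS
    rcases hS' with h | ⟨-, h⟩
    · exact Bool.false_ne_true (h.symm.trans hS.2)
    · rw [hS.1.2] at h; cases h
  · rintro S ⟨hS, -⟩ T ⟨hT, hT'⟩
    rw [mem_family_insert_right, mem_family_insert_one] at hS
    obtain ⟨⟨hS, hl⟩, hb⟩ := hS
    rcases hT' with h | ⟨h, h'⟩
    · exact diffCoeff_eq_zero_of_res hb h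
    · refine diffCoeff_eq_zero_of_label hS hT (hO _ hS.2.1 hS.2.2.1 hb) ?_ hB ?_
      · intro l hlZ hlI
        by_cases hlb : l = b
        · subst hlb; exact Or.inl (hb.trans h.symm)
        · exact Or.inr (hfree l hlZ hlI hlb)
      · rw [hl, h']; simp

/-- Reduction at a crossing whose 1-resolution merges a circle that exists in the 0-resolution (a
Reidemeister move of the first kind). -/
theorem matched_of_merging_kink {b : Fin w.length} {O : Set (Node w)}
    (hM : Matched diffCoeff (Family (insert b Z) I L₁ (insert (cornerB w b) LX) \ E))
    (hbZ : b ∉ Z) (hbI : b ∉ I)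
    (hO : ∀ ε : Resolution w, (∀ k ∈ Z, ε k = false) → (∀ k ∈ I, ε k = true) → ε b = false →
      IsClosedIn ε O)
    (hB : cornerB w b ∈ O) (hA : cornerA w b ∉ O) (h₁ : ∀ v ∈ L₁, v ∉ O) (hX : ∀ v ∈ LX, v ∉ O)
    (hfree : ∀ l, l ∉ Z → l ∉ I → l ≠ b → cornerA w l ∉ O ∧ cornerB w l ∉ O)
    (hE : ∀ S ∈ E, S ∈ Family Z I L₁ LX → S.res b = false ∧ S.labelAt (cornerB w b) = .X) :
    Matched diffCoeff (Family Z I L₁ LX \ E) := by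
  have hS := matched_merge (Or.inr ⟨rfl, rfl⟩) hbZ hbI hO hB hA h₁ hX
  have : Family Z I L₁ LX \ E = {S ∈ Family Z I L₁ LX | S.res b = true ∨
        (S.res b = false ∧ S.labelAt (cornerB w b) = .one)} ∪
      (Family (insert b Z) I L₁ (insert (cornerB w b) LX) \ E) := by
    ext S
    simp only [Set.mem_sdiff, Set.mem_union, mem_family_insert_left, mem_family_insert_X,
      Set.mem_ofPred_eq]
    have h3 := hE S
    cases h1 : S.res b <;> cases h2 : S.labelAt (cornerB w b) <;> simp [h1, h2] at h3 ⊢ <;> tauto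
  rw [this]
  refine hS.union hM ?_ ?_
  · rw [Set.disjoint_left]
    rintro S ⟨-, hS'⟩ ⟨hS, -⟩
    rw [mem_family_insert_left, mem_family_insert_X] at hS
    rcases hS' with h | ⟨-, h⟩
    · exact Bool.false_ne_true (hS.2.symm.trans h)
    · rw [hS.1.2] at h; cases h
  · rintro S ⟨hS, hS'⟩ T ⟨hT, -⟩
    rw [mem_family_insert_left, mem_family_insert_X] at hT
    obtain ⟨⟨hT, hl⟩, hb⟩ := hT
    rcases hS' with h | ⟨h, h'⟩
    · exact diffCoeff_eq_zero_of_res h hb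
    · refine diffCoeff_eq_zero_of_label hS hT (hO _ hS.2.1 hS.2.2.1 h) ?_ hB ?_
      · intro l hlZ hlI
        by_cases hlb : l = b
        · subst hlb; exact Or.inl (h.trans hb.symm)
        · exact Or.inr (hfree l hlZ hlI hlb)
      · rw [hl, h']; simp

/-- Reduction at two crossings of which `b` splits off a circle, and `a` then merges this circle into
another one (a Reidemeister move of the second kind). -/
theorem matched_of_slide {a b : Fin w.length} {x y : Node w} {O : Set (Node w)}
    (hM : Matched diffCoeff (Family (insert b Z) (insert a I) L₁ LX \ E)) (hab : a ≠ b)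
    (haZ : a ∉ Z) (haI : a ∉ I) (hbZ : b ∉ Z) (hbI : b ∉ I) (hxy : AreCorners a x y)
    (hO : ∀ ε : Resolution w, (∀ k ∈ Z, ε k = false) → (∀ k ∈ I, ε k = true) → ε a = false →
      ε b = true → IsClosedIn ε O ∧ circleOf w ε x = circleOf w ε (cornerB w b))
    (hx : x ∈ O) (hy : y ∉ O)
    (hB : cornerB w b ∈ O) (hA : cornerA w b ∉ O) (h₁ : ∀ v ∈ L₁, v ∉ O) (hX : ∀ v ∈ LX, v ∉ O)
    (hfree : ∀ l, l ∉ Z → l ∉ I → l ≠ a → l ≠ b → cornerA w l ∉ O ∧ cornerB w l ∉ O)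
    (hE : ∀ S ∈ E, S ∈ Family Z I L₁ LX → S.res a = true ∧ S.res b = false) :
    Matched diffCoeff (Family Z I L₁ LX \ E) := by
  have hS := matched_split (Z := insert a Z) (I := I) (L₁ := L₁) (LX := LX)
    (Or.inr ⟨rfl, rfl⟩ : AreCorners b (cornerB w b) (cornerA w b))
    (by simp [hbZ, hab.symm]) hbI (O := O) (fun ε h0 h1 hb =>
      (hO ε (fun k hk => h0 k (Set.mem_insert_of_mem _ hk)) h1
        (h0 a (Set.mem_insert _ _)) hb).1) hB hA h₁ hX
  have hT := matched_merge (Z := Z) (I := insert b I) (L₁ := L₁) (LX := LX) hxy haZ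
    (by simp [haI, hab]) (O := O) (fun ε h0 h1 ha =>
      (hO ε h0 (fun k hk => h1 k (Set.mem_insert_of_mem _ hk)) ha
        (h1 b (Set.mem_insert _ _))).1) hx hy h₁ hX
  have hlab : ∀ S ∈ Family Z I L₁ LX, S.res a = false → S.res b = true →
      S.labelAt x = S.labelAt (cornerB w b) := fun S hS ha hb =>
    S.labelAt_eq (hO S.res hS.2.1 hS.2.2.1 ha hb).2
  have : Family Z I L₁ LX \ E =
      {S ∈ Family Z (insert b I) L₁ LX | S.res a = true ∨
        (S.res a = false ∧ S.labelAt x = .one)} ∪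
      ((Family (insert b Z) (insert a I) L₁ LX \ E) ∪
      {S ∈ Family (insert a Z) I L₁ LX | S.res b = false ∨
        (S.res b = true ∧ S.labelAt (cornerB w b) = .X)}) := by
    ext S
    simp only [Set.mem_sdiff, Set.mem_union, mem_family_insert_left, mem_family_insert_right,
      Set.mem_ofPred_eq]
    have h1 := hE S
    have h2 := hlab S
    cases h3 : S.res b <;> cases h4 : S.res a <;> cases h5 : S.labelAt (cornerB w b) <;>
      cases h6 : S.labelAt x <;> simp [h3, h4, h5, h6] at h1 h2 ⊢ <;> tauto
  rw [this]
  refine hT.union (hM.union hS ?_ ?_) ?_ ?_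
  · rw [Set.disjoint_left]
    rintro S ⟨hS, -⟩ ⟨hS', -⟩
    rw [mem_family_insert_right] at hS
    rw [mem_family_insert_left] at hS'
    exact Bool.false_ne_true (hS'.2.symm.trans hS.2)
  · rintro S ⟨hS, -⟩ T ⟨hT, -⟩
    rw [mem_family_insert_right] at hS
    rw [mem_family_insert_left] at hT
    exact diffCoeff_eq_zero_of_res hS.2 hT.2
  · rw [Set.disjoint_left]
    rintro S ⟨hS, hS1⟩ (⟨hS', -⟩ | ⟨hS', hS2⟩)
    · rw [mem_family_insert_right] at hS
      rw [mem_family_insert_right, mem_family_insert_left] at hS'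
      exact Bool.false_ne_true (hS'.1.2.symm.trans hS.2)
    · rw [mem_family_insert_right] at hS
      rw [mem_family_insert_left] at hS'
      have := hlab S hS.1 hS'.2 hS.2
      rcases hS1 with h | ⟨-, h⟩
      · exact Bool.false_ne_true (hS'.2.symm.trans h)
      · rcases hS2 with h' | ⟨-, h'⟩
        · exact Bool.false_ne_true (h'.symm.trans hS.2)
        · rw [h, h'] at this; cases this
  · rintro S ⟨hS, hS1⟩ T (⟨hT, -⟩ | ⟨hT, hT1⟩)
    · rw [mem_family_insert_right] at hS
      rw [mem_family_insert_right, mem_family_insert_left] at hT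
      exact diffCoeff_eq_zero_of_res hS.2 hT.1.2
    · rw [mem_family_insert_right] at hS
      rw [mem_family_insert_left] at hT
      rcases hS1 with h | ⟨h, h'⟩
      · exact diffCoeff_eq_zero_of_res h hT.2
      rcases hT1 with h3 | ⟨h3, h4⟩
      · exact diffCoeff_eq_zero_of_res hS.2 h3
      refine diffCoeff_eq_zero_of_label hS.1 hT.1 (hO _ hS.1.2.1 hS.1.2.2.1 h hS.2).1 ?_ hx ?_
      · intro l hlZ hlI
        by_cases hlb : l = b
        · subst hlb; exact Or.inl (hS.2.trans h3.symm)
        by_cases hla : l = a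
        · subst hla; exact Or.inl (h.trans hT.2.symm)
        · exact Or.inr (hfree l hlZ hlI hla hlb)
      · rw [h', hlab T hT.1 hT.2 h3, h4]; simp

end Moves

end Khovanov

namespace Khovanov

variable {p q : ℕ}

open EnhancedState

/-! ### The crossings of the torus braid -/

theorem length_torusBraid : (torusBraid p q).length = q * (p - 1) := by
  simp [torusBraid]

theorem getElem_torusBraid (k : ℕ) (hk : k < (torusBraid p q).length) :
    ((torusBraid p q)[k]).1.val = k % (p - 1) ∧ ((torusBraid p q)[k]).2 = true := by
  induction q generalizing k with
  | zero => simp [torusBraid] at hk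
  | succ q ih =>
    have hsplit : torusBraid p (q + 1) =
        ((List.finRange (p - 1)).map fun i => (i, true)) ++ torusBraid p q := by
      simp [torusBraid, List.replicate_succ]
    have hlen : ((List.finRange (p - 1)).map fun i => ((i, true) : Fin (p - 1) × Bool)).length =
      p - 1 := by simp
    simp only [hsplit]
    by_cases h : k < p - 1
    · rw [List.getElem_append_left (by rw [hlen]; exact h)]
      simp [Nat.mod_eq_of_lt h]
    · push Not at h
      rw [List.getElem_append_right (by rw [hlen]; exact h)]
      rw [length_torusBraid, Nat.succ_mul] at hk
      have := ih (k - (p - 1)) (by rw [length_torusBraid]; omega)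
      simp only [hlen]
      rw [Nat.mod_eq_sub_mod h]
      exact this

theorem isPositive_torusBraid : IsPositive (torusBraid p q) :=
  fun k => (getElem_torusBraid k.val k.isLt).2

/-- The row of a crossing of the torus braid: the number of the factor `σ_1 ⋯ σ_{p-1}` that it
belongs to, counted from `0`. -/
def row (k : Fin (torusBraid p q).length) : ℕ := k.val / (p - 1)

theorem col_eq (k : Fin (torusBraid p q).length) : col k = k.val % (p - 1) :=
  (getElem_torusBraid k.val k.isLt).1

theorem pos_of_crossing (k : Fin (torusBraid p q).length) : 0 < p - 1 := by
  by_contra h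
  have := k.isLt.trans_eq length_torusBraid
  have h0 : q * (p - 1) = 0 := by rw [show p - 1 = 0 by omega, mul_zero]
  exact absurd (this.trans_eq h0) (Nat.not_lt_zero _)

theorem col_lt (k : Fin (torusBraid p q).length) : col k < p - 1 := by
  rw [col_eq]; exact Nat.mod_lt _ (pos_of_crossing k)

theorem row_lt (k : Fin (torusBraid p q).length) : row k < q := by
  have := k.isLt.trans_eq length_torusBraid
  exact Nat.div_lt_of_lt_mul (by rwa [mul_comm])

theorem val_eq (k : Fin (torusBraid p q).length) : k.val = row k * (p - 1) + col k := by
  rw [col_eq, row, mul_comm]; exact (Nat.div_add_mod _ _).symm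

theorem crossing_ext {k l : Fin (torusBraid p q).length} (hr : row k = row l)
    (hc : col k = col l) : k = l := by
  apply Fin.ext; rw [val_eq, val_eq, hr, hc]

/-- The crossings are ordered lexicographically. -/
theorem val_lt_iff (k l : Fin (torusBraid p q).length) :
    k.val < l.val ↔ row k < row l ∨ (row k = row l ∧ col k < col l) := by
  have hk := val_eq k
  have hl := val_eq l
  have h1 := col_lt k
  have h2 := col_lt l
  rcases lt_trichotomy (row k) (row l) with h | h | h
  · have : (row k + 1) * (p - 1) ≤ row l * (p - 1) := Nat.mul_le_mul_right _ h
    rw [Nat.succ_mul] at this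
    simp only [h, true_or, iff_true]; omega
  · rw [h] at hk; simp only [h, lt_irrefl, false_or, true_and]; omega
  · have : (row l + 1) * (p - 1) ≤ row k * (p - 1) := Nat.mul_le_mul_right _ h
    rw [Nat.succ_mul] at this
    constructor
    · intro h'; omega
    · intro h'; omega

/-- The crossing in row `r` and column `c`. -/
def cr (r c : ℕ) (hr : r < q) (hc : c < p - 1) : Fin (torusBraid p q).length :=
  ⟨r * (p - 1) + c, by
    rw [length_torusBraid]
    have : (r + 1) * (p - 1) ≤ q * (p - 1) := Nat.mul_le_mul_right _ hr
    rw [Nat.succ_mul] at this; omega⟩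

@[simp] theorem row_cr {r c : ℕ} (hr : r < q) (hc : c < p - 1) : row (cr r c hr hc) = r := by
  unfold row cr
  simp only
  rw [mul_comm, Nat.mul_add_div (by omega), Nat.div_eq_of_lt hc, add_zero]

@[simp] theorem col_cr {r c : ℕ} (hr : r < q) (hc : c < p - 1) : col (cr r c hr hc) = c := by
  rw [col_eq]; unfold cr
  simp only
  rw [mul_comm, Nat.mul_add_mod, Nat.mod_eq_of_lt hc]

theorem eq_cr_iff {r c : ℕ} (hr : r < q) (hc : c < p - 1) (k : Fin (torusBraid p q).length) :
    k = cr r c hr hc ↔ row k = r ∧ col k = c := by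
  constructor
  · rintro rfl; simp
  · rintro ⟨h1, h2⟩; exact crossing_ext (by simp [h1]) (by simp [h2])

theorem cornerA_fst_val {w : BraidWord p} (k : Fin w.length) : (cornerA w k).1.val = col k := rfl
theorem cornerA_snd_val {w : BraidWord p} (k : Fin w.length) : (cornerA w k).2.val = k.val := rfl
theorem cornerB_fst_val {w : BraidWord p} (k : Fin w.length) : (cornerB w k).1.val = col k + 1 := rfl
theorem cornerB_snd_val {w : BraidWord p} (k : Fin w.length) :
    (cornerB w k).2.val = k.val + 1 := rfl

/-! ### Reductions along tubes -/

section Moves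

variable {Z I : Set (Fin (torusBraid p q).length)} {L₁ LX : Set (Node (torusBraid p q))}
  {E : Set (EnhancedState (torusBraid p q))}

theorem matched_of_family_empty (h : ∀ S, S ∉ Family Z I L₁ LX) :
    Matched diffCoeff (Family Z I L₁ LX \ E) := by
  have : Family Z I L₁ LX \ E = ∅ := by
    ext S; simp [h S]
  rw [this]; exact matched_empty

theorem matched_sdiff_of_disjoint {E' : Set (EnhancedState (torusBraid p q))}
    (hM : Matched diffCoeff (Family Z I L₁ LX \ E))
    (h : ∀ S ∈ Family Z I L₁ LX, S ∈ E' ↔ S ∈ E) :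
    Matched diffCoeff (Family Z I L₁ LX \ E') := by
  have : Family Z I L₁ LX \ E' = Family Z I L₁ LX \ E := by
    ext S
    simp only [Set.mem_sdiff]
    exact and_congr_right fun hS => not_congr (h S hS)
  rwa [this]

/-- Crossings in the same column in consecutive rows bound a tube if the only crossings of the
neighbouring columns between them have the 0-resolution. -/
theorem isClosedIn_tube_of_rows {ε : Resolution (torusBraid p q)}
    {b k : Fin (torusBraid p q).length}
    (hr : row b + 1 = row k) (hc : col b = col k) (hb : ε b = true) (hk : ε k = true)
    (hl : ∀ l, row l = row k → col l + 1 = col k → ε l = false)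
    (hu : ∀ l, row l = row b → col l = col k + 1 → ε l = false) :
    IsClosedIn ε (tube (col k) b k) ∧
      ∀ v ∈ tube (col k) b k, circleOf _ ε v = circleOf _ ε (cornerB _ b) := by
  have key : ∀ l, b < l → l < k → col l ≤ col k + 1 → col k ≤ col l + 1 → ε l = false := by
    intro l h1 h2 h3 h4
    rw [Fin.lt_def, val_lt_iff] at h1 h2
    by_cases h5 : row l = row k
    · exact hl l h5 (by omega)
    · exact hu l (by omega) (by omega)
  exact ⟨isClosedIn_tube isPositive_torusBraid hc rfl hb hk key,
    fun v hv => circleOf_tube isPositive_torusBraid hc hb key hv⟩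

theorem corner_mem_tube {b k l : Fin (torusBraid p q).length}
    (hr : row b + 1 = row k) (hc : col b = col k)
    (h : cornerA _ l ∈ tube (col k) b k ∨ cornerB _ l ∈ tube (col k) b k) :
    l = b ∨ l = k ∨ (row l = row k ∧ col l + 1 = col k) ∨ (row l = row b ∧ col l = col k + 1) := by
  have h1 := val_lt_iff b l
  have h2 := val_lt_iff l k
  simp only [tube, Set.mem_ofPred_eq, cornerA_fst_val, cornerA_snd_val, cornerB_fst_val,
    cornerB_snd_val] at h
  by_cases e1 : l = b
  · exact Or.inl e1
  by_cases e2 : l = k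
  · exact Or.inr (Or.inl e2)
  have := Fin.val_ne_of_ne e1
  have := Fin.val_ne_of_ne e2
  omega

theorem cornerB_mem_tube {b k : Fin (torusBraid p q).length}
    (hr : row b + 1 = row k) (hc : col b = col k) : cornerB _ b ∈ tube (col k) b k := by
  have := val_lt_iff b k
  simp only [tube, Set.mem_ofPred_eq, cornerB_fst_val, cornerB_snd_val]
  omega

theorem cornerA_notMem_tube {b k : Fin (torusBraid p q).length} : cornerA _ b ∉ tube (col k) b k := by
  simp only [tube, Set.mem_ofPred_eq, cornerA_fst_val, cornerA_snd_val]
  omega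

/-- A crossing `k` with the 1-resolution, the crossing `b` below it in its column, and the crossing
`a` on the left between them: the 1-resolution moves from `b` to `a`. -/
theorem matched_slide_left {k a b : Fin (torusBraid p q).length}
    (hM : Matched diffCoeff (Family (insert b Z) (insert a I) L₁ LX \ E))
    (hk : k ∈ I) (har : row a = row k) (hac : col a + 1 = col k) (hbr : row b + 1 = row k)
    (hbc : col b = col k) (hu : ∀ l, row l = row b → col l = col k + 1 → l ∈ Z)
    (haZ : a ∉ Z) (haI : a ∉ I) (hbZ : b ∉ Z) (hbI : b ∉ I)
    (h₁ : ∀ v ∈ L₁, k.val < v.2.val) (hX : ∀ v ∈ LX, col k + 1 < v.1.val)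
    (hE : ∀ S ∈ E, S ∈ Family Z I L₁ LX → S.res a = true ∧ S.res b = false) :
    Matched diffCoeff (Family Z I L₁ LX \ E) := by
  have hab : a ≠ b := by rintro rfl; omega
  have hlt := val_lt_iff b a
  have hlt' := val_lt_iff a k
  refine matched_of_slide (O := tube (col k) b k) (x := cornerB _ a) (y := cornerA _ a) hM hab
    haZ haI hbZ hbI (Or.inr ⟨rfl, rfl⟩) ?_ ?_ ?_ (cornerB_mem_tube hbr hbc) cornerA_notMem_tube
    ?_ ?_ ?_ hE
  · intro ε h0 h1 ha hb
    obtain ⟨hcl, hcirc⟩ := isClosedIn_tube_of_rows hbr hbc hb (h1 k hk)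
      (fun l h h' => by rwa [crossing_ext (h.trans har.symm) (by omega : col l = col a)])
      (fun l h h' => h0 l (hu l h h'))
    refine ⟨hcl, hcirc _ ?_⟩
    simp only [tube, Set.mem_ofPred_eq, cornerB_fst_val, cornerB_snd_val]; omega
  · simp only [tube, Set.mem_ofPred_eq, cornerB_fst_val, cornerB_snd_val]; omega
  · simp only [tube, Set.mem_ofPred_eq, cornerA_fst_val, cornerA_snd_val]; omega
  · intro v hv hv'; have := h₁ v hv; have := hv'.2.2; omega
  · intro v hv hv'; have := hX v hv; have := hv'.1; omega
  · intro l hlZ hlI hla hlb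
    rw [← not_or]
    intro h
    rcases corner_mem_tube hbr hbc h with rfl | rfl | ⟨h1, h2⟩ | ⟨h1, h2⟩
    · exact hlb rfl
    · exact hlI hk
    · exact hla (crossing_ext (by omega) (by omega))
    · exact hlZ (hu l h1 h2)

/-- A crossing `k` with the 1-resolution, the crossing `b` below it in its column, and the crossing
`a` on the right between them: the 1-resolution moves from `b` to `a`. -/
theorem matched_slide_right {k a b : Fin (torusBraid p q).length}
    (hM : Matched diffCoeff (Family (insert b Z) (insert a I) L₁ LX \ E))
    (hk : k ∈ I) (har : row a = row b) (hac : col a = col k + 1) (hbr : row b + 1 = row k)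
    (hbc : col b = col k) (hu : ∀ l, row l = row k → col l + 1 = col k → l ∈ Z)
    (haZ : a ∉ Z) (haI : a ∉ I) (hbZ : b ∉ Z) (hbI : b ∉ I)
    (h₁ : ∀ v ∈ L₁, k.val < v.2.val) (hX : ∀ v ∈ LX, col k + 1 < v.1.val)
    (hE : ∀ S ∈ E, S ∈ Family Z I L₁ LX → S.res a = true ∧ S.res b = false) :
    Matched diffCoeff (Family Z I L₁ LX \ E) := by
  have hab : a ≠ b := by rintro rfl; omega
  have hlt := val_lt_iff b a
  have hlt' := val_lt_iff a k
  refine matched_of_slide (O := tube (col k) b k) (x := cornerA _ a) (y := cornerB _ a) hM hab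
    haZ haI hbZ hbI (Or.inl ⟨rfl, rfl⟩) ?_ ?_ ?_ (cornerB_mem_tube hbr hbc) cornerA_notMem_tube
    ?_ ?_ ?_ hE
  · intro ε h0 h1 ha hb
    obtain ⟨hcl, hcirc⟩ := isClosedIn_tube_of_rows hbr hbc hb (h1 k hk)
      (fun l h h' => h0 l (hu l h h'))
      (fun l h h' => by rwa [crossing_ext (h.trans har.symm) (h'.trans hac.symm)])
    refine ⟨hcl, hcirc _ ?_⟩
    simp only [tube, Set.mem_ofPred_eq, cornerA_fst_val, cornerA_snd_val]; omega
  · simp only [tube, Set.mem_ofPred_eq, cornerA_fst_val, cornerA_snd_val]; omega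
  · simp only [tube, Set.mem_ofPred_eq, cornerB_fst_val, cornerB_snd_val]; omega
  · intro v hv hv'; have := h₁ v hv; have := hv'.2.2; omega
  · intro v hv hv'; have := hX v hv; have := hv'.1; omega
  · intro l hlZ hlI hla hlb
    rw [← not_or]
    intro h
    rcases corner_mem_tube hbr hbc h with rfl | rfl | ⟨h1, h2⟩ | ⟨h1, h2⟩
    · exact hlb rfl
    · exact hlI hk
    · exact hlZ (hu l h1 h2)
    · exact hla (crossing_ext (by omega) (by omega))

/-- A crossing `k` with the 1-resolution and the crossing `b` below it in its column, where the
crossings between them have the 0-resolution: the crossing `b` gets the 1-resolution, and the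
circle between `b` and `k` the label `1`. -/
theorem matched_tube {k b : Fin (torusBraid p q).length}
    (hM : Matched diffCoeff (Family Z (insert b I) (insert (cornerB _ b) L₁) LX \ E))
    (hk : k ∈ I) (hbr : row b + 1 = row k) (hbc : col b = col k)
    (hl : ∀ l, row l = row k → col l + 1 = col k → l ∈ Z)
    (hu : ∀ l, row l = row b → col l = col k + 1 → l ∈ Z)
    (hbZ : b ∉ Z) (hbI : b ∉ I)
    (h₁ : ∀ v ∈ L₁, k.val < v.2.val) (hX : ∀ v ∈ LX, col k + 1 < v.1.val)
    (hE : ∀ S ∈ E, S ∈ Family Z I L₁ LX → S.res b = true ∧ S.labelAt (cornerB _ b) = .one) :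
    Matched diffCoeff (Family Z I L₁ LX \ E) := by
  refine matched_of_kink (O := tube (col k) b k) hM hbZ hbI ?_ (cornerB_mem_tube hbr hbc)
    cornerA_notMem_tube ?_ ?_ ?_ hE
  · intro ε h0 h1 hb
    exact (isClosedIn_tube_of_rows hbr hbc hb (h1 k hk) (fun l h h' => h0 l (hl l h h'))
      (fun l h h' => h0 l (hu l h h'))).1
  · intro v hv hv'; have := h₁ v hv; have := hv'.2.2; omega
  · intro v hv hv'; have := hX v hv; have := hv'.1; omega
  · intro l hlZ hlI hlb
    rw [← not_or]
    intro h
    rcases corner_mem_tube hbr hbc h with rfl | rfl | ⟨h1, h2⟩ | ⟨h1, h2⟩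
    · exact hlb rfl
    · exact hlI hk
    · exact hlZ (hl l h1 h2)
    · exact hlZ (hu l h1 h2)

/-- In the last crossing of a column, to the right of which all crossings have the 0-resolution: the
strand on the right gets the label `X`. -/
theorem matched_strand {b : Fin (torusBraid p q).length}
    (hM : Matched diffCoeff (Family (insert b Z) I L₁ (insert (cornerB _ b) LX) \ E))
    (hZ : ∀ l, l ≠ b → col l = col b ∨ col l = col b + 1 → l ∈ Z)
    (hbZ : b ∉ Z) (hbI : b ∉ I)
    (h₁ : ∀ v ∈ L₁, v.1.val ≠ col b + 1) (hX : ∀ v ∈ LX, v.1.val ≠ col b + 1)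
    (hE : ∀ S ∈ E, S ∈ Family Z I L₁ LX → S.res b = false ∧ S.labelAt (cornerB _ b) = .X) :
    Matched diffCoeff (Family Z I L₁ LX \ E) := by
  refine matched_of_merging_kink (O := {v | v.1.val = col b + 1}) hM hbZ hbI ?_ rfl ?_ h₁ hX
    ?_ hE
  · intro ε h0 h1 hb
    refine isClosedIn_strand isPositive_torusBraid fun l h2 h3 => ?_
    by_cases hlb : l = b
    · rwa [hlb]
    · exact h0 l (hZ l hlb (by omega))
  · simp only [Set.mem_ofPred_eq, cornerA_fst_val]; omega
  · intro l hlZ hlI hlb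
    simp only [Set.mem_ofPred_eq, cornerA_fst_val, cornerB_fst_val]
    have : ¬ (col l = col b ∨ col l = col b + 1) := fun h => hlZ (hZ l hlb h)
    omega

/-- A family is empty if the columns with prescribed 1-resolutions and the circles with the
prescribed label `1` are at least `4` in number, because its states have level `6`. -/
theorem notMem_family_of_columns {S : EnhancedState (torusBraid p q)} (hS : S ∈ Family Z I L₁ LX)
    (C : Finset ℕ) (hC : ∀ c ∈ C, ∃ k ∈ I, col k = c) (L : Finset (Node (torusBraid p q)))
    (hL : ∀ u ∈ L, ∀ v ∈ L, circleOf _ S.res u = circleOf _ S.res v → u = v)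
    (hone : ∀ v ∈ L, v ∈ L₁) (hcard : 4 ≤ C.card + L.card) : False := by
  have h1 := le_level isPositive_torusBraid S C
    (fun c hc => by obtain ⟨k, hk, h⟩ := hC c hc; exact ⟨k, h, hS.2.2.1 k hk⟩) L hL
    (fun v hv => hS.2.2.2.1 v (hone v hv))
  rw [hS.1] at h1
  have : (4 : ℤ) ≤ C.card + L.card := by exact_mod_cast hcard
  omega

end Moves

end Khovanov

namespace Khovanov

variable {p q : ℕ}

open EnhancedState

/-! ### Branches with a 1-resolution outside the critical state -/

section Scan

variable {Z I : Set (Fin (torusBraid p q).length)} {L₁ LX : Set (Node (torusBraid p q))}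

attribute [local simp] eq_cr_iff

theorem lt_cornerB_iff (k l : Fin (torusBraid p q).length) :
    k.val < (cornerB _ l).2.val ↔ ¬ (row l < row k ∨ (row l = row k ∧ col l < col k)) := by
  rw [← val_lt_iff, cornerB_snd_val]; omega

/-- A tube as in `matched_tube` when there are too many columns with 1-resolutions and too many
circles labelled `1` for a second label `1`. -/
theorem matched_tube_of_columns {k b : Fin (torusBraid p q).length}
    (hk : k ∈ I) (hbr : row b + 1 = row k) (hbc : col b = col k)
    (hl : ∀ l, row l = row k → col l + 1 = col k → l ∈ Z)
    (hu : ∀ l, row l = row b → col l = col k + 1 → l ∈ Z)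
    (hbZ : b ∉ Z) (hbI : b ∉ I)
    (h₁ : ∀ v ∈ L₁, k.val < v.2.val) (hX : ∀ v ∈ LX, col k + 1 < v.1.val)
    (C : Finset ℕ) (hC : ∀ c ∈ C, ∃ k ∈ I, col k = c) (L : Finset (Node (torusBraid p q)))
    (hL : L.card ≤ 1) (hone : ∀ v ∈ L, v ∈ L₁) (hcard : 3 ≤ C.card + L.card) :
    Matched diffCoeff (Family Z I L₁ LX \ ∅) := by
  classical
  refine matched_tube (matched_of_family_empty fun S hS => ?_) hk hbr hbc hl hu hbZ hbI h₁ hX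
    (by simp)
  have hS' := hS.2
  have hcl := (isClosedIn_tube_of_rows hbr hbc (hS'.2.1 b (Set.mem_insert _ _))
    (hS'.2.1 k (Set.mem_insert_of_mem _ hk)) (fun l h h' => hS'.1 l (hl l h h'))
    (fun l h h' => hS'.1 l (hu l h h'))).1
  have hout : ∀ v ∈ L, v ∉ tube (col k) b k := by
    intro v hv hv'; have := h₁ v (hone v hv); have := hv'.2.2; omega
  have hnot : cornerB _ b ∉ L := fun h => hout _ h (cornerB_mem_tube hbr hbc)
  refine notMem_family_of_columns hS C
    (fun c hc => by obtain ⟨l, hl, h⟩ := hC c hc; exact ⟨l, Set.mem_insert_of_mem _ hl, h⟩)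
    (insert (cornerB _ b) L) ?_ ?_ (by rw [Finset.card_insert_of_notMem hnot]; omega)
  · intro u hu v hv huv
    rw [Finset.mem_insert] at hu hv
    rcases hu with rfl | hu <;> rcases hv with rfl | hv
    · rfl
    · exact absurd huv (hcl.ne (cornerB_mem_tube hbr hbc) (hout v hv))
    · exact absurd huv.symm (hcl.ne (cornerB_mem_tube hbr hbc) (hout u hu))
    · exact Finset.card_le_one.1 hL u hu v hv
  · intro v hv
    rw [Finset.mem_insert] at hv
    rcases hv with rfl | hv
    · exact Set.mem_insert _ _
    · exact Set.mem_insert_of_mem _ (hone v hv)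

/-- The states with a 1-resolution in a column to the right of the first two. -/
theorem matched_of_right_column {c r : ℕ} (hc2 : 2 ≤ c) (hc : c < p - 1) (hr1 : 1 ≤ r)
    (hr : r < q) (hZ : ∀ l, l ∈ Z ↔ c < col l ∨ (col l = c ∧ r < row l))
    (hX : ∀ v ∈ LX, c + 1 < v.1.val) :
    Matched diffCoeff (Family Z (insert (cr r c hr hc) ∅) ∅ LX \ ∅) := by
  refine matched_slide_left (k := cr r c hr hc) (a := cr r (c - 1) hr (by omega))
    (b := cr (r - 1) c (by omega) hc) ?_ (by simp) (by simp) (by simp; omega) (by simp; omega)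
    (by simp) (by simp [hZ]; omega) (by simp [hZ]) (by simp; omega) (by simp [hZ])
    (by simp; omega) (by simp) (by simpa using hX) (by simp)
  refine matched_slide_left (k := cr r (c - 1) hr (by omega)) (a := cr r (c - 2) hr (by omega))
    (b := cr (r - 1) (c - 1) (by omega) (by omega)) ?_ (by simp) (by simp) (by simp; omega)
    (by simp; omega)
    (by simp) (by simp [hZ]; omega) (by simp [hZ]; omega) (by simp; omega) (by simp [hZ]; omega)
    (by simp; omega) (by simp) (fun v hv => by have := hX v hv; simp; omega) (by simp)
  by_cases hc3 : c = 2
  · subst hc3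
    refine matched_tube_of_columns (k := cr r 0 hr (by omega))
      (b := cr (r - 1) 0 (by omega) (by omega)) (by simp) (by simp; omega) (by simp) (by simp)
      (by simp [hZ]; omega) (by simp [hZ]) (by simp; omega) (by simp)
      (fun v hv => by have := hX v hv; simp; omega) (Finset.range 3) ?_ ∅ (by simp) (by simp)
      (by simp)
    intro c hc
    rw [Finset.mem_range] at hc
    refine ⟨cr r c hr (by omega), ?_, by simp⟩
    simp; omega
  · refine matched_slide_left (k := cr r (c - 2) hr (by omega)) (a := cr r (c - 3) hr (by omega))
      (b := cr (r - 1) (c - 2) (by omega) (by omega)) ?_ (by simp) (by simp) (by simp; omega)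
      (by simp; omega)
      (by simp) (by simp [hZ]; omega) (by simp [hZ]; omega) (by simp; omega) (by simp [hZ]; omega)
      (by simp; omega) (by simp) (fun v hv => by have := hX v hv; simp; omega) (by simp)
    refine matched_of_family_empty fun S hS => notMem_family_of_columns hS (Finset.Icc (c - 3) c)
      ?_ ∅ (by simp) (by simp) (by simp; omega)
    intro c' hc'
    rw [Finset.mem_Icc] at hc'
    refine ⟨cr r c' hr (by omega), ?_, by simp⟩
    simp; omega

/-- The states with a 1-resolution in the second column in a high row. -/
theorem matched_of_second_column (hp : 3 ≤ p) {r : ℕ} (hr3 : 3 ≤ r) (hr : r < q)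
    (hZ : ∀ l, l ∈ Z ↔ 1 < col l ∨ r < row l) (hX : ∀ v ∈ LX, 2 < v.1.val) :
    Matched diffCoeff (Family Z (insert (cr r 1 hr (by omega)) ∅) ∅ LX \ ∅) := by
  refine matched_slide_left (k := cr r 1 hr (by omega)) (a := cr r 0 hr (by omega))
    (b := cr (r - 1) 1 (by omega) (by omega)) ?_ (by simp) (by simp) (by simp) (by simp; omega)
    (by simp) (by simp [hZ]; omega) (by simp [hZ]) (by simp) (by simp [hZ])
    (by simp; omega) (by simp) (by simpa using hX) (by simp)
  refine matched_tube (k := cr r 0 hr (by omega)) (b := cr (r - 1) 0 (by omega) (by omega)) ?_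
    (by simp) (by simp; omega) (by simp) (by simp) (by simp; omega) (by simp [hZ])
    (by simp; omega) (by simp) (fun v hv => by have := hX v hv; simp; omega) (by simp)
  refine matched_slide_right (k := cr (r - 1) 0 (by omega) (by omega))
    (a := cr (r - 2) 1 (by omega) (by omega)) (b := cr (r - 2) 0 (by omega) (by omega)) ?_
    (by simp) (by simp) (by simp) (by simp; omega) (by simp) (by simp)
    (by simp [hZ]; omega) (by simp; omega) (by simp [hZ]) (by simp; omega)
    (by simp [lt_cornerB_iff]) (fun v hv => by have := hX v hv; simp; omega) (by simp)
  refine matched_tube_of_columns (k := cr (r - 2) 1 (by omega) (by omega))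
    (b := cr (r - 3) 1 (by omega) (by omega)) (by simp) (by simp; omega) (by simp)
    (by simp; omega) (by simp [hZ]; omega) (by simp [hZ]; omega) (by simp; omega)
    (by simp [lt_cornerB_iff]; omega) (fun v hv => by have := hX v hv; simp; omega)
    (Finset.range 2) ?_ {cornerB _ (cr (r - 1) 0 (by omega) (by omega))} (by simp) (by simp)
    (by simp)
  intro c hc
  rw [Finset.mem_range] at hc
  refine ⟨cr r c hr (by omega), ?_, by simp⟩
  simp; omega

/-- The states with a 1-resolution in the first column in a high row. -/
theorem matched_of_first_column (hp : 3 ≤ p) {r : ℕ} (hr3 : 3 ≤ r) (hr : r < q)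
    (hZ : ∀ l, l ∈ Z ↔ 1 < col l ∨ r < row l ∨ (row l = r ∧ col l = 1))
    (hX : ∀ v ∈ LX, 2 < v.1.val) :
    Matched diffCoeff (Family Z (insert (cr r 0 hr (by omega)) ∅) ∅ LX \ ∅) := by
  refine matched_slide_right (k := cr r 0 (by omega) (by omega))
    (a := cr (r - 1) 1 (by omega) (by omega)) (b := cr (r - 1) 0 (by omega) (by omega)) ?_
    (by simp) (by simp) (by simp) (by simp; omega) (by simp) (by simp)
    (by simp [hZ]; omega) (by simp) (by simp [hZ]) (by simp; omega)
    (by simp) (fun v hv => by have := hX v hv; simp; omega) (by simp)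
  refine matched_tube (k := cr (r - 1) 1 (by omega) (by omega))
    (b := cr (r - 2) 1 (by omega) (by omega)) ?_
    (by simp) (by simp; omega) (by simp) (by simp; omega) (by simp [hZ]; omega)
    (by simp [hZ]; omega)
    (by simp; omega) (by simp) (fun v hv => by have := hX v hv; simp; omega) (by simp)
  refine matched_slide_left (k := cr (r - 2) 1 (by omega) (by omega))
    (a := cr (r - 2) 0 (by omega) (by omega))
    (b := cr (r - 3) 1 (by omega) (by omega)) ?_ (by simp) (by simp) (by simp) (by simp; omega)
    (by simp) (by simp [hZ]; omega) (by simp [hZ]; omega) (by simp; omega) (by simp [hZ]; omega)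
    (by simp; omega) (by simp [lt_cornerB_iff]) (fun v hv => by have := hX v hv; simp; omega)
    (by simp)
  refine matched_tube_of_columns (k := cr (r - 2) 0 (by omega) (by omega))
    (b := cr (r - 3) 0 (by omega) (by omega)) (by simp) (by simp; omega) (by simp)
    (by simp) (by simp; omega) (by simp [hZ]; omega) (by simp; omega)
    (by simp [lt_cornerB_iff]) (fun v hv => by have := hX v hv; simp; omega)
    (Finset.range 2) ?_ {cornerB _ (cr (r - 2) 1 (by omega) (by omega))} (by simp) (by simp)
    (by simp)
  intro c hc
  rw [Finset.mem_range] at hc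
  interval_cases c
  · exact ⟨cr r 0 hr (by omega), by simp, by simp⟩
  · exact ⟨cr (r - 1) 1 (by omega) (by omega), by simp, by simp⟩

/-- The states in which the second crossing of the second column has the 1-resolution, but no later
crossing of this column. -/
theorem matched_of_second_row (hp : 3 ≤ p) (hq : 3 ≤ q)
    (hZ : ∀ l, l ∈ Z ↔ 1 < col l ∨ 2 < row l ∨ (row l = 2 ∧ col l = 1))
    (hX : ∀ v ∈ LX, 2 < v.1.val) :
    Matched diffCoeff (Family Z (insert (cr 1 1 (by omega) (by omega)) ∅) ∅ LX \ ∅) := by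
  refine matched_slide_left (k := cr 1 1 (by omega) (by omega))
    (a := cr 1 0 (by omega) (by omega))
    (b := cr 0 1 (by omega) (by omega)) ?_ (by simp) (by simp) (by simp) (by simp)
    (by simp) (by simp [hZ]; omega) (by simp [hZ]) (by simp) (by simp [hZ])
    (by simp) (by simp) (by simpa using hX) (by simp)
  refine matched_tube (k := cr 1 0 (by omega) (by omega))
    (b := cr 0 0 (by omega) (by omega)) ?_
    (by simp) (by simp) (by simp) (by simp) (by simp; omega)
    (by simp [hZ])
    (by simp) (by simp) (fun v hv => by have := hX v hv; simp; omega) (by simp)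
  -- The circle outside the first and the last 1-resolution of the first column.
  have hcl : ∀ ε : Resolution (torusBraid p q), (∀ k ∈ Z, ε k = false) →
      ε (cr 0 1 (by omega) (by omega)) = false →
      ε (cr 0 0 (by omega) (by omega)) = true → ε (cr 2 0 (by omega) (by omega)) = true →
      IsClosedIn ε (outerTube 0 (cr 0 0 (by omega) (by omega))
        (cr 2 0 (by omega) (by omega) : Fin (torusBraid p q).length)) := by
    intro ε h0 h1 h2 h3
    refine isClosedIn_outerTube isPositive_torusBraid ?_ (by simp) (by simp) h2 h3 ?_
    · rw [Fin.le_def]; exact le_of_lt ((val_lt_iff _ _).2 (by simp))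
    · intro l hl hl' hl''
      rw [Fin.lt_def, Fin.lt_def, val_lt_iff, val_lt_iff] at hl
      simp at hl
      exact h0 l ((hZ l).2 (by omega))
  have hB : cornerB _ (cr 2 0 (by omega) (by omega)) ∈
      outerTube 0 (cr 0 0 (by omega) (by omega))
        (cr 2 0 (by omega) (by omega) : Fin (torusBraid p q).length) := by
    refine ⟨Or.inr (by simp [cornerB_fst_val]), Or.inl ?_⟩
    rw [cornerB_snd_val]; omega
  have hB' : cornerB _ (cr 0 0 (by omega) (by omega)) ∉
      outerTube 0 (cr 0 0 (by omega) (by omega))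
        (cr 2 0 (by omega) (by omega) : Fin (torusBraid p q).length) := by
    have := val_lt_iff (cr 0 0 (by omega) (by omega))
      (cr 2 0 (by omega) (by omega) : Fin (torusBraid p q).length)
    simp only [row_cr, col_cr] at this
    rintro ⟨-, h⟩
    rw [cornerB_snd_val] at h; omega
  refine matched_of_kink (b := cr 2 0 (by omega) (by omega))
    (O := outerTube 0 (cr 0 0 (by omega) (by omega)) (cr 2 0 (by omega) (by omega)))
    (matched_of_family_empty fun S hS => ?_) (by simp [hZ]) (by simp) ?_ hB ?_ ?_ ?_ ?_ (by simp)
  · refine notMem_family_of_columns hS (Finset.range 2) ?_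
      {cornerB _ (cr 2 0 (by omega) (by omega)), cornerB _ (cr 0 0 (by omega) (by omega))} ?_
      (by simp) ?_
    · intro c hc
      rw [Finset.mem_range] at hc
      exact ⟨cr 1 c (by omega) (by omega), by simp; omega, by simp⟩
    · have hcl' := (hcl S.res (fun k hk => hS.2.1 k (Set.mem_insert_of_mem _ hk))
        (hS.2.1 _ (by simp)) (hS.2.2.1 _ (by simp)) (hS.2.2.1 _ (by simp))).ne hB hB'
      intro u hu v hv huv
      rw [Finset.mem_insert, Finset.mem_singleton] at hu hv
      rcases hu with rfl | rfl <;> rcases hv with rfl | rfl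
      · rfl
      · exact absurd huv hcl'
      · exact absurd huv.symm hcl'
      · rfl
    · rw [Finset.card_pair (fun h => hB' (by rw [← h]; exact hB))]; simp
  · intro ε h0 h1 hb
    exact hcl ε (fun k hk => h0 k (Set.mem_insert_of_mem _ hk)) (h0 _ (by simp))
      (h1 _ (by simp)) hb
  · have := val_lt_iff (cr 0 0 (by omega) (by omega))
      (cr 2 0 (by omega) (by omega) : Fin (torusBraid p q).length)
    simp only [row_cr, col_cr] at this
    rintro ⟨-, h⟩
    rw [cornerA_snd_val] at h; omega
  · simpa using hB'
  · intro v hv h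
    have := hX v hv
    have := h.1
    omega
  · intro l hlZ hlI hlb
    have h1 := val_lt_iff l (cr 0 0 (by omega) (by omega))
    have h2 := val_lt_iff (cr 2 0 (by omega) (by omega)) l
    have h3 := fun h => hlb (Fin.ext h)
    have h4 : ¬ (l.val = (cr 0 0 (by omega) (by omega) : Fin (torusBraid p q).length).val) :=
      fun h => hlI (by simp [Fin.ext h])
    simp only [Set.mem_insert_iff, hZ, eq_cr_iff, not_or] at hlZ hlI
    simp only [outerTube, Set.mem_ofPred_eq, cornerA_fst_val, cornerA_snd_val, cornerB_fst_val,
      cornerB_snd_val]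
    simp only [row_cr, col_cr] at h1 h2
    omega

end Scan

end Khovanov

namespace Khovanov

variable {p q : ℕ}

open EnhancedState

/-! ### The matching of the states of level 6 -/

section Scan

attribute [local simp] eq_cr_iff

/-- One point on each of the strands to the right of the column `c`. -/
def strandPoints (p q c : ℕ) : Set (Node (torusBraid p q)) :=
  {v | ∃ l, row l = 0 ∧ c ≤ col l ∧ v = cornerB _ l}

theorem insert_strandPoints {c : ℕ} (hq : 0 < q) (hc : c < p - 1) :
    insert (cornerB _ (cr 0 c hq hc)) (strandPoints p q (c + 1)) = strandPoints p q c := by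
  ext v
  simp only [strandPoints, Set.mem_insert_iff, Set.mem_ofPred_eq]
  constructor
  · rintro (rfl | ⟨l, h1, h2, rfl⟩)
    · exact ⟨_, by simp, by simp, rfl⟩
    · exact ⟨l, h1, by omega, rfl⟩
  · rintro ⟨l, h1, h2, rfl⟩
    by_cases h : col l = c
    · exact Or.inl (by rw [(eq_cr_iff hq hc l).2 ⟨h1, h⟩])
    · exact Or.inr ⟨l, h1, by omega, rfl⟩

theorem lt_of_mem_strandPoints {c : ℕ} {v : Node (torusBraid p q)} (hv : v ∈ strandPoints p q c) :
    c < v.1.val := by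
  obtain ⟨l, -, h, rfl⟩ := hv
  rw [cornerB_fst_val]; omega

/-- The states of level 6 that look like states of the torus link `T_{2,3}` on the first two strands:
the 1-resolution occurs only in the first three crossings between these strands, and the other
strands are labelled `X`. -/
def residual (p q : ℕ) : Set (EnhancedState (torusBraid p q)) :=
  Family {k | ¬ (col k = 0 ∧ row k ≤ 2)} ∅ ∅ (strandPoints p q 1)

/-- The crossings with the 1-resolution in the critical state. -/
def criticalOnes (p q : ℕ) : Set (Fin (torusBraid p q).length) :=
  {k | (row k = 2 ∧ col k = 1) ∨ (row k = 2 ∧ col k = 0) ∨ (row k = 1 ∧ col k = 0) ∨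
    (row k = 0 ∧ col k = 1)}

/-- The critical state, as a set of states that turns out to have a single element. -/
def critical (hp : 3 ≤ p) (hq : 3 ≤ q) : Set (EnhancedState (torusBraid p q)) :=
  Family (criticalOnes p q)ᶜ (criticalOnes p q)
    (insert (cornerB _ (cr 1 0 (by omega) (by omega))) ∅) (strandPoints p q 2)

variable {Z : Set (Fin (torusBraid p q).length)}

/-- The states with the 1-resolution in the third crossing of the second column, but in no later
crossing of the first two columns and in no other column. This branch contains the critical
state. -/
theorem matched_critical_branch (hp : 3 ≤ p) (hq : 3 ≤ q)
    (hZ : ∀ l, l ∈ Z ↔ 1 < col l ∨ 2 < row l) :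
    Matched diffCoeff (Family Z (insert (cr 2 1 (by omega) (by omega)) ∅) ∅ (strandPoints p q 2) \
      critical hp hq) := by
  have hX := fun v (hv : v ∈ strandPoints p q 2) => lt_of_mem_strandPoints hv
  have hone : ∀ S ∈ critical hp hq, ∀ k, S.res k = true ↔ k ∈ criticalOnes p q := by
    intro S hS k
    by_cases hk : k ∈ criticalOnes p q
    · simp [hk, hS.2.2.1 k hk]
    · simp [hk, hS.2.1 k hk]
  refine matched_slide_left (k := cr 2 1 (by omega) (by omega))
    (a := cr 2 0 (by omega) (by omega))
    (b := cr 1 1 (by omega) (by omega)) ?_ (by simp) (by simp) (by simp) (by simp)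
    (by simp) (by simp [hZ]; omega) (by simp [hZ]) (by simp) (by simp [hZ])
    (by simp) (by simp) (by simpa using hX) ?_
  swap
  · intro S hS _
    rw [hone S hS, ← Bool.not_eq_true, hone S hS]
    simp [criticalOnes]
  refine matched_tube (k := cr 2 0 (by omega) (by omega))
    (b := cr 1 0 (by omega) (by omega)) ?_
    (by simp) (by simp) (by simp) (by simp) (by simp; omega)
    (by simp [hZ])
    (by simp) (by simp) (fun v hv => by have := hX v hv; simp; omega) ?_
  swap
  · intro S hS _
    rw [hone S hS]
    exact ⟨by simp [criticalOnes], hS.2.2.2.1 _ (by simp)⟩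
  refine matched_slide_right (k := cr 1 0 (by omega) (by omega))
    (a := cr 0 1 (by omega) (by omega)) (b := cr 0 0 (by omega) (by omega)) ?_
    (by simp) (by simp) (by simp) (by simp) (by simp) (by simp)
    (by simp [hZ]) (by simp) (by simp [hZ]) (by simp)
    (by simp [lt_cornerB_iff]) (fun v hv => by have := hX v hv; simp; omega) ?_
  swap
  · intro S hS _
    rw [hone S hS, ← Bool.not_eq_true, hone S hS]
    simp [criticalOnes]
  have h1 : insert (cr 0 0 (by omega) (by omega)) (insert (cr 1 1 (by omega) (by omega)) Z) =
      (criticalOnes p q)ᶜ := by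
    ext l
    simp only [Set.mem_insert_iff, eq_cr_iff, hZ, criticalOnes, Set.mem_compl_iff,
      Set.mem_ofPred_eq]
    omega
  have h2 : insert (cr 0 1 (by omega) (by omega)) (insert (cr 1 0 (by omega) (by omega))
      (insert (cr 2 0 (by omega) (by omega)) (insert (cr 2 1 (by omega) (by omega)) ∅))) =
      criticalOnes p q := by
    ext l
    simp only [Set.mem_insert_iff, eq_cr_iff, criticalOnes, Set.mem_ofPred_eq,
      Set.mem_empty_iff_false, or_false]
    omega
  rw [h1, h2]
  change Matched diffCoeff (critical hp hq \ critical hp hq)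
  rw [Set.sdiff_self]
  exact matched_empty

variable (hp : 3 ≤ p) (hq : 3 ≤ q)

/-- The crossings with the 1-resolution in the critical state or in the residual complex. -/
theorem col_row_of_exceptional {S : EnhancedState (torusBraid p q)}
    (hS : S ∈ residual p q ∪ critical hp hq) {k : Fin (torusBraid p q).length}
    (hk : S.res k = true) : col k ≤ 1 ∧ row k ≤ 2 ∧ ¬ (row k = 1 ∧ col k = 1) := by
  rcases hS with hS | hS
  · by_contra h
    have := hS.2.1 k (by simp only [Set.mem_ofPred_eq]; omega)
    rw [hk] at this; simp at this
  · by_contra h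
    have := hS.2.1 k (by simp only [Set.mem_compl_iff, criticalOnes, Set.mem_ofPred_eq]; omega)
    rw [hk] at this; simp at this

/-- A branch is disjoint from the unmatched states if it prescribes a 1-resolution that these do not
have. -/
theorem matched_of_forbidden {I : Set (Fin (torusBraid p q).length)}
    {L₁ LX : Set (Node (torusBraid p q))} {k : Fin (torusBraid p q).length} (hkI : k ∈ I)
    (hk : ¬ (col k ≤ 1 ∧ row k ≤ 2 ∧ ¬ (row k = 1 ∧ col k = 1)))
    (hM : Matched diffCoeff (Family Z I L₁ LX \ ∅)) :
    Matched diffCoeff (Family Z I L₁ LX \ (residual p q ∪ critical hp hq)) := by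
  refine matched_sdiff_of_disjoint hM fun S hS => ?_
  simp only [Set.mem_empty_iff_false, iff_false]
  exact fun h => hk (col_row_of_exceptional hp hq h (hS.2.2.1 k hkI))

theorem labelAt_of_exceptional {S : EnhancedState (torusBraid p q)}
    (hS : S ∈ residual p q ∪ critical hp hq) {v} (hv : v ∈ strandPoints p q 2) :
    S.labelAt v = .X := by
  rcases hS with hS | hS
  · obtain ⟨l, h1, h2, rfl⟩ := hv
    exact hS.2.2.2.2 _ ⟨l, h1, by omega, rfl⟩
  · exact hS.2.2.2.2 _ hv

/-- The case of 1-resolutions in the first three rows of the first two columns only. -/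
theorem matched_low_rows : Matched diffCoeff (Family {l | 1 < col l ∨ 3 ≤ row l} ∅ ∅
    (strandPoints p q 2) \ (residual p q ∪ critical hp hq)) := by
  have hX := fun v (hv : v ∈ strandPoints p q 2) => lt_of_mem_strandPoints hv
  refine matched_branch (cr 2 1 (by omega) (by omega)) ?_ ?_
  · refine matched_sdiff_of_disjoint
      (matched_critical_branch hp hq (by simp only [Set.mem_ofPred_eq]; omega)) fun S hS => ?_
    refine or_iff_right fun h => ?_
    have h1 := h.2.1 (cr 2 1 (by omega) (by omega)) (by simp)
    rw [hS.2.2.1 _ (by simp)] at h1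
    simp at h1
  refine matched_branch (cr 1 1 (by omega) (by omega))
    (matched_of_forbidden hp hq (Set.mem_insert _ _) (by simp)
      (matched_of_second_row hp hq (by
        simp only [Set.mem_insert_iff, eq_cr_iff, Set.mem_ofPred_eq]; omega) hX)) ?_
  refine matched_strand (b := cr 0 1 (by omega) (by omega)) ?_ ?_ (by simp) (by simp) (by simp)
    (fun v hv => by have := hX v hv; simp; omega) ?_
  · rw [insert_strandPoints]
    have h : insert (cr 0 1 (by omega) (by omega)) (insert (cr 1 1 (by omega) (by omega))
        (insert (cr 2 1 (by omega) (by omega)) {l : Fin (torusBraid p q).length |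
          1 < col l ∨ 3 ≤ row l})) = {k | ¬ (col k = 0 ∧ row k ≤ 2)} := by
      ext l
      simp only [Set.mem_insert_iff, eq_cr_iff, Set.mem_ofPred_eq]
      omega
    rw [h]
    change Matched diffCoeff (residual p q \ _)
    rw [Set.sdiff_eq_empty.2 Set.subset_union_left]
    exact matched_empty
  · intro l hl hl'
    simp only [Ne, Set.mem_insert_iff, eq_cr_iff, Set.mem_ofPred_eq, col_cr] at hl hl' ⊢
    omega
  · rintro S (hS | hS) hS'
    · exact ⟨hS.2.1 _ (by simp), hS.2.2.2.2 _ ⟨_, by simp, by simp, rfl⟩⟩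
    · have h1 := hS.2.2.1 (cr 2 1 (by omega) (by omega)) (by simp [criticalOnes])
      rw [hS'.2.1 _ (by simp)] at h1
      simp at h1

/-- The case of 1-resolutions in the first `r` rows of the first two columns only. -/
theorem matched_two_columns {r : ℕ} (hr : 3 ≤ r) (hrq : r ≤ q) :
    Matched diffCoeff (Family {l | 1 < col l ∨ r ≤ row l} ∅ ∅
      (strandPoints p q 2) \ (residual p q ∪ critical hp hq)) := by
  have hX := fun v (hv : v ∈ strandPoints p q 2) => lt_of_mem_strandPoints hv
  induction r, hr using Nat.le_induction with
  | base => exact matched_low_rows hp hq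
  | succ r hr ih =>
    refine matched_branch (cr r 1 (by omega) (by omega))
      (matched_of_forbidden hp hq (Set.mem_insert _ _) (by simp; omega)
        (matched_of_second_column hp hr hrq (by simp only [Set.mem_ofPred_eq]; omega) hX)) ?_
    refine matched_branch (cr r 0 (by omega) (by omega))
      (matched_of_forbidden hp hq (Set.mem_insert _ _) (by simp; omega)
        (matched_of_first_column hp hr hrq (by
          simp only [Set.mem_insert_iff, eq_cr_iff, Set.mem_ofPred_eq]; omega) hX)) ?_
    have h : insert (cr r 0 (by omega) (by omega)) (insert (cr r 1 (by omega) (by omega))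
        {l : Fin (torusBraid p q).length | 1 < col l ∨ r + 1 ≤ row l}) =
        {l | 1 < col l ∨ r ≤ row l} := by
      ext l
      simp only [Set.mem_insert_iff, eq_cr_iff, Set.mem_ofPred_eq]
      omega
    rw [h]
    exact ih (by omega)

/-- Reduction of the column `c`, in which only the first `r` rows may have the 1-resolution, while all
columns to the right of `c` have the 0-resolution. -/
theorem matched_column {c r : ℕ} (hc2 : 2 ≤ c) (hc : c < p - 1) (hr : 1 ≤ r) (hrq : r ≤ q)
    (hM : Matched diffCoeff (Family {l | c ≤ col l} ∅ ∅
      (strandPoints p q c) \ (residual p q ∪ critical hp hq))) :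
    Matched diffCoeff (Family {l | c < col l ∨ (col l = c ∧ r ≤ row l)} ∅ ∅
      (strandPoints p q (c + 1)) \ (residual p q ∪ critical hp hq)) := by
  have hX := fun v (hv : v ∈ strandPoints p q (c + 1)) => lt_of_mem_strandPoints hv
  induction r, hr using Nat.le_induction with
  | base =>
    refine matched_strand (b := cr 0 c (by omega) (by omega)) ?_ ?_ (by simp) (by simp) (by simp)
      (fun v hv => by have := hX v hv; simp; omega) ?_
    · rw [insert_strandPoints]
      have h : insert (cr 0 c (by omega) (by omega))
          {l : Fin (torusBraid p q).length | c < col l ∨ (col l = c ∧ 1 ≤ row l)} =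
          {l | c ≤ col l} := by
        ext l
        simp only [Set.mem_insert_iff, eq_cr_iff, Set.mem_ofPred_eq]
        omega
      rw [h]; exact hM
    · intro l hl hl'
      simp only [Ne, eq_cr_iff, Set.mem_ofPred_eq, col_cr] at hl hl' ⊢
      omega
    · rintro S hS -
      refine ⟨?_, labelAt_of_exceptional hp hq hS ⟨_, by simp, by simpa using hc2, rfl⟩⟩
      by_contra h
      have := col_row_of_exceptional hp hq hS (by simpa using h)
      simp at this; omega
  | succ r hr ih =>
    refine matched_branch (cr r c (by omega) (by omega))
      (matched_of_forbidden hp hq (Set.mem_insert _ _) (by simp; omega)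
        (matched_of_right_column hc2 hc hr hrq (by simp only [Set.mem_ofPred_eq]; omega) hX)) ?_
    have h : insert (cr r c (by omega) (by omega))
        {l : Fin (torusBraid p q).length | c < col l ∨ (col l = c ∧ r + 1 ≤ row l)} =
        {l | c < col l ∨ (col l = c ∧ r ≤ row l)} := by
      ext l
      simp only [Set.mem_insert_iff, eq_cr_iff, Set.mem_ofPred_eq]
      omega
    rw [h]
    exact ih (by omega)

/-- The case of 1-resolutions in the first `c` columns only. -/
theorem matched_columns {c : ℕ} (hc2 : 2 ≤ c) (hc : c ≤ p - 1) :
    Matched diffCoeff (Family {l | c ≤ col l} ∅ ∅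
      (strandPoints p q c) \ (residual p q ∪ critical hp hq)) := by
  induction c, hc2 using Nat.le_induction with
  | base =>
    have h : {l : Fin (torusBraid p q).length | 2 ≤ col l} = {l | 1 < col l ∨ q ≤ row l} := by
      ext l
      have := row_lt l
      simp only [Set.mem_ofPred_eq]; omega
    rw [h]
    exact matched_two_columns hp hq hq le_rfl
  | succ c hc2 ih =>
    have h : {l : Fin (torusBraid p q).length | c + 1 ≤ col l} =
        {l | c < col l ∨ (col l = c ∧ q ≤ row l)} := by
      ext l
      have := row_lt l
      simp only [Set.mem_ofPred_eq]; omega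
    rw [h]
    exact matched_column hp hq hc2 hc (by omega) le_rfl (ih (by omega))

/-- All states of level 6 outside the residual complex and the critical state can be matched. -/
theorem matched_level_six : Matched diffCoeff
    ({S | level S = 6} \ (residual p q ∪ critical hp hq)) := by
  have h := matched_columns hp hq (c := p - 1) (by omega) le_rfl
  have h1 : (Family {l | p - 1 ≤ col l} ∅ ∅ (strandPoints p q (p - 1)) :
      Set (EnhancedState (torusBraid p q))) = {S | level S = 6} := by
    ext S
    simp only [Family, Set.mem_ofPred_eq, Set.mem_empty_iff_false, IsEmpty.forall_iff,
      implies_true, true_and, and_iff_left_iff_imp]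
    intro _
    refine ⟨fun l hl => absurd (col_lt l) (by omega), ?_⟩
    rintro v ⟨l, -, h, -⟩
    exact absurd (col_lt l) (by omega)
  rwa [h1] at h

end Scan

end Khovanov

namespace Khovanov

open EnhancedState

section Indicator

variable {p : ℕ} {w : BraidWord p}

/-! ### States with few labels `1` -/

/-- The resolution whose 1-resolutions are the crossings in `s`. -/
def resOf (s : Finset (Fin w.length)) : Resolution w := fun k => decide (k ∈ s)

theorem resOf_eq_true {s : Finset (Fin w.length)} {k} : resOf s k = true ↔ k ∈ s :=
  decide_eq_true_iff

theorem resOf_eq_false {s : Finset (Fin w.length)} {k} : resOf s k = false ↔ k ∉ s :=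
  decide_eq_false_iff_not

theorem resOf_insert (s : Finset (Fin w.length)) (k) :
    resOf (insert k s) = Function.update (resOf s) k true := by
  funext l
  by_cases h : l = k
  · subst h; simp [resOf]
  · simp [resOf, h]

theorem ones_resOf (s : Finset (Fin w.length)) : ones (resOf s) = s.card := by
  unfold ones
  congr 1
  ext k
  simp [resOf_eq_true]

theorem edgeSign_resOf (s : Finset (Fin w.length)) (k) :
    edgeSign (resOf s) k = (-1) ^ (s.filter (· < k)).card := by
  unfold edgeSign
  congr 2
  ext l
  simp [resOf_eq_true, and_comm]

theorem eq_resOf {ε : Resolution w} {s : Finset (Fin w.length)} (h : ∀ k, ε k = true → k ∈ s)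
    (hcard : s.card = ones ε) : ε = resOf s := by
  have : (Finset.univ.filter fun k => ε k = true) = s :=
    Finset.eq_of_subset_of_card_le (fun k hk => h k (Finset.mem_filter.1 hk).2) hcard.le
  rw [← this]
  funext k
  simp [resOf]

theorem card_circle_resOf_empty (hw : IsPositive w) :
    Fintype.card (Circle w (resOf ∅)) = p := by
  have h0 : ∀ k : Fin w.length, resOf ∅ k = false := fun k => by simp [resOf]
  refine le_antisymm (card_circle_le_of_zero hw h0) ?_
  have hi : Function.Injective (fun s : Fin p => circleOf w (resOf ∅) (s, 0)) := by
    intro s t hst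
    by_contra hne
    refine (isClosedIn_strand hw (s := s.val) fun l _ _ => h0 l).ne (u := (s, 0)) (v := (t, 0))
      rfl ?_ hst
    exact fun h => hne (Fin.ext h.symm)
  simpa using Fintype.card_le_of_injective _ hi

theorem card_circle_of_merge (hw : IsPositive w) {s : Finset (Fin w.length)} {k : Fin w.length}
    (h : ∀ l ∈ s, col l ≠ col k) :
    Fintype.card (Circle w (resOf s)) = Fintype.card (Circle w (resOf (insert k s))) + 1 := by
  rw [resOf_insert]
  refine (isMerge_update (resOf_eq_false.2 fun hk => h k hk rfl)
    (circleOf_corners_ne hw fun l hl => ?_)).card_eq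
  exact resOf_eq_false.2 fun hl' => h l hl' hl

theorem isMerge_of_split {s : Finset (Fin w.length)} {k : Fin w.length} (hk : k ∉ s)
    {x y : Node w} (hxy : AreCorners k x y) {O : Set (Node w)}
    (hO : IsClosedIn (resOf (insert k s)) O) (hx : x ∈ O) (hy : y ∉ O) :
    IsMerge (resOf (insert k s)) (resOf s) k := by
  refine isMerge_of_closed_true hxy (fun l hl => ?_) ?_ hO hx hy
  · rw [resOf_insert, Function.update_of_ne hl]
  · rw [resOf_eq_false.2 hk, resOf_eq_true.2 (Finset.mem_insert_self _ _)]; simp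

/-- The points on the strands `c` and `c + 1` outside the first and the last 1-resolution in column
`c` are on one circle, if there are no 1-resolutions in the neighbouring columns. -/
theorem circleOf_outerTube (hw : IsPositive w) {ε : Resolution w} {c : ℕ} {lo hi : Fin w.length}
    (hlo : col lo = c) (h1 : ε lo = true)
    (h : ∀ l : Fin w.length, l < lo ∨ hi < l → col l ≤ c + 1 → c ≤ col l + 1 → ε l = false)
    {v : Node w} (hv : v ∈ outerTube c lo hi) : circleOf w ε v = circleOf w ε (cornerA w lo) := by
  obtain ⟨s, x⟩ := v
  obtain ⟨hs, hx⟩ := hv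
  dsimp only at hs hx
  have key : circleOf w ε (s, x) = circleOf w ε (s, lo.castSucc) := by
    have h2 : circleOf w ε (s, 0) = circleOf w ε (s, lo.castSucc) := by
      refine circleOf_strand_le hw (s := s) (Nat.zero_le lo.val) (by omega) ?_
      intro l _ hl hl'
      exact h l (Or.inl hl) (by omega) (by omega)
    rcases hx with hx | hx
    · rw [← h2, ← circleOf_of_arc (Arc.closing s)]
      refine circleOf_strand_le hw (s := s) (a := x.val) (b := w.length) (by omega) (by omega) ?_
      intro l hl _ hl'
      exact h l (Or.inr (by rw [Fin.lt_def]; omega)) (by omega) (by omega)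
    · refine circleOf_strand_le hw (s := s) (a := x.val) (b := lo.val) hx (by omega) ?_
      intro l _ hl hl'
      exact h l (Or.inl hl) (by omega) (by omega)
  rw [key]
  rcases hs with hs | hs
  · have : s = leftPos w lo := Fin.ext (hs.trans hlo.symm)
    subst this; rfl
  · have : s = rightPos w lo := Fin.ext (by rw [rightPos_val]; unfold col at hlo; omega)
    subst this
    exact (circleOf_lower hw h1).symm

open Classical in
/-- The state with the label `1` on the circles in `O` and the label `X` on the others. -/
noncomputable def indicator (ε : Resolution w) (O : Set (Node w)) (hO : IsClosedIn ε O) :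
    EnhancedState w :=
  ofLabel ε (fun v => if v ∈ O then .one else .X) fun u v h => by simp only [hO.mem_iff h]

section

variable {ε : Resolution w} {O : Set (Node w)} (hO : IsClosedIn ε O)

theorem indicator_labelAt_of_mem {v : Node w} (hv : v ∈ O) :
    (indicator ε O hO).labelAt v = .one := if_pos hv

theorem indicator_labelAt_of_notMem {v : Node w} (hv : v ∉ O) :
    (indicator ε O hO).labelAt v = .X := if_neg hv

theorem indicator_labelAt_eq_one {v : Node w} :
    (indicator ε O hO).labelAt v = .one ↔ v ∈ O := by
  by_cases hv : v ∈ O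
  · simp [hv, indicator_labelAt_of_mem hO hv]
  · simp [hv, indicator_labelAt_of_notMem hO hv]

end

/-- The level of a state with 1-resolutions in `s`, in terms of a system `L` of representatives of
the circles labelled `1`. -/
theorem level_eq (S : EnhancedState w) {s : Finset (Fin w.length)} (hs : S.res = resOf s)
    (L : Finset (Node w))
    (hL : ∀ u ∈ L, ∀ v ∈ L, circleOf w S.res u = circleOf w S.res v → u = v)
    (hone : ∀ v ∈ L, S.labelAt v = .one)
    (hall : ∀ v, S.labelAt v = .one → ∃ u ∈ L, circleOf w S.res v = circleOf w S.res u) :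
    level S = 2 * L.card + s.card + p - Fintype.card (Circle w (resOf s)) := by
  classical
  have h1 : (Finset.univ.filter fun c => S.label c = .one) = L.image (circleOf w S.res) := by
    ext c
    obtain ⟨v, rfl⟩ := exists_circleOf c
    simp only [Finset.mem_filter, Finset.mem_univ, true_and, Finset.mem_image]
    constructor
    · intro h
      obtain ⟨u, hu, huv⟩ := hall v h
      exact ⟨u, hu, huv.symm⟩
    · rintro ⟨u, hu, huv⟩
      rw [← huv]; exact hone u hu
  have h2 : (L.image (circleOf w S.res)).card = L.card :=
    Finset.card_image_of_injOn fun u hu v hv => hL u hu v hv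
  have h3 : S.weight = s.card := by rw [← ones_resOf, ← hs]; rfl
  unfold level
  rw [degSum_eq_card, h1, h2, h3, hs]
  ring

end Indicator

end Khovanov

namespace Khovanov

open EnhancedState

/-! ### The residual complex -/

/-- The coefficient of a split of a circle labelled `1` when at most one further circle (that
through `u`) is labelled `1`: it is `1` if exactly one of the new circles is labelled `1`, and the
label of the further circle is kept. -/
theorem edgeCoeff_of_split {p : ℕ} {w : BraidWord p} {k : Fin w.length} {S T : EnhancedState w}
    (hk : S.res k = false)
    (hres : T.res = Function.update S.res k true)
    (hm : IsMerge T.res S.res k) (hone : S.labelAt (cornerA w k) = .one) {u : Node w}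
    (hu : circleOf w S.res u ≠ circleOf w S.res (cornerA w k)) (hu1 : S.labelAt u = .one)
    (haway : ∀ v, circleOf w S.res v ≠ circleOf w S.res (cornerA w k) →
      T.labelAt v = S.labelAt v ∨ (S.labelAt v = .one ∧ T.labelAt v = T.labelAt u)) :
    edgeCoeff k S T = if T.labelAt u = .one then
      comulCoeff .one (T.labelAt (cornerA w k)) (T.labelAt (cornerB w k)) else 0 := by
  split_ifs with h
  · rw [edgeCoeff_split hk hres hm.corners_eq, hone]
    intro v hv
    rcases haway v hv with h' | ⟨h', h''⟩
    · exact h'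
    · rw [h', h'', h]
  · by_contra h0
    refine h ?_
    rw [labelAt_of_edgeCoeff_ne_zero h0 u hu (hm.corners_eq ▸ hu), hu1]

section Residual

variable {p q : ℕ}

theorem lt_of_row {k l : Fin (torusBraid p q).length} (h : row k < row l) : k < l :=
  Fin.lt_def.2 ((val_lt_iff k l).2 (Or.inl h))

theorem labelAt_of_mem_residual {S : EnhancedState (torusBraid p q)} (hS : S ∈ residual p q)
    {v : Node (torusBraid p q)} (hv : 2 ≤ v.1.val) (hq : 0 < q) : S.labelAt v = .X := by
  obtain ⟨s, x⟩ := v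
  dsimp only at hv
  have hz : ∀ l : Fin (torusBraid p q).length, (col l = s.val ∨ col l + 1 = s.val) →
      S.res l = false := by
    intro l hl
    refine hS.2.1 l ?_
    simp only [Set.mem_ofPred_eq]; omega
  have hlt := s.isLt
  set l := cr (p := p) 0 (s.val - 1) hq (by omega)
  have h1 : cornerB _ l = (s, (cornerB _ l).2) :=
    Prod.ext (Fin.ext (by rw [cornerB_fst_val]; simp only [l, col_cr]; omega)) rfl
  have h2 : circleOf _ S.res (s, x) = circleOf _ S.res (cornerB _ l) := by
    rw [h1, circleOf_strand isPositive_torusBraid hz x,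
      circleOf_strand isPositive_torusBraid hz (cornerB _ l).2]
  rw [S.labelAt_eq h2]
  exact hS.2.2.2.2 _ ⟨l, by simp [l], by simp only [l, col_cr]; omega, rfl⟩

section Pair

variable {a b : Fin (torusBraid p q).length}

theorem isClosedIn_first_strands (ha : col a = 0) (hb : col b = 0) :
    IsClosedIn (resOf {a, b}) {v : Node (torusBraid p q) | v.1.val ≤ 1} := by
  refine isClosedIn_left isPositive_torusBraid fun l hl => resOf_eq_false.2 fun h => ?_
  rcases Finset.mem_insert.1 h with rfl | h
  · omega
  · rw [Finset.mem_singleton.1 h] at hl; omega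

/-- The state with 1-resolutions at two crossings of the first column and the label `1` on the two
circles on the first two strands. -/
noncomputable def pairState (ha : col a = 0) (hb : col b = 0) : EnhancedState (torusBraid p q) :=
  indicator (resOf {a, b}) _ (isClosedIn_first_strands ha hb)

/-- The two circles of `pairState` on the first two strands. -/
theorem circleOf_pair (ha : col a = 0) (hb : col b = 0) (hab : row a < row b) :
    IsClosedIn (resOf {a, b}) (tube 0 a b) ∧
    (∀ v ∈ tube 0 a b, circleOf _ (resOf {a, b}) v = circleOf _ (resOf {a, b}) (cornerB _ a)) ∧
    ∀ v : Node (torusBraid p q), v.1.val ≤ 1 → v ∉ tube 0 a b →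
      circleOf _ (resOf {a, b}) v = circleOf _ (resOf {a, b}) (cornerA _ a) := by
  have h1 : resOf {a, b} a = true := resOf_eq_true.2 (by simp)
  have h2 : resOf {a, b} b = true := resOf_eq_true.2 (by simp)
  have hlt := lt_of_row hab
  have h3 : ∀ l, l ≠ a → l ≠ b → resOf {a, b} l = false :=
    fun l h h' => resOf_eq_false.2 (by simp [h, h'])
  refine ⟨isClosedIn_tube isPositive_torusBraid ha hb h1 h2 fun l h h' _ _ => h3 l h.ne' h'.ne,
    fun v hv => circleOf_tube isPositive_torusBraid ha h1 (fun l h h' _ _ => h3 l h.ne' h'.ne) hv,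
    fun v hv hv' => circleOf_outerTube (hi := b) isPositive_torusBraid ha h1 ?_ ?_⟩
  · rintro l (h | h) _ _
    · exact h3 l h.ne (h.trans hlt).ne
    · exact h3 l (hlt.trans h).ne' h.ne'
  · simp only [tube, outerTube, Set.mem_ofPred_eq] at hv' ⊢
    omega

theorem card_circle_pair (ha : col a = 0) (hb : col b = 0) (hab : row a < row b) :
    Fintype.card (Circle _ (resOf {a, b})) = p := by
  have hlt := lt_of_row hab
  have h1 := card_circle_resOf_empty (w := torusBraid p q) isPositive_torusBraid
  have h2 := card_circle_of_merge (s := ∅) (k := b) isPositive_torusBraid (by simp)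
  have h3 := (isMerge_of_split (s := {b}) (k := a) (by simp [hlt.ne]) (Or.inr ⟨rfl, rfl⟩)
    (circleOf_pair ha hb hab).1 (x := cornerB _ a) (y := cornerA _ a) ?_ ?_).card_eq
  · rw [insert_empty_eq] at h2
    omega
  · rw [Fin.lt_def] at hlt
    simp only [tube, Set.mem_ofPred_eq, cornerB_fst_val, cornerB_snd_val]; omega
  · simp only [tube, Set.mem_ofPred_eq, cornerA_fst_val, cornerA_snd_val]; omega

theorem cornerB_fst_mem_tube (ha : col a = 0) (hab : row a < row b) : cornerB _ a ∈ tube 0 a b := by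
  have hlt := lt_of_row hab
  rw [Fin.lt_def] at hlt
  simp only [tube, Set.mem_ofPred_eq, cornerB_fst_val, cornerB_snd_val]; omega

theorem cornerA_fst_notMem_tube : cornerA _ a ∉ tube 0 a b := by
  simp only [tube, Set.mem_ofPred_eq, cornerA_fst_val, cornerA_snd_val]; omega

theorem pairState_mem_residual (ha : col a = 0) (hb : col b = 0) (hab : row a < row b)
    (hb2 : row b ≤ 2) : pairState ha hb ∈ residual p q := by
  classical
  obtain ⟨hcl, htube, hout⟩ := circleOf_pair ha hb hab
  have hlt := lt_of_row hab
  have hne := hcl.ne (cornerB_fst_mem_tube ha hab) cornerA_fst_notMem_tube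
  have hcard : ({cornerB _ a, cornerA _ a} : Finset (Node (torusBraid p q))).card = 2 :=
    Finset.card_pair fun h => hne (by rw [h])
  refine ⟨?_, ?_, by simp, by simp, ?_⟩
  · rw [level_eq (pairState ha hb) (s := {a, b}) rfl {cornerB _ a, cornerA _ a}, hcard,
      card_circle_pair ha hb hab, Finset.card_pair hlt.ne]
    · ring
    · intro u hu v hv huv
      simp only [Finset.mem_insert, Finset.mem_singleton] at hu hv
      rcases hu with rfl | rfl <;> rcases hv with rfl | rfl
      · rfl
      · exact absurd huv hne
      · exact absurd huv.symm hne
      · rfl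
    · intro v hv
      simp only [Finset.mem_insert, Finset.mem_singleton] at hv
      refine indicator_labelAt_of_mem _ ?_
      rcases hv with rfl | rfl
      · simp only [Set.mem_ofPred_eq, cornerB_fst_val]; omega
      · simp only [Set.mem_ofPred_eq, cornerA_fst_val]; omega
    · intro v hv
      have hv1 := (indicator_labelAt_eq_one _).1 hv
      by_cases hv2 : v ∈ tube 0 a b
      · exact ⟨_, by simp, htube v hv2⟩
      · exact ⟨_, by simp, hout v hv1 hv2⟩
  · intro k hk
    refine resOf_eq_false.2 fun h => hk ?_
    simp only [Finset.mem_insert, Finset.mem_singleton] at h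
    rcases h with rfl | rfl <;> omega
  · intro v hv
    refine indicator_labelAt_of_notMem _ ?_
    have := lt_of_mem_strandPoints hv
    simp only [Set.mem_ofPred_eq]; omega

end Pair

section Triple

variable {a b c : Fin (torusBraid p q).length}

/-- The three circles on the first two strands when three crossings of the first column have the
1-resolution. -/
theorem circleOf_triple (ha : col a = 0) (hb : col b = 0) (hc : col c = 0) (hab : row a < row b)
    (hbc : row b < row c) :
    (IsClosedIn (resOf {a, b, c}) (tube 0 a b) ∧ IsClosedIn (resOf {a, b, c}) (tube 0 b c)) ∧
    (∀ v ∈ tube 0 a b,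
      circleOf _ (resOf {a, b, c}) v = circleOf _ (resOf {a, b, c}) (cornerB _ a)) ∧
    (∀ v ∈ tube 0 b c,
      circleOf _ (resOf {a, b, c}) v = circleOf _ (resOf {a, b, c}) (cornerB _ b)) ∧
    ∀ v : Node (torusBraid p q), v.1.val ≤ 1 → v ∉ tube 0 a b → v ∉ tube 0 b c →
      circleOf _ (resOf {a, b, c}) v = circleOf _ (resOf {a, b, c}) (cornerA _ a) := by
  have h1 : resOf {a, b, c} a = true := resOf_eq_true.2 (by simp)
  have h2 : resOf {a, b, c} b = true := resOf_eq_true.2 (by simp)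
  have h2' : resOf {a, b, c} c = true := resOf_eq_true.2 (by simp)
  have hlt := lt_of_row hab
  have hlt' := lt_of_row hbc
  have h3 : ∀ l, l ≠ a → l ≠ b → l ≠ c → resOf {a, b, c} l = false :=
    fun l h h' h'' => resOf_eq_false.2 (by simp [h, h', h''])
  have h4 : ∀ l, a < l → l < b → col l ≤ 0 + 1 → 0 ≤ col l + 1 → resOf {a, b, c} l = false :=
    fun l h h' _ _ => h3 l h.ne' h'.ne (h'.trans hlt').ne
  have h5 : ∀ l, b < l → l < c → col l ≤ 0 + 1 → 0 ≤ col l + 1 → resOf {a, b, c} l = false :=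
    fun l h h' _ _ => h3 l (hlt.trans h).ne' h.ne' h'.ne
  refine ⟨⟨isClosedIn_tube isPositive_torusBraid ha hb h1 h2 h4,
    isClosedIn_tube isPositive_torusBraid hb hc h2 h2' h5⟩,
    fun v hv => circleOf_tube isPositive_torusBraid ha h1 h4 hv,
    fun v hv => circleOf_tube isPositive_torusBraid hb h2 h5 hv,
    fun v hv hv' hv'' => circleOf_outerTube (hi := c) isPositive_torusBraid ha h1 ?_ ?_⟩
  · rintro l (h | h) _ _
    · exact h3 l h.ne (h.trans hlt).ne (h.trans (hlt.trans hlt')).ne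
    · exact h3 l ((hlt.trans hlt').trans h).ne' (hlt'.trans h).ne' h.ne'
  · simp only [tube, outerTube, Set.mem_ofPred_eq] at hv' hv'' ⊢
    omega

theorem card_circle_triple (ha : col a = 0) (hb : col b = 0) (hc : col c = 0)
    (hab : row a < row b) (hbc : row b < row c) :
    Fintype.card (Circle _ (resOf {a, b, c})) = p + 1 := by
  have hlt := lt_of_row hab
  have hlt' := lt_of_row hbc
  rw [(isMerge_of_split (s := {b, c}) (k := a) (by simp [hlt.ne, (hlt.trans hlt').ne])
    (Or.inr ⟨rfl, rfl⟩)
    (circleOf_triple ha hb hc hab hbc).1.1 (x := cornerB _ a) (y := cornerA _ a)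
    (cornerB_fst_mem_tube ha hab) cornerA_fst_notMem_tube).card_eq, card_circle_pair hb hc hbc]

/-- In the residual complex, exactly one of these three circles is labelled `X`. -/
theorem labels_of_triple (ha : col a = 0) (hb : col b = 0) (hc : col c = 0)
    (hab : row a < row b) (hbc : row b < row c) (hq : 0 < q) {T : EnhancedState (torusBraid p q)}
    (hT : T ∈ residual p q) (hres : T.res = resOf {a, b, c}) :
    (T.labelAt (cornerB _ a) = .X ∧ T.labelAt (cornerB _ b) = .one ∧
      T.labelAt (cornerA _ a) = .one) ∨
    (T.labelAt (cornerB _ a) = .one ∧ T.labelAt (cornerB _ b) = .X ∧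
      T.labelAt (cornerA _ a) = .one) ∨
    (T.labelAt (cornerB _ a) = .one ∧ T.labelAt (cornerB _ b) = .one ∧
      T.labelAt (cornerA _ a) = .X) := by
  classical
  obtain ⟨⟨hclA, hclB⟩, hA, hB, hO⟩ := circleOf_triple ha hb hc hab hbc
  have hlt := lt_of_row hab
  have hlt' := lt_of_row hbc
  have hlt1 := Fin.lt_def.1 hlt
  have h1 : circleOf _ T.res (cornerB _ a) ≠ circleOf _ T.res (cornerA _ a) := by
    rw [hres]; exact hclA.ne (cornerB_fst_mem_tube ha hab) cornerA_fst_notMem_tube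
  have h2 : circleOf _ T.res (cornerB _ a) ≠ circleOf _ T.res (cornerB _ b) := by
    rw [hres]; refine hclA.ne (cornerB_fst_mem_tube ha hab) ?_
    simp only [tube, Set.mem_ofPred_eq, cornerB_fst_val, cornerB_snd_val]; omega
  have h3 : circleOf _ T.res (cornerB _ b) ≠ circleOf _ T.res (cornerA _ a) := by
    rw [hres]; refine hclB.ne (cornerB_fst_mem_tube hb hbc) ?_
    simp only [tube, Set.mem_ofPred_eq, cornerA_fst_val, cornerA_snd_val]; omega
  have hall : ∀ v, T.labelAt v = .one → circleOf _ T.res v = circleOf _ T.res (cornerB _ a) ∨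
      circleOf _ T.res v = circleOf _ T.res (cornerB _ b) ∨
      circleOf _ T.res v = circleOf _ T.res (cornerA _ a) := by
    intro v hv
    have hv1 : v.1.val ≤ 1 := by
      by_contra h
      rw [labelAt_of_mem_residual hT (by omega) hq] at hv
      simp at hv
    rw [hres]
    by_cases h4 : v ∈ tube 0 a b
    · exact Or.inl (hA v h4)
    by_cases h5 : v ∈ tube 0 b c
    · exact Or.inr (Or.inl (hB v h5))
    · exact Or.inr (Or.inr (hO v hv1 h4 h5))
  set L : Finset (Node (torusBraid p q)) := {cornerB _ a, cornerB _ b, cornerA _ a} with hLdef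
  have hlevel := level_eq T hres (L.filter fun v => T.labelAt v = .one) (by
      intro u hu v hv huv
      simp only [hLdef, Finset.mem_filter, Finset.mem_insert, Finset.mem_singleton] at hu hv
      rcases hu.1 with rfl | rfl | rfl <;> rcases hv.1 with rfl | rfl | rfl <;>
        first
          | rfl
          | exact absurd huv h1
          | exact absurd huv h2
          | exact absurd huv h3
          | exact absurd huv.symm h1
          | exact absurd huv.symm h2
          | exact absurd huv.symm h3)
    (fun v hv => (Finset.mem_filter.1 hv).2) (by
      intro v hv
      rcases hall v hv with h | h | h
      · exact ⟨_, by simp [hLdef, ← T.labelAt_eq h, hv], h⟩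
      · exact ⟨_, by simp [hLdef, ← T.labelAt_eq h, hv], h⟩
      · exact ⟨_, by simp [hLdef, ← T.labelAt_eq h, hv], h⟩)
  have hcard3 : ({a, b, c} : Finset (Fin (torusBraid p q).length)).card = 3 := by
    rw [Finset.card_insert_of_notMem (by simp [hlt.ne, (hlt.trans hlt').ne]),
      Finset.card_pair hlt'.ne]
  rw [hT.1, card_circle_triple ha hb hc hab hbc, hcard3, Finset.card_filter, hLdef,
    Finset.sum_insert (by
      simp only [Finset.mem_insert, Finset.mem_singleton, not_or]
      exact ⟨fun h => h2 (by rw [h]), fun h => h1 (by rw [h])⟩),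
    Finset.sum_pair (fun h => h3 (by rw [h]))] at hlevel
  cases hx : T.labelAt (cornerB _ a) <;> cases hy : T.labelAt (cornerB _ b) <;>
    cases hz : T.labelAt (cornerA _ a) <;> simp [hx, hy, hz] at hlevel ⊢ <;> omega

theorem eq_of_labels (ha : col a = 0) (hb : col b = 0) (hc : col c = 0)
    (hab : row a < row b) (hbc : row b < row c) (hq : 0 < q)
    {T T' : EnhancedState (torusBraid p q)} (hT : T ∈ residual p q) (hT' : T' ∈ residual p q)
    (hres : T.res = resOf {a, b, c}) (hres' : T'.res = resOf {a, b, c})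
    (h1 : T.labelAt (cornerB _ a) = T'.labelAt (cornerB _ a))
    (h2 : T.labelAt (cornerB _ b) = T'.labelAt (cornerB _ b))
    (h3 : T.labelAt (cornerA _ a) = T'.labelAt (cornerA _ a)) : T = T' := by
  obtain ⟨-, hA, hB, hO⟩ := circleOf_triple ha hb hc hab hbc
  refine ext_labelAt (hres.trans hres'.symm) fun v => ?_
  have key : ∀ u, circleOf _ (resOf {a, b, c}) v = circleOf _ (resOf {a, b, c}) u →
      T.labelAt u = T'.labelAt u → T.labelAt v = T'.labelAt v := by
    intro u huv hu
    rw [T.labelAt_eq (hres ▸ huv), T'.labelAt_eq (hres' ▸ huv), hu]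
  by_cases hv : v.1.val ≤ 1
  · by_cases h4 : v ∈ tube 0 a b
    · exact key _ (hA v h4) h1
    by_cases h5 : v ∈ tube 0 b c
    · exact key _ (hB v h5) h2
    · exact key _ (hO v hv h4 h5) h3
  · rw [labelAt_of_mem_residual hT (by omega) hq, labelAt_of_mem_residual hT' (by omega) hq]

/-- The differentials of the three states `pairState`. -/
theorem diffCoeff_pairState (ha : col a = 0) (hb : col b = 0) (hc : col c = 0)
    (hab : row a < row b) (hbc : row b < row c) (hq : 0 < q) {T : EnhancedState (torusBraid p q)}
    (hT : T ∈ residual p q) (hres : T.res = resOf {a, b, c}) :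
    diffCoeff (pairState ha hb) T = (if T.labelAt (cornerB _ a) = .one then 1 else 0) ∧
    diffCoeff (pairState hb hc) T = (if T.labelAt (cornerB _ b) = .one then 1 else 0) ∧
    diffCoeff (pairState ha hc) T = -(if T.labelAt (cornerA _ a) = .one then 1 else 0) := by
  have hlab := labels_of_triple ha hb hc hab hbc hq hT hres
  obtain ⟨⟨hclA, hclB⟩, hA, hB, hO⟩ := circleOf_triple ha hb hc hab hbc
  have hlt := lt_of_row hab
  have hlt' := lt_of_row hbc
  have hlt1 := Fin.lt_def.1 hlt
  have hlt1' := Fin.lt_def.1 hlt'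
  have hac := hab.trans hbc
  have hX : ∀ v : Node (torusBraid p q), ¬ v.1.val ≤ 1 → T.labelAt v = .X :=
    fun v hv => labelAt_of_mem_residual hT (by omega) hq
  have hT1 : ∀ u v, circleOf _ (resOf {a, b, c}) u = circleOf _ (resOf {a, b, c}) v →
    T.labelAt u = T.labelAt v := fun u v h => T.labelAt_eq (by rw [hres]; exact h)
  have e1 : T.labelAt (cornerA _ c) = T.labelAt (cornerB _ b) := hT1 _ _ (hB _ (by
    simp only [tube, Set.mem_ofPred_eq, cornerA_fst_val, cornerA_snd_val]; omega))
  have e2 : T.labelAt (cornerB _ c) = T.labelAt (cornerA _ a) := hT1 _ _ (hO _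
    (by simp only [cornerB_fst_val]; omega)
    (by simp only [tube, Set.mem_ofPred_eq, cornerB_fst_val, cornerB_snd_val]; omega)
    (by simp only [tube, Set.mem_ofPred_eq, cornerB_fst_val, cornerB_snd_val]; omega))
  have e3 : T.labelAt (cornerA _ b) = T.labelAt (cornerB _ a) := hT1 _ _ (hA _ (by
    simp only [tube, Set.mem_ofPred_eq, cornerA_fst_val, cornerA_snd_val]; omega))
  refine ⟨?_, ?_, ?_⟩
  · obtain ⟨hcl, htube, hout⟩ := circleOf_pair ha hb hab
    have hset : ({a, b, c} : Finset (Fin (torusBraid p q).length)) = insert c {a, b} := by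
      ext; simp; tauto
    have hnot : c ∉ ({a, b} : Finset (Fin (torusBraid p q).length)) := by
      simp [hlt'.ne', (hlt.trans hlt').ne']
    have hm : IsMerge T.res (resOf {a, b}) c := by
      rw [hres, hset]
      refine isMerge_of_split hnot (Or.inl ⟨rfl, rfl⟩) (hset ▸ hclB) ?_ ?_ <;>
        simp only [tube, Set.mem_ofPred_eq, cornerA_fst_val, cornerA_snd_val, cornerB_fst_val,
          cornerB_snd_val] <;> omega
    rw [diffCoeff_eq_edgeCoeff (k := c) (resOf_eq_false.2 hnot)
      (by rw [hres]; exact resOf_eq_true.2 (by simp)),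
      edgeCoeff_of_split (u := cornerB _ a) (resOf_eq_false.2 hnot)
        (by rw [hres, hset, resOf_insert]; rfl) hm]
    · have hs : edgeSign (pairState ha hb).res c = 1 := by
        change edgeSign (resOf {a, b}) c = 1
        rw [edgeSign_resOf, Finset.filter_true_of_mem (by simp [hlt.trans hlt', hlt']),
          Finset.card_pair hlt.ne]; norm_num
      rw [hs, e1, e2]
      rcases hlab with ⟨h1, h2, h3⟩ | ⟨h1, h2, h3⟩ | ⟨h1, h2, h3⟩ <;>
        simp [h1, h2, h3, comulCoeff]
    · exact indicator_labelAt_of_mem _ (by simp only [Set.mem_ofPred_eq, cornerA_fst_val]; omega)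
    · refine hcl.ne (cornerB_fst_mem_tube ha hab) ?_
      simp only [tube, Set.mem_ofPred_eq, cornerA_fst_val, cornerA_snd_val]; omega
    · exact indicator_labelAt_of_mem _ (by simp only [Set.mem_ofPred_eq, cornerB_fst_val]; omega)
    · intro v hv
      by_cases hv1 : v.1.val ≤ 1
      · refine Or.inr ⟨indicator_labelAt_of_mem _ hv1, hT1 _ _ (hA v ?_)⟩
        by_contra hv2
        refine hv ((hout v hv1 hv2).trans (hout _ ?_ ?_).symm) <;>
          simp only [tube, Set.mem_ofPred_eq, cornerA_fst_val, cornerA_snd_val] <;> omega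
      · exact Or.inl ((hX v hv1).trans (indicator_labelAt_of_notMem _ hv1).symm)
  · obtain ⟨hcl, htube, hout⟩ := circleOf_pair hb hc hbc
    have hnot : a ∉ ({b, c} : Finset (Fin (torusBraid p q).length)) := by
      simp [hlt.ne, (hlt.trans hlt').ne]
    have hm : IsMerge T.res (resOf {b, c}) a := by
      rw [hres]
      exact isMerge_of_split hnot (Or.inr ⟨rfl, rfl⟩) hclA (cornerB_fst_mem_tube ha hab)
        cornerA_fst_notMem_tube
    have hAnot : cornerA _ a ∉ tube 0 b c := by
      simp only [tube, Set.mem_ofPred_eq, cornerA_fst_val, cornerA_snd_val]; omega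
    rw [diffCoeff_eq_edgeCoeff (k := a) (resOf_eq_false.2 hnot)
      (by rw [hres]; exact resOf_eq_true.2 (by simp)),
      edgeCoeff_of_split (u := cornerB _ b) (resOf_eq_false.2 hnot)
        (by rw [hres, resOf_insert]; rfl) hm]
    · have hs : edgeSign (pairState hb hc).res a = 1 := by
        change edgeSign (resOf {b, c}) a = 1
        rw [edgeSign_resOf, Finset.filter_false_of_mem (by
          simp [hlt.le, (hlt.trans hlt').le])]; rfl
      rw [hs]
      rcases hlab with ⟨h1, h2, h3⟩ | ⟨h1, h2, h3⟩ | ⟨h1, h2, h3⟩ <;>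
        simp [h1, h2, h3, comulCoeff]
    · exact indicator_labelAt_of_mem _ (by simp only [Set.mem_ofPred_eq, cornerA_fst_val]; omega)
    · exact hcl.ne (cornerB_fst_mem_tube hb hbc) hAnot
    · exact indicator_labelAt_of_mem _ (by simp only [Set.mem_ofPred_eq, cornerB_fst_val]; omega)
    · intro v hv
      by_cases hv1 : v.1.val ≤ 1
      · refine Or.inr ⟨indicator_labelAt_of_mem _ hv1, hT1 _ _ (hB v ?_)⟩
        by_contra hv2
        exact hv ((hout v hv1 hv2).trans (hout _ (by simp only [cornerA_fst_val]; omega)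
          hAnot).symm)
      · exact Or.inl ((hX v hv1).trans (indicator_labelAt_of_notMem _ hv1).symm)
  · obtain ⟨hcl, htube, hout⟩ := circleOf_pair ha hc hac
    have hset : ({a, b, c} : Finset (Fin (torusBraid p q).length)) = insert b {a, c} := by
      ext; simp; tauto
    have hnot : b ∉ ({a, c} : Finset (Fin (torusBraid p q).length)) := by
      simp [hlt.ne', hlt'.ne]
    have hm : IsMerge T.res (resOf {a, c}) b := by
      rw [hres, hset]
      refine isMerge_of_split hnot (Or.inl ⟨rfl, rfl⟩) (hset ▸ hclA) ?_ ?_ <;>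
        simp only [tube, Set.mem_ofPred_eq, cornerA_fst_val, cornerA_snd_val, cornerB_fst_val,
          cornerB_snd_val] <;> omega
    have hAmem : cornerA _ b ∈ tube 0 a c := by
      simp only [tube, Set.mem_ofPred_eq, cornerA_fst_val, cornerA_snd_val]; omega
    rw [diffCoeff_eq_edgeCoeff (k := b) (resOf_eq_false.2 hnot)
      (by rw [hres]; exact resOf_eq_true.2 (by simp)),
      edgeCoeff_of_split (u := cornerA _ a) (resOf_eq_false.2 hnot)
        (by rw [hres, hset, resOf_insert]; rfl) hm]
    · have hs : edgeSign (pairState ha hc).res b = -1 := by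
        change edgeSign (resOf {a, c}) b = -1
        rw [edgeSign_resOf, Finset.filter_insert, if_pos hlt,
          Finset.filter_false_of_mem (by simp [hlt'.le])]; simp
      rw [hs, e3]
      rcases hlab with ⟨h1, h2, h3⟩ | ⟨h1, h2, h3⟩ | ⟨h1, h2, h3⟩ <;>
        simp [h1, h2, h3, comulCoeff]
    · exact indicator_labelAt_of_mem _ (by simp only [Set.mem_ofPred_eq, cornerA_fst_val]; omega)
    · exact (hcl.ne hAmem cornerA_fst_notMem_tube).symm
    · exact indicator_labelAt_of_mem _ (by simp only [Set.mem_ofPred_eq, cornerA_fst_val]; omega)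
    · intro v hv
      by_cases hv1 : v.1.val ≤ 1
      · have hv2 : v ∉ tube 0 a c := fun h => hv ((htube v h).trans (htube _ hAmem).symm)
        refine Or.inr ⟨indicator_labelAt_of_mem _ hv1, hT1 _ _ (hO v hv1 ?_ ?_)⟩ <;>
          simp only [tube, Set.mem_ofPred_eq] at hv2 ⊢ <;> omega
      · exact Or.inl ((hX v hv1).trans (indicator_labelAt_of_notMem _ hv1).symm)

end Triple

end Residual

end Khovanov

namespace Khovanov

open EnhancedState

/-! ### The homology of the residual complex in degree `3` -/

section Residual

variable {p q : ℕ}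

theorem nNeg_torusBraid : nNeg (torusBraid p q) = 0 := by
  unfold nNeg
  rw [List.countP_eq_zero]
  intro l hl
  obtain ⟨k, hk, rfl⟩ := List.getElem_of_mem hl
  simp [(getElem_torusBraid k hk).2]

theorem nPos_torusBraid : nPos (torusBraid p q) = q * (p - 1) := by
  rw [← length_torusBraid (p := p) (q := q)]
  unfold nPos
  rw [List.countP_eq_length]
  intro l hl
  obtain ⟨k, hk, rfl⟩ := List.getElem_of_mem hl
  exact (getElem_torusBraid k hk).2

theorem hDeg_eq (S : EnhancedState (torusBraid p q)) : S.hDeg = ones S.res := by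
  unfold hDeg
  rw [nNeg_torusBraid]
  simp [weight, ones]

theorem qDeg_eq_level (S : EnhancedState (torusBraid p q)) :
    S.qDeg = level S + (q * (p - 1) : ℕ) - p := by
  rw [qDeg_eq, nNeg_torusBraid, nPos_torusBraid]
  unfold level
  push_cast; ring

/-- Twice every element in degree `3` of the residual complex is a boundary: this is the torsion in
the homology of the trefoil. -/
theorem residual_surjective (hp : 3 ≤ p) (hq : 3 ≤ q) (y : EnhancedState (torusBraid p q) → ℤ) :
    ∃ x : EnhancedState (torusBraid p q) → ℤ,
      (∀ S, x S ≠ 0 → S ∈ residual p q ∧ S.hDeg = 4 - 2) ∧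
      ∀ T ∈ residual p q, T.hDeg = 4 - 1 → applyMatrix diffCoeff x T = 2 * y T := by
  classical
  obtain ⟨a, har, hac⟩ : ∃ a : Fin (torusBraid p q).length, row a = 0 ∧ col a = 0 :=
    ⟨cr 0 0 (by omega) (by omega), by simp, by simp⟩
  obtain ⟨b, hbr, hbc⟩ : ∃ a : Fin (torusBraid p q).length, row a = 1 ∧ col a = 0 :=
    ⟨cr 1 0 (by omega) (by omega), by simp, by simp⟩
  obtain ⟨c, hcr, hcc⟩ : ∃ a : Fin (torusBraid p q).length, row a = 2 ∧ col a = 0 :=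
    ⟨cr 2 0 (by omega) (by omega), by simp, by simp⟩
  have hab : row a < row b := by omega
  have hbc' : row b < row c := by omega
  have hac' : row a < row c := by omega
  have hres : ∀ T ∈ residual p q, T.hDeg = 4 - 1 → T.res = resOf {a, b, c} := by
    intro T hT hT3
    refine eq_resOf (fun k hk => ?_) ?_
    · have h : col k = 0 ∧ row k ≤ 2 := by
        by_contra h
        have := hT.2.1 k h
        rw [hk] at this; simp at this
      simp only [Finset.mem_insert, Finset.mem_singleton]
      have h3 : row k = 0 ∨ row k = 1 ∨ row k = 2 := by omega
      rcases h3 with h3 | h3 | h3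
      · exact Or.inl (crossing_ext (by omega) (by omega))
      · exact Or.inr (Or.inl (crossing_ext (by omega) (by omega)))
      · exact Or.inr (Or.inr (crossing_ext (by omega) (by omega)))
    · rw [hDeg_eq] at hT3
      rw [Finset.card_insert_of_notMem (by
        simp [(lt_of_row hab).ne, (lt_of_row hac').ne]), Finset.card_pair (lt_of_row hbc').ne]
      omega
  have hval : ∀ g₁ g₂ g₃ : Gen, ∃ u : ℤ, ∀ T ∈ residual p q, T.hDeg = 4 - 1 →
      T.labelAt (cornerB _ a) = g₁ → T.labelAt (cornerB _ b) = g₂ →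
      T.labelAt (cornerA _ a) = g₃ → y T = u := by
    intro g₁ g₂ g₃
    by_cases h : ∃ T ∈ residual p q, T.hDeg = 4 - 1 ∧ T.labelAt (cornerB _ a) = g₁ ∧
      T.labelAt (cornerB _ b) = g₂ ∧ T.labelAt (cornerA _ a) = g₃
    · obtain ⟨T, hT, hT3, h1, h2, h3⟩ := h
      refine ⟨y T, fun T' hT' hT3' h1' h2' h3' => ?_⟩
      rw [eq_of_labels hac hbc hcc hab hbc' (by omega) hT' hT (hres _ hT' hT3') (hres _ hT hT3)
        (h1'.trans h1.symm) (h2'.trans h2.symm) (h3'.trans h3.symm)]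
    · exact ⟨0, fun T hT hT3 h1 h2 h3 => absurd ⟨T, hT, hT3, h1, h2, h3⟩ h⟩
  obtain ⟨uA, hA⟩ := hval .X .one .one
  obtain ⟨uB, hB⟩ := hval .one .X .one
  obtain ⟨uO, hO⟩ := hval .one .one .X
  refine ⟨fun S => (if S = pairState hac hbc then uB + uO - uA else 0) +
    (if S = pairState hbc hcc then uA + uO - uB else 0) +
    (if S = pairState hac hcc then uO - uA - uB else 0), fun S hS => ?_, fun T hT hT3 => ?_⟩
  · have hdeg : ∀ {k l : Fin (torusBraid p q).length} (hk : col k = 0) (hl : col l = 0),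
        row k < row l → (pairState hk hl).hDeg = 4 - 2 := by
      intro k l hk hl hkl
      rw [hDeg_eq]
      change (ones (resOf {k, l}) : ℤ) = _
      rw [ones_resOf, Finset.card_pair (lt_of_row hkl).ne]; norm_num
    by_cases h1 : S = pairState hac hbc
    · rw [h1]; exact ⟨pairState_mem_residual hac hbc hab (by omega), hdeg _ _ hab⟩
    by_cases h2 : S = pairState hbc hcc
    · rw [h2]; exact ⟨pairState_mem_residual hbc hcc hbc' (by omega), hdeg _ _ hbc'⟩
    by_cases h3 : S = pairState hac hcc
    · rw [h3]; exact ⟨pairState_mem_residual hac hcc hac' (by omega), hdeg _ _ hac'⟩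
    · simp [h1, h2, h3] at hS
  · have hsum : applyMatrix diffCoeff (fun S => (if S = pairState hac hbc then uB + uO - uA else 0) +
        (if S = pairState hbc hcc then uA + uO - uB else 0) +
        (if S = pairState hac hcc then uO - uA - uB else 0)) T =
        diffCoeff (pairState hac hbc) T * (uB + uO - uA) +
        diffCoeff (pairState hbc hcc) T * (uA + uO - uB) +
        diffCoeff (pairState hac hcc) T * (uO - uA - uB) := by
      simp [applyMatrix, mul_add, Finset.sum_add_distrib]
    rw [hsum]
    obtain ⟨h1, h2, h3⟩ := diffCoeff_pairState hac hbc hcc hab hbc' (by omega) hT (hres T hT hT3)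
    rw [h1, h2, h3]
    rcases labels_of_triple hac hbc hcc hab hbc' (by omega) hT (hres T hT hT3) with h | h | h <;>
      obtain ⟨g1, g2, g3⟩ := h
    · rw [hA T hT hT3 g1 g2 g3]; simp [g1, g2, g3]; ring
    · rw [hB T hT hT3 g1 g2 g3]; simp [g1, g2, g3]; ring
    · rw [hO T hT hT3 g1 g2 g3]; simp [g1, g2, g3]; ring

/-- The residual complex is a quotient complex. -/
theorem mem_residual_of_diffCoeff {S T : EnhancedState (torusBraid p q)} (hT : T ∈ residual p q)
    (h : diffCoeff S T ≠ 0) : S ∈ residual p q := by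
  have hlevel : level S = 6 := by
    obtain ⟨k, hk⟩ := exists_edgeCoeff_ne_zero h
    rw [← level_of_edgeCoeff_ne_zero hk]; exact hT.1
  have hres : ∀ k : Fin (torusBraid p q).length, ¬ (col k = 0 ∧ row k ≤ 2) → S.res k = false := by
    intro k hk
    by_contra h'
    exact h (diffCoeff_eq_zero_of_res (by simpa using h') (hT.2.1 k hk))
  refine ⟨hlevel, hres, by simp, by simp, fun v hv => ?_⟩
  have hv1 := lt_of_mem_strandPoints hv
  by_contra h'
  refine h (diffCoeff_eq_zero_of_label (Z := {k | ¬ (col k = 0 ∧ row k ≤ 2)}) (I := ∅) (L₁ := ∅)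
    (LX := ∅) (O := {u | u.1.val = v.1.val}) (x := v) ⟨hlevel, hres, by simp, by simp, by simp⟩
    ⟨hT.1, hT.2.1, by simp, by simp, by simp⟩
    (isClosedIn_strand isPositive_torusBraid fun l h1 h2 => hres l (by omega)) ?_ rfl ?_)
  · intro l hl _
    simp only [Set.mem_ofPred_eq, cornerA_fst_val, cornerB_fst_val] at hl ⊢
    right; omega
  · rw [hT.2.2.2.2 v hv]; exact h'

end Residual

/-! ### The critical state and the homology in degree `4` -/

section Critical

variable {p q : ℕ}

theorem labelAt_of_mem_critical (hp : 3 ≤ p) (hq : 3 ≤ q) {S : EnhancedState (torusBraid p q)}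
    (hS : S ∈ critical hp hq) (v : Node (torusBraid p q)) : S.labelAt v = .one ↔
      v ∈ tube 0 (cr 1 0 (by omega) (by omega)) (cr 2 0 (by omega) (by omega)) := by
  classical
  have h1 : S.res (cr 1 0 (by omega) (by omega)) = true := hS.2.2.1 _ (by simp [criticalOnes])
  have h2 : S.res (cr 2 0 (by omega) (by omega)) = true := hS.2.2.1 _ (by simp [criticalOnes])
  have h3 : S.res (cr 2 1 (by omega) (by omega)) = true := hS.2.2.1 _ (by simp [criticalOnes])
  obtain ⟨hcl, hcirc⟩ := isClosedIn_tube_of_rows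
    (b := cr 1 0 (by omega) (by omega)) (k := cr 2 0 (by omega) (by omega)) (by simp) (by simp)
    h1 h2 (by simp) (fun l hl hl' => hS.2.1 l (by
      simp only [row_cr, col_cr] at hl hl'
      simp only [criticalOnes, Set.mem_compl_iff, Set.mem_ofPred_eq]; omega))
  have hmem := cornerB_mem_tube (p := p) (q := q) (b := cr 1 0 (by omega) (by omega))
    (k := cr 2 0 (by omega) (by omega)) (by simp) (by simp)
  have hone := hS.2.2.2.1 _ (Set.mem_insert _ _)
  rw [col_cr] at hcl hcirc hmem
  constructor
  · intro hv
    by_contra hv'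
    have hne := hcl.ne hmem hv'
    have := le_level isPositive_torusBraid S (Finset.range 2) (fun c hc => by
        rw [Finset.mem_range] at hc
        interval_cases c
        · exact ⟨_, by simp, h2⟩
        · exact ⟨_, by simp, h3⟩)
      {cornerB _ (cr 1 0 (by omega) (by omega)), v} (by
        intro u hu u' hu' huu
        simp only [Finset.mem_insert, Finset.mem_singleton] at hu hu'
        rcases hu with rfl | rfl <;> rcases hu' with rfl | rfl
        · rfl
        · exact absurd huu hne
        · exact absurd huu.symm hne
        · rfl) (by
        intro u hu
        simp only [Finset.mem_insert, Finset.mem_singleton] at hu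
        rcases hu with rfl | rfl
        · exact hone
        · exact hv)
    rw [hS.1, Finset.card_pair (fun h => hne (by rw [h]))] at this
    simp at this
  · intro hv
    rw [S.labelAt_eq (hcirc v hv), hone]

/-- The labels of the critical state are determined by the level: with 1-resolutions in two columns,
only one circle can be labelled `1`. -/
theorem exists_critical (hp : 3 ≤ p) (hq : 3 ≤ q) : ∃ S, critical hp hq = {S} := by
  classical
  obtain ⟨a, har, hac⟩ : ∃ a : Fin (torusBraid p q).length, row a = 0 ∧ col a = 1 :=
    ⟨cr 0 1 (by omega) (by omega), by simp, by simp⟩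
  set b : Fin (torusBraid p q).length := cr 1 0 (by omega) (by omega) with hb
  set c : Fin (torusBraid p q).length := cr 2 0 (by omega) (by omega) with hc
  obtain ⟨d, hdr, hdc⟩ : ∃ a : Fin (torusBraid p q).length, row a = 2 ∧ col a = 1 :=
    ⟨cr 2 1 (by omega) (by omega), by simp, by simp⟩
  have hbr : row b = 1 := by simp [hb]
  have hbc : col b = 0 := by simp [hb]
  have hcr : row c = 2 := by simp [hc]
  have hcc : col c = 0 := by simp [hc]
  have hlt : a < b ∧ b < c ∧ c < d := by
    simp only [Fin.lt_def, val_lt_iff]; omega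
  have hab := Fin.lt_def.1 hlt.1
  have hbc' := Fin.lt_def.1 hlt.2.1
  have hcd := Fin.lt_def.1 hlt.2.2
  have nb : b ∉ ({c, d} : Finset (Fin (torusBraid p q).length)) := by
    simp [hlt.2.1.ne, (hlt.2.1.trans hlt.2.2).ne]
  have na : a ∉ ({b, c, d} : Finset (Fin (torusBraid p q).length)) := by
    simp [hlt.1.ne, (hlt.1.trans hlt.2.1).ne, (hlt.1.trans (hlt.2.1.trans hlt.2.2)).ne]
  have hclT : ∀ s : Finset (Fin (torusBraid p q).length), b ∈ s → c ∈ s →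
      (∀ l ∈ s, l = a ∨ l = b ∨ l = c ∨ l = d) → IsClosedIn (resOf s) (tube 0 b c) := by
    intro s hbs hcs hs
    refine isClosedIn_tube isPositive_torusBraid hbc hcc (resOf_eq_true.2 hbs)
      (resOf_eq_true.2 hcs) fun l h1 h2 _ _ => resOf_eq_false.2 fun hl => ?_
    rw [Fin.lt_def] at h1 h2
    rcases hs l hl with rfl | rfl | rfl | rfl <;> omega
  have hmemT : cornerB _ b ∈ tube 0 b c := by
    simp only [tube, Set.mem_ofPred_eq, cornerB_fst_val, cornerB_snd_val]; omega
  have hcard : Fintype.card (Circle _ (resOf {a, b, c, d})) = p := by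
    have h0 := card_circle_resOf_empty (w := torusBraid p q) isPositive_torusBraid
    have h1 := card_circle_of_merge (s := ∅) (k := d) isPositive_torusBraid (by simp)
    have h2 := card_circle_of_merge (s := {d}) (k := c) isPositive_torusBraid (by
      intro l hl; rw [Finset.mem_singleton.1 hl]; omega)
    have h3 := (isMerge_of_split nb (Or.inr ⟨rfl, rfl⟩)
      (hclT {b, c, d} (by simp) (by simp) (by simp)) hmemT (by
        simp only [tube, Set.mem_ofPred_eq, cornerA_fst_val, cornerA_snd_val]; omega)).card_eq
    have h4 := (isMerge_of_split na (Or.inl ⟨rfl, rfl⟩) (O := outerTube 1 a d) ?_ ?_ ?_).card_eq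
    · rw [insert_empty_eq] at h1
      omega
    · refine isClosedIn_outerTube isPositive_torusBraid
        (hlt.1.trans (hlt.2.1.trans hlt.2.2)).le hac hdc (resOf_eq_true.2 (by simp))
        (resOf_eq_true.2 (by simp)) fun l h _ _ => resOf_eq_false.2 fun hl => ?_
      rw [Fin.lt_def, Fin.lt_def] at h
      simp only [Finset.mem_insert, Finset.mem_singleton] at hl
      rcases hl with rfl | rfl | rfl | rfl <;> omega
    · simp only [outerTube, Set.mem_ofPred_eq, cornerA_fst_val, cornerA_snd_val]; omega
    · simp only [outerTube, Set.mem_ofPred_eq, cornerB_fst_val, cornerB_snd_val]; omega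
  have hcl := hclT {a, b, c, d} (by simp) (by simp) (by simp)
  have hmem : ∀ k, k ∈ criticalOnes p q ↔ k ∈ ({a, b, c, d} : Finset _) := by
    intro k
    have h : ∀ l, k = l ↔ row k = row l ∧ col k = col l :=
      fun l => ⟨fun h => by rw [h]; simp, fun h => crossing_ext h.1 h.2⟩
    simp only [criticalOnes, Set.mem_ofPred_eq, Finset.mem_insert, Finset.mem_singleton, h]
    omega
  have hS : indicator (resOf {a, b, c, d}) _ hcl ∈ critical hp hq := by
    refine ⟨?_, ?_, ?_, ?_, ?_⟩
    · rw [level_eq _ (s := {a, b, c, d}) rfl {cornerB _ b}, hcard,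
        Finset.card_insert_of_notMem na, Finset.card_insert_of_notMem nb,
        Finset.card_pair hlt.2.2.ne, Finset.card_singleton]
      · ring
      · simp
      · intro v hv
        rw [Finset.mem_singleton.1 hv]
        exact indicator_labelAt_of_mem hcl hmemT
      · intro v hv
        refine ⟨_, Finset.mem_singleton_self _, ?_⟩
        refine circleOf_tube (lo := b) (hi := c) isPositive_torusBraid hbc
          (resOf_eq_true.2 (Finset.mem_insert_of_mem (Finset.mem_insert_self b _))) ?_
          ((indicator_labelAt_eq_one hcl).1 hv)
        intro l h1 h2 _ _
        refine resOf_eq_false.2 fun hl => ?_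
        rw [Fin.lt_def] at h1 h2
        simp only [Finset.mem_insert, Finset.mem_singleton] at hl
        rcases hl with rfl | rfl | rfl | rfl <;> omega
    · intro k hk
      exact resOf_eq_false.2 fun h => hk ((hmem k).2 h)
    · intro k hk
      exact resOf_eq_true.2 ((hmem k).1 hk)
    · intro v hv
      rcases hv with rfl | hv
      · exact indicator_labelAt_of_mem hcl hmemT
      · exact absurd hv (Set.notMem_empty v)
    · intro v hv
      have := lt_of_mem_strandPoints hv
      refine indicator_labelAt_of_notMem hcl ?_
      simp only [tube, Set.mem_ofPred_eq]; omega
  refine ⟨_, Set.eq_singleton_iff_unique_mem.2 ⟨hS, fun T hT => ext_labelAt ?_ fun v => ?_⟩⟩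
  · funext k
    by_cases hk : k ∈ criticalOnes p q
    · rw [hT.2.2.1 k hk, hS.2.2.1 k hk]
    · rw [hT.2.1 k hk, hS.2.1 k hk]
  · have h1 := labelAt_of_mem_critical hp hq hT v
    have h2 := labelAt_of_mem_critical hp hq hS v
    generalize T.labelAt v = x at h1
    generalize (indicator (resOf {a, b, c, d}) (tube 0 b c) hcl).labelAt v = y at h2
    rw [← h2] at h1
    cases x <;> cases y <;> simp_all

theorem hDeg_of_mem_critical (hp : 3 ≤ p) (hq : 3 ≤ q) {S : EnhancedState (torusBraid p q)}
    (hS : S ∈ critical hp hq) :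
    S.hDeg = 4 := by
  classical
  have h : S.res = resOf {cr 0 1 (by omega) (by omega), cr 1 0 (by omega) (by omega),
      cr 2 0 (by omega) (by omega), cr 2 1 (by omega) (by omega)} := by
    funext k
    have h1 : k ∈ criticalOnes p q ↔ k ∈ ({cr 0 1 (by omega) (by omega),
      cr 1 0 (by omega) (by omega), cr 2 0 (by omega) (by omega),
      cr 2 1 (by omega) (by omega)} : Finset (Fin (torusBraid p q).length)) := by
      simp only [criticalOnes, Set.mem_ofPred_eq, Finset.mem_insert, Finset.mem_singleton,
        eq_cr_iff]
      omega
    by_cases hk : k ∈ criticalOnes p q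
    · rw [hS.2.2.1 k hk, resOf_eq_true.2 (h1.1 hk)]
    · rw [hS.2.1 k hk, resOf_eq_false.2 (fun h => hk (h1.2 h))]
  rw [hDeg_eq, h, ones_resOf, Finset.card_insert_of_notMem (by simp [eq_cr_iff]),
    Finset.card_insert_of_notMem (by simp [eq_cr_iff]),
    Finset.card_pair (by simp [eq_cr_iff])]
  norm_num

/-- The class below the two diagonals of the homology in degree `0`. -/
theorem homologyRank_four_pos (hp : 3 ≤ p) (hq : 3 ≤ q) :
    0 < homologyRank (torusBraid p q) 4 (6 + (q * (p - 1) : ℕ) - p) := by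
  obtain ⟨a, ha⟩ := exists_critical hp hq
  have haC : a ∈ critical hp hq := by rw [ha]; exact Set.mem_singleton a
  have hM : ∀ S T : EnhancedState (torusBraid p q), diffCoeff S T ≠ 0 →
      (S ∈ {S | level S = 6} ↔ T ∈ {S : EnhancedState (torusBraid p q) | level S = 6}) := by
    intro S T h
    obtain ⟨k, hk⟩ := exists_edgeCoeff_ne_zero h
    simp only [Set.mem_ofPred_eq, level_of_edgeCoeff_ne_zero hk]
  obtain ⟨z, hz, hcyc, hb⟩ := exists_cycle_of_matched sum_diffCoeff_mul_diffCoeff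
    (fun S => S.hDeg) (fun S T h => hDeg_of_diffCoeff_ne_zero h) (M := {S | level S = 6})
    (P := residual p q) (A := {S | level S = 6} \ (residual p q ∪ critical hp hq)) (a := a)
    (n := 4) hM
    (fun S hS => by
      by_cases h : S ∈ residual p q ∪ critical hp hq
      · rcases h with h | h
        · exact Or.inl h
        · rw [ha] at h; exact Or.inr (Or.inl h)
      · exact Or.inr (Or.inr ⟨hS, h⟩))
    (fun S hS => hS.1) haC.1 Set.sdiff_subset (fun h => h.2 (Or.inr haC))
    (hDeg_of_mem_critical hp hq haC) (matched_level_six hp hq)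
    (fun T hT => by
      refine diffCoeff_eq_zero_of_res (k := cr 2 1 (by omega) (by omega))
        (haC.2.2.1 _ (by simp [criticalOnes])) (hT.2.1 _ (by simp)))
    (fun S hS T hT => by
      by_contra h
      exact hS.2 (Or.inl (mem_residual_of_diffCoeff hT h)))
    (residual_surjective hp hq)
  refine homologyRank_pos_of_total z (fun S hS => ?_) hcyc fun m hm y hy => hb m hm y fun S hS => ?_
  · obtain ⟨h1, h2⟩ := hz S hS
    refine ⟨h2, ?_⟩
    rw [qDeg_eq_level, show level S = 6 from h1]
  · obtain ⟨h1, h2⟩ := hy S hS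
    rw [qDeg_eq_level] at h2
    refine ⟨?_, h1⟩
    simp only [Set.mem_ofPred_eq]; omega

end Critical

end Khovanov

namespace Khovanov

open EnhancedState

/-! ### The homology in degree `0` -/

section Zero

variable {p : ℕ} {w : BraidWord p}

theorem resOf_empty (k : Fin w.length) : resOf ∅ k = false := resOf_eq_false.2 (by simp)

/-- In the 0-resolution of a positive braid, the state with the label `1` on the strand `s` and the
label `X` on the other strands. -/
noncomputable def strandState (hw : IsPositive w) (s : Fin p) : EnhancedState w :=
  indicator (resOf ∅) {v | v.1.val = s.val}
    (isClosedIn_strand hw fun l _ _ => resOf_empty l)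

theorem strandState_labelAt (hw : IsPositive w) {s : Fin p} {v : Node w} :
    (strandState hw s).labelAt v = if v.1 = s then .one else .X := by
  split_ifs with h
  · exact indicator_labelAt_of_mem _ (congrArg Fin.val h)
  · exact indicator_labelAt_of_notMem _ fun h' => h (Fin.ext h')

theorem level_strandState (hw : IsPositive w) (s : Fin p) : level (strandState hw s) = 2 := by
  rw [level_eq (strandState hw s) (s := ∅) rfl {(s, 0)}, card_circle_resOf_empty hw]
  · simp
  · simp
  · intro v hv
    rw [Finset.mem_singleton.1 hv, strandState_labelAt, if_pos rfl]
  · intro v hv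
    refine ⟨_, Finset.mem_singleton_self _, ?_⟩
    have h : v.1 = s := Fin.ext ((indicator_labelAt_eq_one _).1 hv)
    rw [← h]
    exact circleOf_strand hw (fun l _ => resOf_empty l) v.2

theorem circleOf_zero_eq_iff (hw : IsPositive w) {u v : Node w} :
    circleOf w (resOf ∅) u = circleOf w (resOf ∅) v ↔ u.1 = v.1 := by
  constructor
  · intro h
    by_contra hne
    refine (isClosedIn_strand hw (s := u.1.val) fun l _ _ => resOf_empty l).ne
      (u := u) (v := v) rfl (fun h' => hne (Fin.ext h'.symm)) h
  · intro h
    obtain ⟨s, x⟩ := u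
    obtain ⟨t, y⟩ := v
    obtain rfl : s = t := h
    rw [circleOf_strand hw (fun l _ => resOf_empty l) x,
      circleOf_strand hw (fun l _ => resOf_empty l) y]

/-- The two strands at a crossing are merged with the same result. -/
theorem edgeCoeff_strandState (hw : IsPositive w) {k : Fin w.length} {T : EnhancedState w}
    (hT : T.res = Function.update (resOf ∅) k true) :
    edgeCoeff k (strandState hw (leftPos w k)) T =
      edgeCoeff k (strandState hw (rightPos w k)) T := by
  classical
  have hne : circleOf w (resOf ∅) (cornerA w k) ≠ circleOf w (resOf ∅) (cornerB w k) :=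
    fun h => leftPos_ne_rightPos k ((circleOf_zero_eq_iff hw).1 h)
  have key : ∀ s, s = leftPos w k ∨ s = rightPos w k → edgeCoeff k (strandState hw s) T =
      if (∀ v : Node w, v.1 ≠ leftPos w k → v.1 ≠ rightPos w k → T.labelAt v = .X) then
        mulCoeff .one .X (T.labelAt (cornerA w k)) else 0 := by
    intro s hs
    split_ifs with h
    · rw [edgeCoeff_merge (resOf_empty k) hT hne, strandState_labelAt, strandState_labelAt]
      · change mulCoeff (if leftPos w k = s then _ else _) (if rightPos w k = s then _ else _) _ = _
        have := leftPos_ne_rightPos k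
        rcases hs with rfl | rfl
        · rw [if_pos rfl, if_neg this.symm]
        · rw [if_pos rfl, if_neg this]
          cases T.labelAt (cornerA w k) <;> rfl
      · intro v h1 h2
        have h1' : v.1 ≠ leftPos w k := fun e => h1 ((circleOf_zero_eq_iff hw).2 e)
        have h2' : v.1 ≠ rightPos w k := fun e => h2 ((circleOf_zero_eq_iff hw).2 e)
        rw [h v h1' h2', strandState_labelAt, if_neg]
        rcases hs with rfl | rfl
        · exact h1'
        · exact h2'
    · by_contra h0
      refine h fun v h1 h2 => ?_
      rw [labelAt_of_edgeCoeff_ne_zero h0 v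
        (fun e => h1 ((circleOf_zero_eq_iff hw).1 e)) (fun e => h2 ((circleOf_zero_eq_iff hw).1 e)),
        strandState_labelAt, if_neg]
      rcases hs with rfl | rfl
      · exact h1
      · exact h2
  rw [key _ (Or.inl rfl), key _ (Or.inr rfl)]

/-- A merge of two circles labelled `X` is zero. -/
theorem edgeCoeff_eq_zero_of_X {k : Fin w.length} {S T : EnhancedState w}
    (hne : circleOf w S.res (cornerA w k) ≠ circleOf w S.res (cornerB w k))
    (hA : S.labelAt (cornerA w k) = .X) (hB : S.labelAt (cornerB w k) = .X) :
    edgeCoeff k S T = 0 := by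
  by_contra h
  obtain ⟨h1, h2⟩ := res_of_edgeCoeff_ne_zero h
  rw [edgeCoeff_merge h1 h2 hne (labelAt_of_edgeCoeff_ne_zero h), hA, hB] at h
  exact h rfl

/-- The alternating sum of the states `strandState` is a cycle. -/
theorem sum_diffCoeff_strandState (hw : IsPositive w) (T : EnhancedState w) :
    ∑ s : Fin p, diffCoeff (strandState hw s) T * (-1) ^ s.val = 0 := by
  by_cases h : ∃ s, diffCoeff (strandState hw s) T ≠ 0
  swap
  · push Not at h
    simp [h]
  obtain ⟨s₀, hs₀⟩ := h
  obtain ⟨k, hk⟩ := exists_edgeCoeff_ne_zero hs₀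
  have hT : T.res = Function.update (resOf ∅) k true := (res_of_edgeCoeff_ne_zero hk).2
  have hTk : T.res k = true := by rw [hT, Function.update_self]
  have hdiff : ∀ s, diffCoeff (strandState hw s) T =
      edgeSign (resOf ∅) k * edgeCoeff k (strandState hw s) T :=
    fun s => diffCoeff_eq_edgeCoeff (resOf_empty k) hTk
  have hlr := leftPos_ne_rightPos k
  have hne : circleOf w (resOf ∅) (cornerA w k) ≠ circleOf w (resOf ∅) (cornerB w k) :=
    fun h => hlr ((circleOf_zero_eq_iff hw).1 h)
  rw [Finset.sum_eq_add (leftPos w k) (rightPos w k) hlr]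
  · rw [hdiff, hdiff, edgeCoeff_strandState hw hT, rightPos_val, pow_succ]; ring
  · rintro s - ⟨h1, h2⟩
    rw [hdiff, edgeCoeff_eq_zero_of_X hne]
    · ring
    · rw [strandState_labelAt]; exact if_neg h1.symm
    · rw [strandState_labelAt]; exact if_neg h2.symm
  · intro h; exact absurd (Finset.mem_univ _) h
  · intro h; exact absurd (Finset.mem_univ _) h

end Zero

section TorusLink

variable {p q : ℕ}

/-- There are no boundaries in homological degree `0`. -/
theorem homologyRank_zero_pos {ℓ : ℤ} (z : EnhancedState (torusBraid p q) → ℤ)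
    (hz : ∀ S, z S ≠ 0 → S.res = resOf ∅ ∧ level S = ℓ)
    (hcyc : ∀ T, applyMatrix diffCoeff z T = 0) {S₀ : EnhancedState (torusBraid p q)}
    (h₀ : z S₀ ≠ 0) : 0 < homologyRank (torusBraid p q) 0 (ℓ + (q * (p - 1) : ℕ) - p) := by
  refine homologyRank_pos_of_total z (fun S hS => ?_) hcyc fun m hm y hy h => ?_
  · obtain ⟨h1, h2⟩ := hz S hS
    refine ⟨?_, by rw [qDeg_eq_level, h2]⟩
    rw [hDeg_eq, h1, ones_resOf]; simp
  · have hy0 : ∀ S, y S = 0 := by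
      intro S
      by_contra hS
      have := (hy S hS).1
      rw [hDeg_eq] at this; omega
    have := h S₀
    rw [applyMatrix_eq_zero (fun S hS => absurd (hy0 S) hS)] at this
    exact mul_ne_zero hm h₀ this.symm

/-- The class of the state with all circles labelled `X`. -/
theorem homologyRank_zero_pos_lower :
    0 < homologyRank (torusBraid p q) 0 (0 + (q * (p - 1) : ℕ) - p) := by
  classical
  have hcl : IsClosedIn (resOf ∅) (∅ : Set (Node (torusBraid p q))) := fun _ _ _ => Iff.rfl
  have hX : ∀ v, (indicator (resOf ∅) _ hcl).labelAt v = .X :=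
    fun v => indicator_labelAt_of_notMem hcl (Set.notMem_empty v)
  refine homologyRank_zero_pos (fun S => if S = indicator (resOf ∅) _ hcl then 1 else 0)
    (fun S hS => ?_) (fun T => ?_) (S₀ := indicator (resOf ∅) _ hcl) (by simp)
  · have h : S = indicator (resOf ∅) _ hcl := by
      by_contra h; simp [h] at hS
    rw [h]
    refine ⟨rfl, ?_⟩
    rw [level_eq _ (s := ∅) rfl ∅, card_circle_resOf_empty isPositive_torusBraid]
    · simp
    · simp
    · simp
    · intro v hv; rw [hX] at hv; simp at hv
  · have h : applyMatrix diffCoeff (fun S => if S = indicator (resOf ∅) _ hcl then 1 else 0) T =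
        diffCoeff (indicator (resOf ∅) _ hcl) T := by simp [applyMatrix]
    rw [h]
    by_contra h0
    obtain ⟨k, hk⟩ := exists_edgeCoeff_ne_zero h0
    refine hk (edgeCoeff_eq_zero_of_X ?_ (hX _) (hX _))
    exact circleOf_corners_ne isPositive_torusBraid fun l _ => resOf_empty l

/-- The class of the alternating sum of the states with one strand labelled `1`. -/
theorem homologyRank_zero_pos_upper (hp : 0 < p) :
    0 < homologyRank (torusBraid p q) 0 (2 + (q * (p - 1) : ℕ) - p) := by
  classical
  have hw : IsPositive (torusBraid p q) := isPositive_torusBraid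
  have hinj : ∀ s t : Fin p, strandState hw s = strandState hw t → s = t := by
    intro s t h
    have := congrArg (fun S => S.labelAt (s, 0)) h
    simp only [strandState_labelAt, if_true] at this
    by_contra hne
    rw [if_neg hne] at this
    cases this
  refine homologyRank_zero_pos
    (fun S => ∑ s : Fin p, if S = strandState hw s then (-1) ^ s.val else 0)
    (fun S hS => ?_) (fun T => ?_) (S₀ := strandState hw ⟨0, hp⟩) ?_
  · obtain ⟨s, -, hs⟩ := Finset.exists_ne_zero_of_sum_ne_zero hS
    have h : S = strandState hw s := by
      by_contra h; simp [h] at hs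
    rw [h]
    exact ⟨rfl, level_strandState hw s⟩
  · refine Eq.trans ?_ (sum_diffCoeff_strandState hw T)
    simp only [applyMatrix, Finset.mul_sum]
    rw [Finset.sum_comm]
    refine Finset.sum_congr rfl fun s _ => ?_
    simp
  · rw [Finset.sum_eq_single ⟨0, hp⟩]
    · simp
    · intro t _ ht
      exact if_neg fun h => ht (hinj _ _ h).symm
    · intro h; exact absurd (Finset.mem_univ _) h

end TorusLink

end Khovanov

theorem corollary21 (p q : ℕ) (hp : 3 ≤ p) (hq : 3 ≤ q) :
    Khovanov.IsHThick (Khovanov.torusBraid p q) ∧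
      3 ≤ (Khovanov.diagonals (Khovanov.torusBraid p q)).encard := by
  have h3 : 3 ≤ (Khovanov.diagonals (Khovanov.torusBraid p q)).encard := by
    set d : ℤ := (q * (p - 1) : ℕ) - p
    have hsub : ({d, d + 2, d - 2} : Set ℤ) ⊆ Khovanov.diagonals (Khovanov.torusBraid p q) := by
      rintro a (rfl | rfl | rfl)
      · exact ⟨0, _, by ring, Khovanov.homologyRank_zero_pos_lower⟩
      · exact ⟨0, _, by ring, Khovanov.homologyRank_zero_pos_upper (by omega)⟩
      · exact ⟨4, _, by ring, Khovanov.homologyRank_four_pos hp hq⟩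
    refine le_trans (le_of_eq ?_) (Set.encard_le_encard hsub)
    rw [Set.encard_insert_of_notMem, Set.encard_pair]
    · norm_num
    · omega
    · simp only [Set.mem_insert_iff, Set.mem_singleton_iff]; omega
  refine ⟨fun h => ?_, h3⟩
  rw [Khovanov.IsHThin] at h
  rw [h] at h3
  exact absurd h3 (by norm_num)
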